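/- Let $T\ge 0$, $A,Q\in\mathbb R^{n\times n}$ with $Q\succeq 0$, and, for sensors $j=1,\dots,M$, let $H_j\in\mathbb R^{p_j\times n}$ and $R_j\in\mathbb R^{p_j\times p_j}$ with $R_j\succ0$. Put $$S_j=H_j^\top R_j^{-1}H_j,\qquad g_j(P)=PH_j^\top(H_jPH_j^\top+R_j)^{-1}H_jP .$$ Fix a deterministic schedule $\lambda=(\lambda_1,\dots,\lambda_M)$ of measurable, nonnegative, essentially bounded rates on $[0,T]$. On a filtered probability space let $N_1,\dots,N_M$ be independent Poisson processes, relative to the filtration, with intensities $\lambda_1(t),\dots,\lambda_M(t)$, and let $P(t)$, $t\in[0,T]$, be the error covariance of the continuous-discrete Kalman filter with measurement times given by these processes: $P$ is adapted, right-continuous with left limits, $P(0)\succ0$ is an (in general random) matrix, and almost surely $$dP(t)=\big(AP(t)+P(t)A^\top+Q\big)\,dt-\sum_{j=1}^M g_j(P(t^-))\,dN_j(t).$$ Let $Y(t)=P(t)^{-1}$ and assume that $\mathbb E\big[\|Y(t)\|_F^2+\|P(t)\|_F\,\big|\,Y(0)\big]<\infty$ almost surely for every $t\in[0,T]$. Let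 $\bar P(t)=\mathbb E[P(t)\mid P(0)]$. **Theorem (Schedule-wise deterministic bracket).** Let the symmetric-matrix-valued (absolutely continuous) trajectories $\hat Y,\hat P$ on $[0,T]$ satisfy $$\dot{\hat Y}=-\hat YA-A^\top\hat Y-\hat YQ\hat Y+\sum_{j=1}^M\lambda_j(t)S_j,\qquad \dot{\hat P}=A\hat P+\hat PA^\top+Q-\sum_{j=1}^M\lambda_j(t)g_j(\hat P)$$ almost surely, with the common initial conditions $\hat Y(0)=Y(0)=P(0)^{-1}$ and $\hat P(0)=P(0)$. Then, for every $t\in[0,T]$, almost surely $\hat Y(t)$ is positive definite and $$\hat Y(t)^{-1}\preceq\bar P(t)\preceq\hat P(t)$$ in the Loewner order. -/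

import Mathlib

open MeasureTheory ProbabilityTheory Set Filter Topology
open scoped Matrix MatrixOrder

noncomputable section

namespace CDKF

/-! ### Matrix-valued random variables and conditional means -/

/-- The (Borel) product σ-algebra on real matrices. -/
instance instMeasurableSpaceMatrix {m n : Type*} : MeasurableSpace (Matrix m n ℝ) :=
  inferInstanceAs (MeasurableSpace (m → n → ℝ))

/-- The Frobenius norm of a real matrix. -/
def frobNorm {m n : Type*} [Fintype m] [Fintype n] (X : Matrix m n ℝ) : ℝ :=
  Real.sqrt (∑ i, ∑ j, X i j ^ 2)

/-- `𝔼[X | Z]` has a finite value almost surely, that is `𝔼[|X| | Z] < ∞` a.s.; the expectation is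
taken under the regular conditional law of `X` given `Z`. -/
def CondIntegrable {Ω β : Type*} [MeasurableSpace Ω] [MeasurableSpace β]
    (μ : Measure Ω) [IsFiniteMeasure μ] (X : Ω → ℝ) (Z : Ω → β) : Prop :=
  ∀ᵐ ω ∂μ, Integrable (fun x : ℝ => x) (condDistrib X Z μ (Z ω))

/-- The conditional mean `𝔼[X | Z]` of a random matrix `X`, computed entrywise under the regular
conditional law given `Z`. It agrees a.s. with `μ[· | σ(Z)]` for integrable entries and it is also
the right object when the entries are only conditionally integrable. -/
def condMean {Ω β : Type*} [MeasurableSpace Ω] [MeasurableSpace β] {m n : Type*}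
    (μ : Measure Ω) [IsFiniteMeasure μ] (X : Ω → Matrix m n ℝ) (Z : Ω → β) (ω : Ω) :
    Matrix m n ℝ :=
  Matrix.of fun i k => ∫ x, x ∂(condDistrib (fun ω' => X ω' i k) Z μ (Z ω))

/-! ### Integrals of matrix-valued paths and Carathéodory solutions -/

/-- Entrywise integral `∫₀ᵗ F(s) ds`. -/
def matIntegral {m n : Type*} (F : ℝ → Matrix m n ℝ) (t : ℝ) : Matrix m n ℝ :=
  Matrix.of fun i k => ∫ s in (0 : ℝ)..t, F s i k

/-- `x` is a (Carathéodory, i.e. absolutely continuous) solution on `[0, T]`, with values in the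
space of symmetric matrices, of the matrix differential equation `ẋ(t) = F(t, x(t))`. -/
structure IsSolution {n : ℕ} (T : ℝ)
    (F : ℝ → Matrix (Fin n) (Fin n) ℝ → Matrix (Fin n) (Fin n) ℝ)
    (x : ℝ → Matrix (Fin n) (Fin n) ℝ) : Prop where
  isSymm : ∀ t ∈ Icc 0 T, (x t).IsSymm
  continuousOn : ContinuousOn x (Icc 0 T)
  integrable : ∀ i k, IntervalIntegrable (fun s => F s (x s) i k) volume 0 T
  eq : ∀ t ∈ Icc 0 T, x t = x 0 + matIntegral (fun s => F s (x s)) t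

/-! ### Kalman filter maps -/

/-- Information gain `S = Hᵀ R⁻¹ H` of a measurement `y = H x + v`, `v ∼ 𝒩(0, R)`. -/
def infoGain {n p : ℕ} (H : Matrix (Fin p) (Fin n) ℝ) (R : Matrix (Fin p) (Fin p) ℝ) :
    Matrix (Fin n) (Fin n) ℝ :=
  Hᵀ * R⁻¹ * H

/-- Covariance reduction `g(P) = P Hᵀ (H P Hᵀ + R)⁻¹ H P` of a measurement `y = H x + v`,
`v ∼ 𝒩(0, R)`: the Kalman update is `P ↦ P - g(P)`. -/
def covGain {n p : ℕ} (H : Matrix (Fin p) (Fin n) ℝ) (R : Matrix (Fin p) (Fin p) ℝ)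
    (P : Matrix (Fin n) (Fin n) ℝ) : Matrix (Fin n) (Fin n) ℝ :=
  P * Hᵀ * (H * P * Hᵀ + R)⁻¹ * H * P

/-- Right-hand side of the information-form surrogate
`Ẏ = -Y A - Aᵀ Y - Y Q Y + ∑ⱼ λⱼ(t) Sⱼ`. -/
def infoField {n M : ℕ} {p : Fin M → ℕ} (A Q : Matrix (Fin n) (Fin n) ℝ)
    (H : (j : Fin M) → Matrix (Fin (p j)) (Fin n) ℝ)
    (R : (j : Fin M) → Matrix (Fin (p j)) (Fin (p j)) ℝ) (lam : Fin M → ℝ → ℝ)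
    (t : ℝ) (Y : Matrix (Fin n) (Fin n) ℝ) : Matrix (Fin n) (Fin n) ℝ :=
  -(Y * A) - Aᵀ * Y - Y * Q * Y + ∑ j, lam j t • infoGain (H j) (R j)

/-- Right-hand side of the covariance-form surrogate
`Ṗ = A P + P Aᵀ + Q - ∑ⱼ λⱼ(t) gⱼ(P)`. -/
def covField {n M : ℕ} {p : Fin M → ℕ} (A Q : Matrix (Fin n) (Fin n) ℝ)
    (H : (j : Fin M) → Matrix (Fin (p j)) (Fin n) ℝ)
    (R : (j : Fin M) → Matrix (Fin (p j)) (Fin (p j)) ℝ) (lam : Fin M → ℝ → ℝ)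
    (t : ℝ) (P : Matrix (Fin n) (Fin n) ℝ) : Matrix (Fin n) (Fin n) ℝ :=
  A * P + P * Aᵀ + Q - ∑ j, lam j t • covGain (H j) (R j) P

/-! ### Schedules and measurement arrivals -/

/-- A deterministic schedule of measurement rates on `[0, T]`: each rate is measurable,
nonnegative and essentially bounded. -/
structure IsSchedule {M : ℕ} (T : ℝ) (lam : Fin M → ℝ → ℝ) : Prop where
  aemeasurable : ∀ j, AEMeasurable (lam j) (volume.restrict (Icc 0 T))
  nonneg : ∀ j, ∀ᵐ t ∂(volume.restrict (Icc 0 T)), 0 ≤ lam j t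
  bounded : ∃ C : ℝ, ∀ j, ∀ᵐ t ∂(volume.restrict (Icc 0 T)), lam j t ≤ C

/-- `N 1, …, N M` are independent (inhomogeneous) Poisson processes on `[0, T]` with intensities
`lam 1, …, lam M`, relative to the filtration `ℱ`: they are adapted, start at `0`, have
nondecreasing right-continuous paths, their joint increments after time `s` are independent of
`ℱ s`, and `N j t - N j s` has the Poisson law with mean `∫ₛᵗ lam j`. -/
structure IsPoissonFamily {Ω : Type*} [mΩ : MeasurableSpace Ω] (μ : Measure Ω)
    (ℱ : Filtration ℝ mΩ) {M : ℕ} (T : ℝ) (lam : Fin M → ℝ → ℝ) (N : Fin M → ℝ → Ω → ℕ) :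
    Prop where
  adapted : ∀ j, ∀ t ∈ Icc 0 T, Measurable[ℱ t] (N j t)
  zero : ∀ j, ∀ᵐ ω ∂μ, N j 0 ω = 0
  monotone : ∀ j, ∀ᵐ ω ∂μ, MonotoneOn (fun t => N j t ω) (Icc 0 T)
  rightContinuous : ∀ j, ∀ᵐ ω ∂μ, ∀ t ∈ Ico 0 T,
    ContinuousWithinAt (fun s => N j s ω) (Ici t) t
  indepIncrements : ∀ s ∈ Icc 0 T, ∀ t ∈ Icc 0 T, s ≤ t →
    Indep (MeasurableSpace.comap (fun ω j => N j t ω - N j s ω) inferInstance) (ℱ s) μ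
  law : ∀ j, ∀ s ∈ Icc 0 T, ∀ t ∈ Icc 0 T, s ≤ t →
    μ.map (fun ω => N j t ω - N j s ω) = poissonMeasure (∫ r in s..t, lam j r).toNNReal
  indep : iIndepFun (fun j ω (t : Icc (0 : ℝ) T) => N j t ω) μ

/-- The integral `∫_{(0,t]} F(s) dN(s)` against a counting path `N`, i.e. the sum over the jump
times `s ∈ (0, t]` of `N` of the jump size times `F(s)`. -/
def countingIntegral {m n : Type*} (N : ℝ → ℕ) (F : ℝ → Matrix m n ℝ) (t : ℝ) : Matrix m n ℝ :=
  ∑ᶠ s ∈ Ioc 0 t, ((N s : ℝ) - ((Function.leftLim N s : ℕ) : ℝ)) • F s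

/-! ### The continuous-discrete Kalman filter covariance -/

/-- A path `P` of the error covariance of the continuous-discrete Kalman filter on `[0, T]`, where
`N j` counts the measurements taken so far by sensor `j`: `P` is right-continuous with left limits,
and `dP(t) = (A P(t) + P(t) Aᵀ + Q) dt - ∑ⱼ gⱼ(P(t⁻)) dNⱼ(t)`, so that `P` follows the Lyapunov
equation between measurements and is updated by `P ↦ P - gⱼ(P)` at a measurement of sensor `j`. -/
structure IsCovPath {n M : ℕ} {p : Fin M → ℕ} (T : ℝ) (A Q : Matrix (Fin n) (Fin n) ℝ)
    (H : (j : Fin M) → Matrix (Fin (p j)) (Fin n) ℝ)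
    (R : (j : Fin M) → Matrix (Fin (p j)) (Fin (p j)) ℝ)
    (N : Fin M → ℝ → ℕ) (P : ℝ → Matrix (Fin n) (Fin n) ℝ) : Prop where
  rightContinuous : ∀ t ∈ Ico 0 T, ContinuousWithinAt P (Ici t) t
  leftLimits : ∀ t ∈ Ioc 0 T, ∃ L, Tendsto P (𝓝[<] t) (𝓝 L)
  eq : ∀ t ∈ Icc 0 T,
    P t = P 0 + matIntegral (fun s => A * P s + P s * Aᵀ + Q) t
      - ∑ j, countingIntegral (N j) (fun s => covGain (H j) (R j) (Function.leftLim P s)) t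

/-- The random error covariance `P` of the continuous-discrete Kalman filter under the schedule
`lam`, on a filtered probability space: `P` is adapted with `P(0) ≻ 0`, the measurements of the
sensors arrive according to independent Poisson processes `N j` with intensities `lam j`, and a.s.
the path of `P` follows the filter dynamics. (The `ℱ 0`-measurable initial covariance is then
independent of the arrivals.) -/
structure IsCovProcess {Ω : Type*} [mΩ : MeasurableSpace Ω] (μ : Measure Ω)
    (ℱ : Filtration ℝ mΩ) {n M : ℕ} {p : Fin M → ℕ} (T : ℝ) (A Q : Matrix (Fin n) (Fin n) ℝ)
    (H : (j : Fin M) → Matrix (Fin (p j)) (Fin n) ℝ)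
    (R : (j : Fin M) → Matrix (Fin (p j)) (Fin (p j)) ℝ) (lam : Fin M → ℝ → ℝ)
    (N : Fin M → ℝ → Ω → ℕ) (P : ℝ → Ω → Matrix (Fin n) (Fin n) ℝ) : Prop where
  poisson : IsPoissonFamily μ ℱ T lam N
  adapted : ∀ t ∈ Icc 0 T, Measurable[ℱ t] (P t)
  posDef_init : ∀ᵐ ω ∂μ, (P 0 ω).PosDef
  path : ∀ᵐ ω ∂μ, IsCovPath T A Q H R (fun j t => N j t ω) (fun t => P t ω)

/-- Conditional moment condition: `𝔼[‖Y(t)‖_F² + ‖P(t)‖_F | Y(0)] < ∞` a.s. for all `t ∈ [0, T]`,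
where `Y(t) = P(t)⁻¹` is the information matrix. -/
def FiniteMoments {Ω : Type*} [MeasurableSpace Ω] (μ : Measure Ω) [IsFiniteMeasure μ] {n : ℕ}
    (T : ℝ) (P : ℝ → Ω → Matrix (Fin n) (Fin n) ℝ) : Prop :=
  ∀ t ∈ Icc 0 T,
    CondIntegrable μ (fun ω => frobNorm (P t ω)⁻¹ ^ 2 + frobNorm (P t ω)) (fun ω => (P 0 ω)⁻¹)

end CDKF

end

open scoped Matrix.Norms.Frobenius

namespace CDKF

/-! ### The Loewner order on real matrices -/

section Loewner

variable {m n : ℕ}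

/-! Both bounds come from writing a concave right-hand side as an infimum of affine ones. For the
covariance, the drift is affine and a measurement update satisfies X - g(X) ≤ (1 - KH) X (1 - KH)ᵀ +
K R Kᵀ for every gain K, with equality at the Kalman gain (`joseph_form`, `sub_covGain_le`). For the
information matrix Y = P⁻¹, a measurement adds the constant S (`inv_sub_covGain`), and the concave
drift term -YQY lies below its tangent at every Z (`tangent_le_mul_mul`). So P and Y are each
dominated by a whole family of affine dynamics with jumps, one for each K or Z (`covCoeffs`,
`infoCoeffs`).

Affine bounds survive conditional expectation. Over a time h with Δ jumps in total, the path lies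
below a first-order affine step up to an error of order h² + hΔ + Δ(Δ - 1) (`IsJumpPath.le_step`).
Increments after time s are independent of the past, so conditioning on P(0) replaces the counts by
∫ λ_j and the error by O(h²) (`exists_condExp_le_step`). The conditional means of P and Y are
therefore discrete subsolutions on all dyadic grids, for all affine coefficients at once
(`ae_isDiscreteSubsolution`). At each grid time the coefficient tangent at the surrogate solution is
selected: the affine field then equals the nonlinear one at that solution, and since an affine step
is monotone up to O(h²), a discrete Grönwall argument puts the subsolution below the solution
(`IsDiscreteSubsolution.le_of_linearized`). This gives E[P | P(0)] ≤ P̂ and E[Y | P(0)] ≤ Ŷ.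

The lower bound is Jensen's inequality for the inverse in tangent form: Z + Zᵀ - Z Y Zᵀ ≤ P for all
Z is affine in (P, Y), hence passes to conditional means (`ae_tangent_le_condExp`). Taking Z = Ŷ⁻¹
and using E[Y | P(0)] ≤ Ŷ yields Ŷ⁻¹ ≤ E[P | P(0)]. The same inequality, with scalar Z and bounded
traces, keeps both means uniformly positive. This makes Ŷ positive definite, and it allows a
continuation argument showing that P̂ stays positive semidefinite, so that its Kalman gain is
available.

Integrability is obtained by localizing to events on which the traces of P(0) and P(0)⁻¹ are
bounded; these events exhaust the space. -/

theorem posSemidef_iff_transpose {X : Matrix (Fin n) (Fin n) ℝ} :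
    X.PosSemidef ↔ Xᵀ = X ∧ ∀ v : Fin n → ℝ, 0 ≤ v ⬝ᵥ X *ᵥ v := by
  rw [Matrix.posSemidef_iff_dotProduct_mulVec]
  simp [Matrix.IsHermitian]

theorem le_iff_transpose {X Y : Matrix (Fin n) (Fin n) ℝ} (hX : Xᵀ = X) (hY : Yᵀ = Y) :
    X ≤ Y ↔ ∀ v : Fin n → ℝ, v ⬝ᵥ X *ᵥ v ≤ v ⬝ᵥ Y *ᵥ v := by
  rw [Matrix.le_iff, posSemidef_iff_transpose]
  simp [hX, hY, Matrix.sub_mulVec, dotProduct_sub]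

theorem dotProduct_mulVec_le {X Y : Matrix (Fin n) (Fin n) ℝ} (h : X ≤ Y) (v : Fin n → ℝ) :
    v ⬝ᵥ X *ᵥ v ≤ v ⬝ᵥ Y *ᵥ v := by
  have := (posSemidef_iff_transpose.1 (Matrix.le_iff.1 h)).2 v
  simpa [Matrix.sub_mulVec, dotProduct_sub] using this

theorem _root_.Matrix.PosSemidef.transpose_eq {X : Matrix (Fin n) (Fin n) ℝ}
    (h : X.PosSemidef) : Xᵀ = X := (posSemidef_iff_transpose.1 h).1

theorem _root_.Matrix.PosSemidef.conj {X : Matrix (Fin n) (Fin n) ℝ} (h : X.PosSemidef)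
    (G : Matrix (Fin m) (Fin n) ℝ) : (G * X * Gᵀ).PosSemidef := by
  simpa using h.mul_mul_conjTranspose_same G

theorem conj_le_conj {X Y : Matrix (Fin n) (Fin n) ℝ} (h : X ≤ Y)
    (G : Matrix (Fin m) (Fin n) ℝ) : G * X * Gᵀ ≤ G * Y * Gᵀ := by
  have := (Matrix.le_iff.1 h).conj G
  rw [Matrix.le_iff]
  rwa [Matrix.mul_sub, Matrix.sub_mul] at this

theorem smul_one_le_smul_one {a b : ℝ} (h : a ≤ b) :
    a • (1 : Matrix (Fin n) (Fin n) ℝ) ≤ b • 1 := by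
  rw [Matrix.le_iff, ← sub_smul]
  exact Matrix.PosSemidef.one.smul (sub_nonneg.2 h)

theorem smul_le_smul_of_nonneg {a : ℝ} (ha : 0 ≤ a) {X Y : Matrix (Fin n) (Fin n) ℝ}
    (h : X ≤ Y) : a • X ≤ a • Y := by
  rw [Matrix.le_iff, ← smul_sub]
  exact (Matrix.le_iff.1 h).smul ha

theorem trace_le_trace {X Y : Matrix (Fin n) (Fin n) ℝ} (h : X ≤ Y) : X.trace ≤ Y.trace := by
  have := (Matrix.le_iff.1 h).trace_nonneg
  rwa [Matrix.trace_sub, sub_nonneg] at this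

theorem frobenius_sq (X : Matrix (Fin m) (Fin n) ℝ) : ‖X‖ ^ 2 = ∑ i, ∑ j, X i j ^ 2 := by
  have h0 : 0 ≤ ∑ i, ∑ j, X i j ^ 2 := by positivity
  rw [Matrix.frobenius_norm_def, ← Real.sqrt_eq_rpow, Real.sq_sqrt] <;> simp [h0]

theorem abs_entry_le_norm (X : Matrix (Fin m) (Fin n) ℝ) (i : Fin m) (j : Fin n) :
    |X i j| ≤ ‖X‖ := by
  apply abs_le_of_sq_le_sq _ (norm_nonneg _)
  rw [frobenius_sq]
  calc X i j ^ 2 ≤ ∑ j, X i j ^ 2 :=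
        Finset.single_le_sum (f := fun j => X i j ^ 2) (fun _ _ => sq_nonneg _) (Finset.mem_univ j)
    _ ≤ _ := Finset.single_le_sum (f := fun i => ∑ j, X i j ^ 2)
        (fun _ _ => by positivity) (Finset.mem_univ i)

theorem norm_le_sum_abs (X : Matrix (Fin m) (Fin n) ℝ) : ‖X‖ ≤ ∑ i, ∑ j, |X i j| := by
  apply le_of_sq_le_sq _ (by positivity)
  rw [frobenius_sq, ← Finset.sum_product', ← Finset.sum_product']
  simp only [← sq_abs (X _ _)]
  exact Finset.sum_sq_le_sq_sum_of_nonneg fun _ _ => abs_nonneg _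

theorem abs_trace_le (X : Matrix (Fin n) (Fin n) ℝ) : |X.trace| ≤ n * ‖X‖ := by
  calc |X.trace| ≤ ∑ i, |X i i| := by
        simpa [Matrix.trace] using Finset.abs_sum_le_sum_abs (fun i => X i i) Finset.univ
    _ ≤ ∑ _i : Fin n, ‖X‖ := Finset.sum_le_sum fun i _ => abs_entry_le_norm X i i
    _ = _ := by simp

theorem abs_dotProduct_mulVec_le (X : Matrix (Fin n) (Fin n) ℝ) (v : Fin n → ℝ) :
    |v ⬝ᵥ X *ᵥ v| ≤ ‖X‖ * (v ⬝ᵥ v) := by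
  have hv : 0 ≤ v ⬝ᵥ v := by simpa [dotProduct] using Finset.sum_nonneg fun i _ => mul_self_nonneg (v i)
  apply abs_le_of_sq_le_sq _ (by positivity)
  have e : v ⬝ᵥ X *ᵥ v = ∑ p : Fin n × Fin n, X p.1 p.2 * (v p.1 * v p.2) := by
    rw [← Finset.univ_product_univ, Finset.sum_product]
    simp only [dotProduct, Matrix.mulVec, Finset.mul_sum]
    exact Finset.sum_congr rfl fun i _ => Finset.sum_congr rfl fun j _ => by ring
  rw [e, mul_pow, frobenius_sq]
  refine (Finset.sum_mul_sq_le_sq_mul_sq _ _ _).trans (le_of_eq ?_)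
  rw [← Finset.univ_product_univ, Finset.sum_product, Finset.sum_product]
  congr 1
  simp only [dotProduct, sq, Finset.sum_mul_sum]
  exact Finset.sum_congr rfl fun i _ => Finset.sum_congr rfl fun j _ => by ring

theorem dotProduct_one_smul (a : ℝ) (v : Fin n → ℝ) :
    v ⬝ᵥ (a • (1 : Matrix (Fin n) (Fin n) ℝ)) *ᵥ v = a * (v ⬝ᵥ v) := by
  simp [Matrix.smul_mulVec]

theorem le_norm_smul_one {X : Matrix (Fin n) (Fin n) ℝ} (hX : Xᵀ = X) {c : ℝ} (h : ‖X‖ ≤ c) :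
    X ≤ c • 1 := by
  rw [le_iff_transpose hX (by simp)]
  intro v
  have hv : 0 ≤ v ⬝ᵥ v := by simpa [dotProduct] using Finset.sum_nonneg fun i _ => mul_self_nonneg (v i)
  rw [dotProduct_one_smul]
  exact (le_abs_self _).trans ((abs_dotProduct_mulVec_le X v).trans (by gcongr))

theorem neg_norm_smul_one_le {X : Matrix (Fin n) (Fin n) ℝ} (hX : Xᵀ = X) {c : ℝ}
    (h : ‖X‖ ≤ c) : -(c • 1) ≤ X := by
  have := le_norm_smul_one (X := -X) (c := c) (by simp [hX]) (by simpa using h)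
  exact neg_le.1 this

/-- The 2 × 2 principal minors give X_ij² ≤ X_ii X_jj, and summing over i and j gives the squared
trace. This lets the trace, which is linear, control all norms below. -/
theorem norm_le_trace {X : Matrix (Fin n) (Fin n) ℝ} (h : X.PosSemidef) : ‖X‖ ≤ X.trace := by
  apply le_of_sq_le_sq _ h.trace_nonneg
  have key : ∀ i j, X i j ^ 2 ≤ X i i * X j j := by
    intro i j
    have hs : X j i = X i j := congr_fun (congr_fun h.transpose_eq i) j
    have hq : ∀ a b : ℝ, 0 ≤ a ^ 2 * X i i + 2 * a * b * X i j + b ^ 2 * X j j := by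
      intro a b
      have := (posSemidef_iff_transpose.1 h).2 (a • Pi.single i 1 + b • Pi.single j 1)
      simp only [Matrix.mulVec_add, Matrix.mulVec_smul, add_dotProduct, dotProduct_add,
        smul_dotProduct, dotProduct_smul, Matrix.mulVec_single_one, single_one_dotProduct,
        Matrix.col_apply, smul_eq_mul, hs] at this
      nlinarith [this]
    have hi : 0 ≤ X i i := h.diag_nonneg
    have hj : 0 ≤ X j j := h.diag_nonneg
    rcases hj.eq_or_lt with hj | hj
    · by_contra hc
      have hx : X i j ≠ 0 := by rintro h0; apply hc; rw [h0, ← hj]; simp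
      -- When X_jj = 0 the form is affine in b; this b gives it the value -1.
      have := hq 1 (-(X i i + 1) / (2 * X i j))
      rw [← hj] at this
      have e : 2 * 1 * (-(X i i + 1) / (2 * X i j)) * X i j = -(X i i + 1) := by field_simp
      rw [e] at this
      linarith
    -- The form takes the value X_jj (X_ii X_jj - X_ij²) here.
    · have := hq (X j j) (-X i j)
      nlinarith [this]
  rw [frobenius_sq, sq, Matrix.trace, Finset.sum_mul_sum]
  exact Finset.sum_le_sum fun i _ => Finset.sum_le_sum fun j _ => key i j

theorem le_trace_smul_one {X : Matrix (Fin n) (Fin n) ℝ} (h : X.PosSemidef) : X ≤ X.trace • 1 :=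
  le_norm_smul_one h.transpose_eq (norm_le_trace h)

theorem norm_one_le : ‖(1 : Matrix (Fin n) (Fin n) ℝ)‖ ≤ n := by
  refine (norm_le_trace Matrix.PosSemidef.one).trans ?_
  simp [Matrix.trace]

end Loewner

end CDKF

namespace CDKF

/-! ### Algebra of the Kalman update -/

section Kalman

variable {n p : ℕ} {H : Matrix (Fin p) (Fin n) ℝ} {R : Matrix (Fin p) (Fin p) ℝ}
  {X : Matrix (Fin n) (Fin n) ℝ}

theorem le_of_posSemidef_of_sub_eq {X Y D : Matrix (Fin n) (Fin n) ℝ} (h : D.PosSemidef)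
    (e : Y - X = D) : X ≤ Y := by
  rw [Matrix.le_iff, e]; exact h

theorem innovation_posDef (hR : R.PosDef) (hX : X.PosSemidef) : (H * X * Hᵀ + R).PosDef :=
  Matrix.PosDef.posSemidef_add (hX.conj H) hR

/-- The Kalman gain `X Hᵀ (H X Hᵀ + R)⁻¹`. -/
noncomputable def kalmanGain (H : Matrix (Fin p) (Fin n) ℝ) (R : Matrix (Fin p) (Fin p) ℝ)
    (X : Matrix (Fin n) (Fin n) ℝ) : Matrix (Fin n) (Fin p) ℝ :=
  X * Hᵀ * (H * X * Hᵀ + R)⁻¹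

theorem _root_.Matrix.PosDef.mul_inv_self {Y : Matrix (Fin n) (Fin n) ℝ} (h : Y.PosDef) :
    Y * Y⁻¹ = 1 := Matrix.mul_nonsing_inv _ ((Matrix.isUnit_iff_isUnit_det _).1 h.isUnit)

theorem _root_.Matrix.PosDef.inv_mul_self {Y : Matrix (Fin n) (Fin n) ℝ} (h : Y.PosDef) :
    Y⁻¹ * Y = 1 := Matrix.nonsing_inv_mul _ ((Matrix.isUnit_iff_isUnit_det _).1 h.isUnit)

/-- Completion of the square in K: with S = H X Hᵀ + R, both sides equal X - K H X - X Hᵀ Kᵀ + K S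
Kᵀ. The excess over the optimal update is thus a congruence of S. -/
theorem joseph_form (hR : R.PosDef) (hX : X.PosSemidef) (K : Matrix (Fin n) (Fin p) ℝ) :
    (1 - K * H) * X * (1 - K * H)ᵀ + K * R * Kᵀ = X - covGain H R X +
      (K - kalmanGain H R X) * (H * X * Hᵀ + R) * (K - kalmanGain H R X)ᵀ := by
  have hS := innovation_posDef (H := H) hR hX
  have hSi : ((H * X * Hᵀ + R)⁻¹)ᵀ = (H * X * Hᵀ + R)⁻¹ := hS.inv.posSemidef.transpose_eq
  have h1 := hS.mul_inv_self
  have h2 := hS.inv_mul_self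
  have hXt := hX.transpose_eq
  set S := H * X * Hᵀ + R with hSdef
  have hRS : R = S - H * X * Hᵀ := by rw [hSdef]; abel
  have e1 : kalmanGain H R X * S = X * Hᵀ := by
    rw [kalmanGain, ← hSdef, Matrix.mul_assoc, h2, Matrix.mul_one]
  have e2 : (kalmanGain H R X)ᵀ = S⁻¹ * H * X := by
    rw [kalmanGain, ← hSdef]
    simp only [Matrix.transpose_mul, hSi, hXt, Matrix.transpose_transpose, Matrix.mul_assoc]
  have e3 : covGain H R X = kalmanGain H R X * H * X := by
    simp only [covGain, kalmanGain]
  have e4 : kalmanGain H R X * (S * S⁻¹ * H * X) = kalmanGain H R X * H * X := by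
    rw [h1]; simp [Matrix.mul_assoc]
  have expand : (K - kalmanGain H R X) * S * (K - kalmanGain H R X)ᵀ
      = K * S * Kᵀ - X * Hᵀ * Kᵀ - K * H * X + kalmanGain H R X * H * X := by
    rw [Matrix.transpose_sub, e2, Matrix.sub_mul, e1, Matrix.sub_mul, Matrix.mul_sub,
      Matrix.mul_sub]
    have a1 : K * S * (S⁻¹ * H * X) = K * H * X := by
      calc K * S * (S⁻¹ * H * X) = K * ((S * S⁻¹) * (H * X)) := by simp only [Matrix.mul_assoc]
        _ = _ := by rw [h1]; simp [Matrix.mul_assoc]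
    have a2 : X * Hᵀ * (S⁻¹ * H * X) = kalmanGain H R X * H * X := by
      rw [kalmanGain, ← hSdef]
      simp only [Matrix.mul_assoc]
    rw [a1, a2]
    abel
  rw [expand, e3, hRS]
  simp only [Matrix.sub_mul, Matrix.mul_sub, Matrix.transpose_sub, Matrix.transpose_one,
    Matrix.transpose_mul, Matrix.mul_one, Matrix.one_mul, Matrix.mul_assoc]
  abel

theorem joseph_form_kalmanGain (hR : R.PosDef) (hX : X.PosSemidef) :
    (1 - kalmanGain H R X * H) * X * (1 - kalmanGain H R X * H)ᵀ
      + kalmanGain H R X * R * (kalmanGain H R X)ᵀ = X - covGain H R X := by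
  rw [joseph_form hR hX]; simp

/-- Every gain gives an affine majorant of the update, since the square in the Joseph form is
positive semidefinite. -/
theorem sub_covGain_le (hR : R.PosDef) (hX : X.PosSemidef) (K : Matrix (Fin n) (Fin p) ℝ) :
    X - covGain H R X ≤ (1 - K * H) * X * (1 - K * H)ᵀ + K * R * Kᵀ := by
  rw [joseph_form hR hX, Matrix.le_iff, add_sub_cancel_left]
  exact (innovation_posDef hR hX).posSemidef.conj _

theorem infoGain_posSemidef (hR : R.PosDef) : (infoGain H R).PosSemidef := by
  simpa [infoGain] using hR.inv.posSemidef.conj Hᵀ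

/-- The Woodbury identity, which reduces to D (S - R) R⁻¹ = R⁻¹ - D for D = S⁻¹ and S = H X Hᵀ + R.
-/
theorem sub_covGain_mul (hR : R.PosDef) (hX : X.PosDef) :
    (X - covGain H R X) * (X⁻¹ + infoGain H R) = 1 := by
  have hS := innovation_posDef (H := H) hR hX.posSemidef
  have h1 := hS.inv_mul_self
  have hX1 := hX.mul_inv_self
  have hR1 := hR.mul_inv_self
  have hS2 : (H * X * Hᵀ + R)⁻¹ * (H * X * Hᵀ) * R⁻¹ = R⁻¹ - (H * X * Hᵀ + R)⁻¹ := by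
    have : (H * X * Hᵀ + R)⁻¹ * ((H * X * Hᵀ + R) * R⁻¹) = R⁻¹ := by
      rw [← Matrix.mul_assoc, h1, Matrix.one_mul]
    rw [Matrix.add_mul, hR1, Matrix.mul_add, Matrix.mul_one] at this
    rw [← this, add_sub_cancel_right, Matrix.mul_assoc]
    simp [this]
  set D := (H * X * Hᵀ + R)⁻¹ with hD
  have a1 : covGain H R X * X⁻¹ = X * Hᵀ * D * H := by
    rw [covGain, Matrix.mul_assoc _ X, hX1, Matrix.mul_one]
  have a2 : covGain H R X * infoGain H R = X * Hᵀ * (D * (H * X * Hᵀ) * R⁻¹) * H := by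
    rw [covGain, ← hD]
    simp only [infoGain, Matrix.mul_assoc]
  rw [Matrix.sub_mul, Matrix.mul_add, Matrix.mul_add, hX1, a1, a2, hS2, infoGain]
  simp only [Matrix.sub_mul, Matrix.mul_sub, Matrix.mul_assoc]
  abel

theorem inv_add_infoGain_posDef (hR : R.PosDef) (hX : X.PosDef) :
    (X⁻¹ + infoGain H R).PosDef :=
  hX.inv.add_posSemidef (infoGain_posSemidef hR)

theorem inv_sub_covGain (hR : R.PosDef) (hX : X.PosDef) :
    (X - covGain H R X)⁻¹ = X⁻¹ + infoGain H R :=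
  Matrix.inv_eq_right_inv (sub_covGain_mul hR hX)

theorem sub_covGain_posDef (hR : R.PosDef) (hX : X.PosDef) : (X - covGain H R X).PosDef := by
  have : X - covGain H R X = (X⁻¹ + infoGain H R)⁻¹ :=
    (Matrix.inv_eq_left_inv (sub_covGain_mul hR hX)).symm
  rw [this]
  exact (inv_add_infoGain_posDef hR hX).inv

/-- The tangent inequality for the matrix inverse. -/
theorem tangent_le_of_posDef (hX : X.PosDef) (Z : Matrix (Fin n) (Fin n) ℝ) :
    Z + Zᵀ - Z * X⁻¹ * Zᵀ ≤ X := by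
  -- The difference of the two sides is (X - Z) X⁻¹ (X - Z)ᵀ.
  have h := hX.inv.posSemidef.conj (X - Z)
  have h1 := hX.mul_inv_self
  have h2 := hX.inv_mul_self
  refine le_of_posSemidef_of_sub_eq h ?_
  rw [Matrix.transpose_sub, hX.posSemidef.transpose_eq]
  simp only [Matrix.sub_mul, Matrix.mul_sub, h1, Matrix.mul_assoc, h2, Matrix.mul_one,
    Matrix.one_mul]
  abel

/-- The tangent inequality for the quadratic term of the Riccati equation. -/
theorem tangent_le_mul_mul {Q Y : Matrix (Fin n) (Fin n) ℝ} (hQ : Q.PosSemidef) (hY : Yᵀ = Y)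
    (Z : Matrix (Fin n) (Fin n) ℝ) : Zᵀ * Q * Y + Y * Q * Z - Zᵀ * Q * Z ≤ Y * Q * Y := by
  have h := hQ.conj (Y - Zᵀ)
  refine le_of_posSemidef_of_sub_eq h ?_
  rw [Matrix.transpose_sub, hY, Matrix.transpose_transpose]
  simp only [Matrix.sub_mul, Matrix.mul_sub]
  abel

end Kalman

end CDKF

namespace CDKF

/-! ### Matrix differential inequalities -/

section Flow

variable {n : ℕ}

/-- The quadratic form `X ↦ vᵀ X v` as a continuous linear functional. -/
noncomputable def quadCLM (v : Fin n → ℝ) : Matrix (Fin n) (Fin n) ℝ →L[ℝ] ℝ :=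
  LinearMap.toContinuousLinearMap
    { toFun := fun X => v ⬝ᵥ X *ᵥ v
      map_add' := fun X Y => by simp [Matrix.add_mulVec, dotProduct_add]
      map_smul' := fun a X => by simp [Matrix.smul_mulVec] }

@[simp] theorem quadCLM_apply (v : Fin n → ℝ) (X : Matrix (Fin n) (Fin n) ℝ) :
    quadCLM v X = v ⬝ᵥ X *ᵥ v := rfl

/-- The trace as a continuous linear functional. -/
noncomputable def traceCLM (n : ℕ) : Matrix (Fin n) (Fin n) ℝ →L[ℝ] ℝ :=
  LinearMap.toContinuousLinearMap (Matrix.traceLinearMap (Fin n) ℝ ℝ)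

/-- The transpose as a continuous linear map. -/
noncomputable def transposeCLM (n : ℕ) :
    Matrix (Fin n) (Fin n) ℝ →L[ℝ] Matrix (Fin n) (Fin n) ℝ :=
  LinearMap.toContinuousLinearMap
    { toFun := fun X => Xᵀ
      map_add' := fun X Y => Matrix.transpose_add X Y
      map_smul' := fun a X => Matrix.transpose_smul a X }

theorem dotProduct_self_nonneg' (v : Fin n → ℝ) : 0 ≤ v ⬝ᵥ v := by
  simpa [dotProduct] using Finset.sum_nonneg fun i _ => mul_self_nonneg (v i)

/-- A continuous path on `[a, b]` solving the Lyapunov equation `Ẋ = A X + X Aᵀ + Q`. -/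
structure IsFlow (A Q : Matrix (Fin n) (Fin n) ℝ) (a b : ℝ)
    (X : ℝ → Matrix (Fin n) (Fin n) ℝ) : Prop where
  continuousOn : ContinuousOn X (Icc a b)
  hasDerivAt : ∀ u ∈ Ioo a b, HasDerivAt X (A * X u + X u * Aᵀ + Q) u

/-- A positive semidefinite path on `[a, b]` with `Ẋ ≤ B X + X Bᵀ + c`. -/
structure IsSubflow (B c : Matrix (Fin n) (Fin n) ℝ) (a b : ℝ)
    (X : ℝ → Matrix (Fin n) (Fin n) ℝ) : Prop where
  continuousOn : ContinuousOn X (Icc a b)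
  hasDerivAt : ∀ u ∈ Ioo a b, ∃ X', HasDerivAt X X' u ∧ X' ≤ B * X u + X u * Bᵀ + c
  posSemidef : ∀ u ∈ Icc a b, (X u).PosSemidef

theorem IsSubflow.mono {B c : Matrix (Fin n) (Fin n) ℝ} {a b a' b' : ℝ}
    {X : ℝ → Matrix (Fin n) (Fin n) ℝ} (h : IsSubflow B c a b X) (ha : a ≤ a') (hb : b' ≤ b) :
    IsSubflow B c a' b' X where
  continuousOn := h.continuousOn.mono (Icc_subset_Icc ha hb)
  hasDerivAt u hu := h.hasDerivAt u (Ioo_subset_Ioo ha hb hu)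
  posSemidef u hu := h.posSemidef u (Icc_subset_Icc ha hb hu)

/-- The `(i, j)` entry as a continuous linear functional. -/
noncomputable def entryCLM (i j : Fin n) : Matrix (Fin n) (Fin n) ℝ →L[ℝ] ℝ :=
  LinearMap.toContinuousLinearMap (Matrix.entryLinearMap ℝ ℝ i j)

@[simp] theorem entryCLM_apply (i j : Fin n) (X : Matrix (Fin n) (Fin n) ℝ) :
    entryCLM i j X = X i j := rfl

theorem eq_of_hasDerivAt_zero_Ioo {f : ℝ → Matrix (Fin n) (Fin n) ℝ} {a b : ℝ}
    (hc : ContinuousOn f (Icc a b)) (hab : a ≤ b) (hd : ∀ u ∈ Ioo a b, HasDerivAt f 0 u) :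
    f b = f a := by
  have key : ∀ L : Matrix (Fin n) (Fin n) ℝ →L[ℝ] ℝ, L (f a) ≤ L (f b) := by
    intro L
    have hd' : ∀ u ∈ Ioo a b, HasDerivAt (fun u => L (f u)) 0 u := fun u hu => by
      have := L.hasFDerivAt.comp_hasDerivAt u (hd u hu)
      exact this.congr_deriv (map_zero L)
    refine monotoneOn_of_deriv_nonneg (convex_Icc a b) (f := fun u => L (f u))
      (L.continuous.comp_continuousOn hc) ?_ ?_ ⟨le_rfl, hab⟩ ⟨hab, le_rfl⟩ hab
    · rw [interior_Icc]
      exact fun u hu => (hd' u hu).differentiableAt.differentiableWithinAt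
    · rw [interior_Icc]
      exact fun u hu => (hd' u hu).deriv.ge
  ext i j
  have h1 := key (entryCLM i j)
  have h2 := key (-entryCLM i j)
  simp only [_root_.neg_apply, entryCLM_apply] at h1 h2
  linarith

/-- Variation of constants: conjugation by exp(-uA) removes the linear drift, leaving a path with
derivative E Q Eᵀ ≥ 0, which can only grow. Conjugation by an invertible matrix preserves
definiteness. -/
theorem IsFlow.posDef {A Q : Matrix (Fin n) (Fin n) ℝ} (hQ : Q.PosSemidef) {a b : ℝ}
    {X : ℝ → Matrix (Fin n) (Fin n) ℝ} (h : IsFlow A Q a b X) (ha : (X a).PosDef) :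
    ∀ s ∈ Icc a b, (X s).PosDef := by
  intro s hs
  let E : ℝ → Matrix (Fin n) (Fin n) ℝ := fun u => NormedSpace.exp (u • (-A))
  have hE : ∀ u, HasDerivAt E (E u * (-A)) u := fun u => hasDerivAt_exp_smul_const (-A) u
  have hEc : Continuous E := continuous_iff_continuousAt.2 fun u => (hE u).continuousAt
  have hEt : ∀ u, HasDerivAt (fun u => (E u)ᵀ) ((E u * (-A))ᵀ) u := fun u =>
    (transposeCLM n).hasFDerivAt.comp_hasDerivAt u (hE u)
  have hEtc : Continuous (fun u => (E u)ᵀ) := hEc.matrix_transpose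
  have hEu : ∀ u, IsUnit (E u) := fun u => NormedSpace.isUnit_exp _
  let W : ℝ → Matrix (Fin n) (Fin n) ℝ := fun u => E u * X u * (E u)ᵀ
  have hWc : ContinuousOn W (Icc a b) :=
    (hEc.continuousOn.mul h.continuousOn).mul hEtc.continuousOn
  have hW : ∀ u ∈ Ioo a b, HasDerivAt W (E u * Q * (E u)ᵀ) u := by
    intro u hu
    have := ((hE u).mul (h.hasDerivAt u hu)).mul (hEt u)
    refine HasDerivAt.congr_deriv (f := W) this ?_
    simp only [Matrix.transpose_mul, Matrix.transpose_neg, Pi.mul_apply]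
    noncomm_ring
  have hWm : ∀ v, MonotoneOn (fun u => quadCLM v (W u)) (Icc a b) := by
    intro v
    apply monotoneOn_of_deriv_nonneg (convex_Icc a b)
    · exact (quadCLM v).continuous.comp_continuousOn hWc
    · rw [interior_Icc]
      intro u hu
      exact ((quadCLM v).hasFDerivAt.comp_hasDerivAt u (hW u hu)).differentiableAt.differentiableWithinAt
    · rw [interior_Icc]
      intro u hu
      refine le_of_le_of_eq ?_ ((quadCLM v).hasFDerivAt.comp_hasDerivAt u (hW u hu)).deriv.symm
      exact (posSemidef_iff_transpose.1 (hQ.conj (E u))).2 v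
  have haI : a ∈ Icc a b := ⟨le_rfl, hs.1.trans hs.2⟩
  -- Symmetry of X is known only at a. It propagates because the derivative of W is symmetric.
  have hWsymm : (W s)ᵀ - W s = (W a)ᵀ - W a := by
    refine eq_of_hasDerivAt_zero_Ioo (f := fun u => (W u)ᵀ - W u)
      ((((transposeCLM n).continuous.comp_continuousOn hWc).sub hWc).mono
        (Icc_subset_Icc_right hs.2)) hs.1 fun u hu => ?_
    have hd := hW u ⟨hu.1, hu.2.trans_le hs.2⟩
    refine HasDerivAt.congr_deriv (f := fun u => (W u)ᵀ - W u)
      (((transposeCLM n).hasFDerivAt.comp_hasDerivAt u hd).sub hd) ?_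
    exact sub_eq_zero.2 (hQ.conj (E u)).transpose_eq
  have hWa : (W a).PosDef := by
    have := (Matrix.IsUnit.posDef_star_right_conjugate_iff (x := X a) (hEu a)).2 ha
    simpa [Matrix.star_eq_conjTranspose] using this
  have hWs : (W s).PosDef := by
    rw [hWa.posSemidef.transpose_eq, sub_self, sub_eq_zero] at hWsymm
    apply Matrix.PosDef.of_dotProduct_mulVec_pos
    · simpa [Matrix.IsHermitian] using hWsymm
    · intro v hv
      have h1 := hWa.dotProduct_mulVec_pos hv
      have h2 := hWm v haI hs hs.1
      simp only [star_trivial] at h1 ⊢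
      exact h1.trans_le h2
  have := (Matrix.IsUnit.posDef_star_right_conjugate_iff (x := X s) (hEu s)).1
  apply this
  simpa [Matrix.star_eq_conjTranspose] using hWs

/-- Grönwall for the trace: its derivative is at most 2nρ tr X + nρ. Adding 1 to the trace absorbs
the forcing term. -/
theorem IsSubflow.antitoneOn_trace {B c : Matrix (Fin n) (Fin n) ℝ} {a b ρ : ℝ}
    {X : ℝ → Matrix (Fin n) (Fin n) ℝ} (h : IsSubflow B c a b X) (hB : ‖B‖ ≤ ρ) (hc : ‖c‖ ≤ ρ) :
    AntitoneOn (fun u => Real.exp (-(2 * n * ρ * u)) * ((X u).trace + 1)) (Icc a b) := by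
  have hexp : ∀ u : ℝ, HasDerivAt (fun u : ℝ => Real.exp (-(2 * n * ρ * u)))
      (Real.exp (-(2 * n * ρ * u)) * (-(2 * n * ρ))) u := by
    intro u
    have := ((hasDerivAt_id' u).const_mul (2 * n * ρ)).neg.exp
    refine this.congr_deriv ?_
    simp
  have hd : ∀ u ∈ Ioo a b, ∃ X', HasDerivAt
      (fun u => Real.exp (-(2 * n * ρ * u)) * ((X u).trace + 1))
      (Real.exp (-(2 * n * ρ * u)) * (-(2 * n * ρ)) * ((X u).trace + 1) +
        Real.exp (-(2 * n * ρ * u)) * X') u ∧ X' ≤ 2 * n * ρ * ((X u).trace + 1) := by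
    intro u hu
    obtain ⟨X', hX', hle⟩ := h.hasDerivAt u hu
    have hp := h.posSemidef u (Ioo_subset_Icc_self hu)
    refine ⟨X'.trace, (hexp u).mul
      (((traceCLM n).hasFDerivAt.comp_hasDerivAt u hX').add_const 1), ?_⟩
    refine (trace_le_trace hle).trans ?_
    have hρ : 0 ≤ ρ := (norm_nonneg _).trans hB
    have hn : ‖X u‖ ≤ (X u).trace := norm_le_trace hp
    have h0 := hp.trace_nonneg
    have e : (X u * Bᵀ).trace = (B * X u).trace := by
      rw [← Matrix.trace_transpose, Matrix.transpose_mul, hp.transpose_eq,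
        Matrix.transpose_transpose]
    have h1 : (B * X u).trace ≤ n * (ρ * (X u).trace) :=
      (le_abs_self _).trans ((abs_trace_le _).trans (by
        gcongr
        exact (norm_mul_le _ _).trans (by gcongr)))
    have h2 : c.trace ≤ n * ρ := (le_abs_self _).trans ((abs_trace_le _).trans (by gcongr))
    have h3 : (0 : ℝ) ≤ n * ρ := by positivity
    rw [Matrix.trace_add, Matrix.trace_add, e]
    nlinarith
  apply antitoneOn_of_deriv_nonpos (convex_Icc a b)
  · apply ContinuousOn.mul
    · exact (continuous_iff_continuousAt.2 fun u => (hexp u).continuousAt).continuousOn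
    · exact ((traceCLM n).continuous.comp_continuousOn h.continuousOn).add continuousOn_const
  · rw [interior_Icc]
    intro u hu
    obtain ⟨X', hX', -⟩ := hd u hu
    exact hX'.differentiableAt.differentiableWithinAt
  · rw [interior_Icc]
    intro u hu
    obtain ⟨X', hX', hle⟩ := hd u hu
    rw [hX'.deriv]
    nlinarith [Real.exp_pos (-(2 * n * ρ * u))]

theorem IsSubflow.trace_le {B c : Matrix (Fin n) (Fin n) ℝ} {a b ρ : ℝ} (hab : a ≤ b)
    {X : ℝ → Matrix (Fin n) (Fin n) ℝ} (h : IsSubflow B c a b X) (hB : ‖B‖ ≤ ρ) (hc : ‖c‖ ≤ ρ) :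
    (X b).trace + 1 ≤ Real.exp (2 * n * ρ * (b - a)) * ((X a).trace + 1) := by
  have := h.antitoneOn_trace hB hc ⟨le_rfl, hab⟩ ⟨hab, le_rfl⟩ hab
  have h2 := mul_le_mul_of_nonneg_left this (Real.exp_pos (2 * n * ρ * b)).le
  simp only [← mul_assoc, ← Real.exp_add] at h2
  rw [add_neg_cancel, Real.exp_zero, one_mul] at h2
  rwa [mul_sub, sub_eq_add_neg]

/-- The constant depends on n, ρ, T only, and the error is linear in the initial trace, so it can
later be averaged. The proof interpolates between the affine step and X b by a path whose derivative
is at most c + O(b - u). -/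
theorem IsSubflow.le_first_order (n : ℕ) (ρ T : ℝ) (hρ : 0 ≤ ρ) (hT : 0 ≤ T) :
    ∃ C, 0 ≤ C ∧ ∀ (B c : Matrix (Fin n) (Fin n) ℝ) (a b : ℝ)
      (X : ℝ → Matrix (Fin n) (Fin n) ℝ), a ≤ b → b - a ≤ T → IsSubflow B c a b X →
      ‖B‖ ≤ ρ → ‖c‖ ≤ ρ → cᵀ = c →
      X b ≤ (1 + (b - a) • B) * X a * (1 + (b - a) • B)ᵀ + (b - a) • c
        + (C * (1 + (X a).trace) * (b - a) ^ 2) • 1 := by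
  -- The sum of the bounds on the five terms of N below, with ‖E u‖ ≤ n + Tρ. The terms free of X
  -- are multiplied by D ≥ 1 as well.
  set C1 := 2 * ρ ^ 2 * (n + T * ρ) + 2 * ρ ^ 2 + T * ρ ^ 3 with hC1
  have hC1n : 0 ≤ C1 := by positivity
  refine ⟨C1 * Real.exp (2 * n * ρ * T), by positivity, ?_⟩
  intro B c a b X hab hT h hB hc hcs
  set D := Real.exp (2 * n * ρ * T) * ((X a).trace + 1) with hD
  have htra : 0 ≤ (X a).trace := (h.posSemidef a ⟨le_rfl, hab⟩).trace_nonneg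
  have htr : ∀ u ∈ Icc a b, (X u).trace + 1 ≤ D := by
    intro u hu
    refine ((h.mono le_rfl hu.2).trace_le hu.1 hB hc).trans ?_
    rw [hD]
    gcongr
    linarith [hu.2]
  have hsymm : ∀ G : Matrix (Fin n) (Fin n) ℝ, ((G * X a * Gᵀ))ᵀ = G * X a * Gᵀ := fun G =>
    ((h.posSemidef a ⟨le_rfl, hab⟩).conj G).transpose_eq
  rw [le_iff_transpose (h.posSemidef b ⟨hab, le_rfl⟩).transpose_eq (by
    rw [Matrix.transpose_add, Matrix.transpose_add, hsymm]; simp [hcs])]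
  intro v
  -- This first-order integrating factor equals 1 at b and 1 + (b - a)B at a. In the derivative of E
  -- X Eᵀ the terms BX and XBᵀ cancel to leading order.
  set E : ℝ → Matrix (Fin n) (Fin n) ℝ := fun u => 1 + (b - u) • B with hE
  have hEd : ∀ u, HasDerivAt E (-B) u := by
    intro u
    exact ((((hasDerivAt_id' u).const_sub b).smul_const B).const_add 1).congr_deriv (by simp)
  have hEtd : ∀ u, HasDerivAt (fun u => (E u)ᵀ) ((-B)ᵀ) u := fun u =>
    (transposeCLM n).hasFDerivAt.comp_hasDerivAt u (hEd u)
  have hEc : Continuous E := continuous_iff_continuousAt.2 fun u => (hEd u).continuousAt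
  have hvv := dotProduct_self_nonneg' v
  have key := (convex_Icc a b).image_sub_le_mul_sub_of_deriv_le
    (f := fun u => quadCLM v (E u * X u * (E u)ᵀ))
    (C := v ⬝ᵥ c *ᵥ v + (b - a) * (C1 * D) * (v ⬝ᵥ v)) ?_ ?_ ?_ a ⟨le_rfl, hab⟩ b ⟨hab, le_rfl⟩ hab
  · have e1 : E b = 1 := by simp [hE]
    have e2 : E a = 1 + (b - a) • B := rfl
    simp only [e1, e2, quadCLM_apply, Matrix.transpose_one, Matrix.mul_one, Matrix.one_mul] at key
    rw [Matrix.add_mulVec, Matrix.add_mulVec, dotProduct_add, dotProduct_add, dotProduct_one_smul,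
      Matrix.smul_mulVec, dotProduct_smul, smul_eq_mul]
    rw [hD] at key
    nlinarith [key]
  · exact (quadCLM v).continuous.comp_continuousOn
      ((hEc.continuousOn.mul h.continuousOn).mul hEc.matrix_transpose.continuousOn)
  · rw [interior_Icc]
    intro u hu
    obtain ⟨X', hX', -⟩ := h.hasDerivAt u hu
    exact ((quadCLM v).hasFDerivAt.comp_hasDerivAt u
      (((hEd u).mul hX').mul (hEtd u))).differentiableAt.differentiableWithinAt
  · rw [interior_Icc]
    intro u hu
    obtain ⟨X', hX', hle⟩ := h.hasDerivAt u hu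
    have hd : HasDerivAt (fun u => quadCLM v (E u * X u * (E u)ᵀ))
        (v ⬝ᵥ (-B * X u * (E u)ᵀ + E u * X' * (E u)ᵀ + E u * X u * (-B)ᵀ) *ᵥ v) u :=
      ((quadCLM v).hasFDerivAt.comp_hasDerivAt u (((hEd u).mul hX').mul (hEtd u))).congr_deriv
        (by rw [add_mul]; rfl)
    rw [hd.deriv]
    have hp := h.posSemidef u (Ioo_subset_Icc_self hu)
    set η := b - u with hη
    have hη0 : 0 ≤ η := by linarith [hu.2]
    have hηT : η ≤ T := by linarith [hu.1]
    have hηh : η ≤ b - a := by linarith [hu.1]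
    have hconj := dotProduct_mulVec_le (conj_le_conj hle (E u)) v
    set N := B * B * X u * (E u)ᵀ + E u * X u * Bᵀ * Bᵀ + B * c + c * Bᵀ + η • (B * c * Bᵀ) with hN
    have hexpand : -B * X u * (E u)ᵀ + E u * (B * X u + X u * Bᵀ + c) * (E u)ᵀ
        + E u * X u * (-B)ᵀ = c + η • N := by
      have : E u = 1 + η • B := rfl
      rw [hN, this]
      simp only [Matrix.transpose_add, Matrix.transpose_one, Matrix.transpose_smul,
        Matrix.transpose_neg, mul_add, add_mul, mul_one, one_mul, smul_mul_assoc, mul_smul_comm,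
        smul_add, smul_smul, mul_neg, neg_mul, smul_neg, mul_assoc]
      abel
    have hle2 : v ⬝ᵥ (-B * X u * (E u)ᵀ + E u * X' * (E u)ᵀ + E u * X u * (-B)ᵀ) *ᵥ v
        ≤ v ⬝ᵥ (c + η • N) *ᵥ v := by
      rw [← hexpand]
      simp only [Matrix.add_mulVec, dotProduct_add] at hconj ⊢
      linarith
    have hEn : ‖E u‖ ≤ n + T * ρ := by
      refine (norm_add_le _ _).trans (add_le_add norm_one_le ?_)
      rw [norm_smul, Real.norm_of_nonneg hη0]
      gcongr
    have hEtn : ‖(E u)ᵀ‖ ≤ n + T * ρ := by rwa [Matrix.frobenius_norm_transpose]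
    have hBt : ‖Bᵀ‖ ≤ ρ := by rwa [Matrix.frobenius_norm_transpose]
    have hXn : ‖X u‖ ≤ D := (norm_le_trace hp).trans
      (by linarith [htr u (Ioo_subset_Icc_self hu)])
    have hD1 : 1 ≤ D := by linarith [htr u (Ioo_subset_Icc_self hu), hp.trace_nonneg]
    have hT0 : 0 ≤ T := hη0.trans hηT
    have hm : ∀ {G K : Matrix (Fin n) (Fin n) ℝ} {g k : ℝ}, ‖G‖ ≤ g → ‖K‖ ≤ k →
        ‖G * K‖ ≤ g * k := fun {G K g k} h1 h2 => (norm_mul_le _ _).trans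
          (mul_le_mul h1 h2 (norm_nonneg _) ((norm_nonneg _).trans h1))
    have hNn : ‖N‖ ≤ C1 * D := by
      have n1 := hm (hm (hm hB hB) hXn) hEtn
      have n2 := hm (hm (hm hEn hXn) hBt) hBt
      have n3 := hm hB hc
      have n4 := hm hc hBt
      have n5 : ‖η • (B * c * Bᵀ)‖ ≤ T * (ρ * ρ * ρ) := by
        rw [norm_smul, Real.norm_of_nonneg hη0]
        exact mul_le_mul hηT (hm n3 hBt) (norm_nonneg _) hT0
      have n6 : ‖N‖ ≤ _ := norm_add_le_of_le (norm_add_le_of_le (norm_add_le_of_le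
        (norm_add_le_of_le n1 n2) n3) n4) n5
      refine n6.trans ?_
      rw [hC1]
      have : 0 ≤ (2 * ρ ^ 2 + T * ρ ^ 3) * (D - 1) :=
        mul_nonneg (by positivity) (by linarith)
      nlinarith [this]
    refine hle2.trans ?_
    rw [Matrix.add_mulVec, dotProduct_add, Matrix.smul_mulVec, dotProduct_smul, smul_eq_mul]
    have h1 : v ⬝ᵥ N *ᵥ v ≤ C1 * D * (v ⬝ᵥ v) :=
      (le_abs_self _).trans ((abs_dotProduct_mulVec_le N v).trans (by gcongr))
    have h2 : η * (v ⬝ᵥ N *ᵥ v) ≤ (b - a) * (C1 * D * (v ⬝ᵥ v)) :=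
      (mul_le_mul_of_nonneg_left h1 hη0).trans (by gcongr)
    linarith

end Flow

end CDKF

namespace CDKF

/-! ### Flows of the covariance and of the information matrix -/

section InfoFlow

variable {n : ℕ} {A Q : Matrix (Fin n) (Fin n) ℝ} {a b : ℝ} {X : ℝ → Matrix (Fin n) (Fin n) ℝ}

theorem IsFlow.isSubflow (hQ : Q.PosSemidef) (h : IsFlow A Q a b X) (ha : (X a).PosDef) :
    IsSubflow A Q a b X where
  continuousOn := h.continuousOn
  hasDerivAt u hu := ⟨_, h.hasDerivAt u hu, le_rfl⟩
  posSemidef u hu := (h.posDef hQ ha u hu).posSemidef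

theorem hasFDerivAt_matrix_inv {Y : Matrix (Fin n) (Fin n) ℝ} (hY : Y.PosDef) :
    HasFDerivAt (fun X : Matrix (Fin n) (Fin n) ℝ => X⁻¹)
      (-(ContinuousLinearMap.mulLeftRight ℝ (Matrix (Fin n) (Fin n) ℝ)) Y⁻¹ Y⁻¹) Y := by
  let U : (Matrix (Fin n) (Fin n) ℝ)ˣ := ⟨Y, Y⁻¹, hY.mul_inv_self, hY.inv_mul_self⟩
  have := hasFDerivAt_ringInverse (𝕜 := ℝ) U
  have e : (fun X : Matrix (Fin n) (Fin n) ℝ => X⁻¹) = Ring.inverse := by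
    funext X
    exact Matrix.nonsing_inv_eq_ringInverse _
  rw [e]
  exact this

/-- The inverse solves Y' = -YA - AᵀY - YQY; replacing YQY by its tangent minorant at Z gives an
affine upper bound. Z is constant along the flow, and the family over all Z retains the full Riccati
equation. -/
theorem IsFlow.isSubflow_inv (hQ : Q.PosSemidef) (h : IsFlow A Q a b X) (ha : (X a).PosDef)
    (Z : Matrix (Fin n) (Fin n) ℝ) :
    IsSubflow (-(A + Q * Z)ᵀ) (Zᵀ * Q * Z) a b (fun u => (X u)⁻¹) where
  continuousOn u hu :=
    (hasFDerivAt_matrix_inv (h.posDef hQ ha u hu)).continuousAt.comp_continuousWithinAt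
      (h.continuousOn u hu)
  posSemidef u hu := (h.posDef hQ ha u hu).inv.posSemidef
  hasDerivAt u hu := by
    have hp := h.posDef hQ ha u (Ioo_subset_Icc_self hu)
    refine ⟨_, (hasFDerivAt_matrix_inv hp).comp_hasDerivAt u (h.hasDerivAt u hu), ?_⟩
    have hYt := hp.inv.posSemidef.transpose_eq
    have h1 := hp.mul_inv_self
    have h2 := hp.inv_mul_self
    refine le_of_posSemidef_of_sub_eq
      (Matrix.le_iff.1 (tangent_le_mul_mul hQ hYt Z)) ?_
    set Y := (X u)⁻¹ with hY
    have e : (-(ContinuousLinearMap.mulLeftRight ℝ (Matrix (Fin n) (Fin n) ℝ)) Y Y)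
        (A * X u + X u * Aᵀ + Q) = -(Y * (A * X u + X u * Aᵀ + Q) * Y) := by
      simp
    refine (congrArg₂ (· - ·) rfl e).trans ?_
    have e1 : Y * (A * X u) * Y = Y * A := by
      rw [mul_assoc, mul_assoc, h1, mul_one]
    have e2 : Y * (X u * Aᵀ) * Y = Aᵀ * Y := by
      rw [← mul_assoc, h2, one_mul]
    rw [mul_add, mul_add, add_mul, add_mul, e1, e2]
    simp only [Matrix.transpose_add, Matrix.transpose_mul, Matrix.transpose_neg,
      Matrix.transpose_transpose, hQ.transpose_eq]
    noncomm_ring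

end InfoFlow

/-! ### First-order steps of processes with jumps -/

section Step

variable {n M : ℕ}

/-- Coefficients `(B, c, G, d)` of the affine dynamics `dX = (B X + X Bᵀ + c) dt +
∑ⱼ (Gⱼ X Gⱼᵀ + dⱼ - X) dNⱼ`. -/
abbrev Coeff (n M : ℕ) : Type :=
  Matrix (Fin n) (Fin n) ℝ × Matrix (Fin n) (Fin n) ℝ ×
    (Fin M → Matrix (Fin n) (Fin n) ℝ) × (Fin M → Matrix (Fin n) (Fin n) ℝ)

/-- The forcing terms of the affine dynamics are symmetric. -/
def Coeff.IsSymm (θ : Coeff n M) : Prop := θ.2.1ᵀ = θ.2.1 ∧ ∀ j, (θ.2.2.2 j)ᵀ = θ.2.2.2 j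

theorem Coeff.norm_le {θ : Coeff n M} {ρ : ℝ} (h : ‖θ‖ ≤ ρ) :
    ‖θ.1‖ ≤ ρ ∧ ‖θ.2.1‖ ≤ ρ ∧ (∀ j, ‖θ.2.2.1 j‖ ≤ ρ) ∧ ∀ j, ‖θ.2.2.2 j‖ ≤ ρ := by
  have h2 := (norm_snd_le θ).trans h
  have h3 := (norm_snd_le θ.2).trans h2
  exact ⟨(norm_fst_le θ).trans h, (norm_fst_le θ.2).trans h2,
    fun j => (norm_le_pi_norm _ j).trans ((norm_fst_le θ.2.2).trans h3),
    fun j => (norm_le_pi_norm _ j).trans ((norm_snd_le θ.2.2).trans h3)⟩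

/-- First-order approximation of the affine dynamics over a time `h` with jump counts `l`. -/
noncomputable def step (θ : Coeff n M) (h : ℝ) (l : Fin M → ℝ) (X : Matrix (Fin n) (Fin n) ℝ) :
    Matrix (Fin n) (Fin n) ℝ :=
  (1 + h • θ.1) * X * (1 + h • θ.1)ᵀ + h • θ.2.1
    + ∑ j, l j • (θ.2.2.1 j * X * (θ.2.2.1 j)ᵀ + θ.2.2.2 j - X)

/-- Total number of counts. -/
def total (N : Fin M → ℝ → ℕ) (t : ℝ) : ℕ := ∑ j, N j t

/-- The dyadic grid of `[0, T]`. -/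
noncomputable def gridPt (T : ℝ) (m k : ℕ) : ℝ := T * (k / 2 ^ m)

/-- A positive semidefinite path which is dominated by the affine dynamics with any coefficients in
`𝒯`, on intervals with at most one jump, and whose jumps are separated by a dyadic grid. -/
structure IsJumpPath (T : ℝ) (N : Fin M → ℝ → ℕ) (𝒯 : Set (Coeff n M))
    (X : ℝ → Matrix (Fin n) (Fin n) ℝ) : Prop where
  mono : ∀ j, MonotoneOn (N j) (Icc 0 T)
  cells : ∃ m : ℕ, ∀ k < 2 ^ m, total N (gridPt T m (k + 1)) ≤ total N (gridPt T m k) + 1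
  posSemidef : ∀ s ∈ Icc 0 T, (X s).PosSemidef
  flow : ∀ r s, 0 ≤ r → r ≤ s → s ≤ T → (∀ j, N j s = N j r) →
    ∀ θ ∈ 𝒯, IsSubflow θ.1 θ.2.1 r s X
  jump : ∀ r s, 0 ≤ r → r ≤ s → s ≤ T → total N s = total N r + 1 →
    ∃ (j : Fin M) (τ : ℝ) (X' : ℝ → Matrix (Fin n) (Fin n) ℝ), r < τ ∧ τ ≤ s ∧
      (∀ i, N i s = N i r + if i = j then 1 else 0) ∧ X' r = X r ∧
      ∀ θ ∈ 𝒯, IsSubflow θ.1 θ.2.1 r τ X' ∧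
        X τ ≤ θ.2.2.1 j * X' τ * (θ.2.2.1 j)ᵀ + θ.2.2.2 j ∧ IsSubflow θ.1 θ.2.1 τ s X

theorem gridPt_mono {T : ℝ} (hT : 0 ≤ T) (m : ℕ) : Monotone (gridPt T m) := by
  intro k l h
  unfold gridPt
  gcongr

theorem gridPt_zero (T : ℝ) (m : ℕ) : gridPt T m 0 = 0 := by simp [gridPt]

theorem gridPt_last (T : ℝ) (m : ℕ) : gridPt T m (2 ^ m) = T := by simp [gridPt]

theorem gridPt_mem {T : ℝ} (hT : 0 ≤ T) {m k : ℕ} (hk : k ≤ 2 ^ m) : gridPt T m k ∈ Icc 0 T := by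
  constructor
  · simpa [gridPt_zero] using gridPt_mono hT m (Nat.zero_le k)
  · simpa [gridPt_last] using gridPt_mono hT m hk

theorem gridPt_succ_sub (T : ℝ) (m k : ℕ) : gridPt T m (k + 1) - gridPt T m k = T / 2 ^ m := by
  simp only [gridPt]; push_cast; ring

theorem total_monotoneOn {N : Fin M → ℝ → ℕ} {T : ℝ} (h : ∀ j, MonotoneOn (N j) (Icc 0 T)) :
    MonotoneOn (total N) (Icc 0 T) := fun _ hr _ hs hrs =>
  Finset.sum_le_sum fun j _ => h j hr hs hrs

theorem eq_of_total_eq {N : Fin M → ℝ → ℕ} {T r s : ℝ} (h : ∀ j, MonotoneOn (N j) (Icc 0 T))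
    (hr : r ∈ Icc 0 T) (hs : s ∈ Icc 0 T) (hrs : r ≤ s) (he : total N s = total N r) (j : Fin M) :
    N j s = N j r :=
  ((Finset.sum_eq_sum_iff_of_le fun j _ => h j hr hs hrs).1 he.symm j (Finset.mem_univ j)).symm

theorem antitoneOn_of_grid {T : ℝ} (hT : 0 ≤ T) {φ : ℝ → ℝ} (m : ℕ)
    (h : ∀ k < 2 ^ m, AntitoneOn φ (Icc (gridPt T m k) (gridPt T m (k + 1)))) :
    AntitoneOn φ (Icc 0 T) := by
  have key : ∀ k ≤ 2 ^ m, AntitoneOn φ (Icc 0 (gridPt T m k)) := by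
    intro k
    induction k with
    | zero => intro _; rw [gridPt_zero]; simp
    | succ k ih =>
      intro hk r hr s hs hrs
      have hk' : k < 2 ^ m := hk
      have hg := (gridPt_mem hT hk'.le).1
      have hg' := gridPt_mono hT m (Nat.le_succ k)
      rcases le_total s (gridPt T m k) with h1 | h1
      · exact ih hk'.le ⟨hr.1, hrs.trans h1⟩ ⟨hs.1, h1⟩ hrs
      rcases le_total r (gridPt T m k) with h2 | h2
      · exact (h k hk' ⟨le_rfl, hg'⟩ ⟨h1, hs.2⟩ h1).trans
          (ih hk'.le ⟨hr.1, h2⟩ ⟨hg, le_rfl⟩ h2)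
      · exact h k hk' ⟨h2, hr.2⟩ ⟨h1, hs.2⟩ hrs
  simpa [gridPt_last] using key _ le_rfl

/-- The trace of a path with jumps grows at most linearly in the number of jumps. -/
theorem IsJumpPath.trace_le {T : ℝ} (hT : 0 ≤ T) {𝒯 : Set (Coeff n M)} {θ : Coeff n M}
    (hθ : θ ∈ 𝒯) (hG : ∀ j, θ.2.2.1 j = 1) :
    ∃ C, 0 ≤ C ∧ ∀ (N : Fin M → ℝ → ℕ) (X : ℝ → Matrix (Fin n) (Fin n) ℝ), IsJumpPath T N 𝒯 X →
      ∀ r s, 0 ≤ r → r ≤ s → s ≤ T →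
        (X s).trace + 1 ≤ C * ((X r).trace + 1 + ((total N s : ℝ) - total N r)) := by
  set ρ := ‖θ‖ with hρ
  obtain ⟨hB, hc, -, hd⟩ := Coeff.norm_le hρ.ge
  have hρ0 : 0 ≤ ρ := norm_nonneg _
  set κ := 2 * n * ρ with hκ
  have hκ0 : 0 ≤ κ := by positivity
  set D := n * ρ with hD
  have hD0 : 0 ≤ D := by positivity
  refine ⟨Real.exp (κ * T) * (1 + D), by positivity, ?_⟩
  intro N X h r s hr hrs hs
  obtain ⟨m, hm⟩ := h.cells
  -- The exponential discounts the drift and D pays for one jump: since all congruence factors are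
  -- 1, a jump adds at most tr d_j ≤ D to the trace. Monotonicity is checked on grid cells, where at
  -- most one jump occurs.
  set φ : ℝ → ℝ := fun u => Real.exp (-(κ * u)) * ((X u).trace + 1) - D * total N u with hφ
  have hmono := total_monotoneOn h.mono
  have hanti : AntitoneOn φ (Icc 0 T) := by
    refine antitoneOn_of_grid hT m fun k hk r hr s hs hrs => ?_
    have hka := gridPt_mem hT (m := m) hk.le
    have hkb := gridPt_mem hT (m := m) (Nat.succ_le_of_lt hk)
    have hr' : r ∈ Icc 0 T := ⟨hka.1.trans hr.1, hr.2.trans hkb.2⟩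
    have hs' : s ∈ Icc 0 T := ⟨hka.1.trans hs.1, hs.2.trans hkb.2⟩
    have h1 := hmono hka hr' hr.1
    have h2 := hmono hs' hkb hs.2
    have h3 := hmono hr' hs' hrs
    have h4 := hm k hk
    have h5 : total N s = total N r ∨ total N s = total N r + 1 := by
      have : total N (gridPt T m k.succ) = total N (gridPt T m (k + 1)) := rfl
      omega
    rcases h5 with h5 | h5
    · have := (h.flow r s hr'.1 hrs hs'.2 (eq_of_total_eq h.mono hr' hs' hrs h5) θ
        hθ).antitoneOn_trace hB hc ⟨le_rfl, hrs⟩ ⟨hrs, le_rfl⟩ hrs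
      simp only [hφ, h5]
      exact sub_le_sub_right this _
    · obtain ⟨j, τ, X', hrτ, hτs, -, hX', hθ'⟩ := h.jump r s hr'.1 hrs hs'.2 h5
      obtain ⟨f1, f2, f3⟩ := hθ' θ hθ
      have g1 := f1.antitoneOn_trace hB hc ⟨le_rfl, hrτ.le⟩ ⟨hrτ.le, le_rfl⟩ hrτ.le
      have g3 := f3.antitoneOn_trace hB hc ⟨le_rfl, hτs⟩ ⟨hτs, le_rfl⟩ hτs
      have g2 := trace_le_trace f2
      rw [hG, Matrix.transpose_one, Matrix.mul_one, Matrix.one_mul, Matrix.trace_add] at g2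
      have g4 : (θ.2.2.2 j).trace ≤ D := (le_abs_self _).trans ((abs_trace_le _).trans (by
        rw [hD]; gcongr; exact hd j))
      have hτ0 : 0 ≤ τ := hr'.1.trans hrτ.le
      have he : Real.exp (-(κ * τ)) ≤ 1 := Real.exp_le_one_iff.2 (by
        have := mul_nonneg hκ0 hτ0; linarith)
      simp only [hφ, h5]
      simp only [hX', ← hκ] at g1 g3
      push_cast
      have g5 : Real.exp (-(κ * τ)) * ((X τ).trace + 1) ≤
          Real.exp (-(κ * τ)) * ((X' τ).trace + 1) + D := by
        have : Real.exp (-(κ * τ)) * ((X τ).trace + 1) ≤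
          Real.exp (-(κ * τ)) * ((X' τ).trace + 1 + D) :=
          mul_le_mul_of_nonneg_left (by linarith) (Real.exp_pos _).le
        nlinarith
      linarith
  have hfin := hanti ⟨hr, hrs.trans hs⟩ ⟨hr.trans hrs, hs⟩ hrs
  simp only [hφ] at hfin
  have hN : (total N r : ℝ) ≤ total N s := by
    exact_mod_cast hmono ⟨hr, hrs.trans hs⟩ ⟨hr.trans hrs, hs⟩ hrs
  have htr := (h.posSemidef r ⟨hr, hrs.trans hs⟩).trace_nonneg
  have he1 : Real.exp (-(κ * r)) ≤ 1 := Real.exp_le_one_iff.2 (by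
    have := mul_nonneg hκ0 hr; linarith)
  have h1 : Real.exp (-(κ * s)) * ((X s).trace + 1) ≤
      (1 + D) * ((X r).trace + 1 + ((total N s : ℝ) - total N r)) := by
    have := mul_le_mul_of_nonneg_right he1 (by linarith : 0 ≤ (X r).trace + 1)
    nlinarith [mul_nonneg hD0 htr]
  have h2 := mul_le_mul_of_nonneg_left h1 (Real.exp_pos (κ * s)).le
  rw [← mul_assoc, ← Real.exp_add, add_neg_cancel, Real.exp_zero, one_mul] at h2
  refine h2.trans ?_
  rw [← mul_assoc]
  have : 0 ≤ (X r).trace + 1 + ((total N s : ℝ) - total N r) := by linarith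
  gcongr

end Step

end CDKF

namespace CDKF

/-! ### One-step error bounds for paths with jumps -/

section OneStep

variable {n M : ℕ}

theorem norm_drift_sub_le {ρ T : ℝ} (hT : 0 ≤ T) {B c X : Matrix (Fin n) (Fin n) ℝ}
    (hB : ‖B‖ ≤ ρ) (hc : ‖c‖ ≤ ρ) (hX : X.PosSemidef) {h : ℝ} (h0 : 0 ≤ h) (hh : h ≤ T) :
    ‖(1 + h • B) * X * (1 + h • B)ᵀ + h • c - X‖ ≤ (3 * ρ + T * ρ ^ 2) * (1 + X.trace) * h := by
  have hρ : 0 ≤ ρ := (norm_nonneg _).trans hB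
  have e : (1 + h • B) * X * (1 + h • B)ᵀ + h • c - X
      = h • (B * X + X * Bᵀ + h • (B * X * Bᵀ) + c) := by
    simp only [Matrix.transpose_add, Matrix.transpose_one, Matrix.transpose_smul, mul_add, add_mul,
      mul_one, one_mul, smul_mul_assoc, mul_smul_comm, smul_add]
    abel
  have hBt : ‖Bᵀ‖ ≤ ρ := by rwa [Matrix.frobenius_norm_transpose]
  have hXn := norm_le_trace hX
  have htr := hX.trace_nonneg
  have hm : ∀ {G K : Matrix (Fin n) (Fin n) ℝ} {g k : ℝ}, ‖G‖ ≤ g → ‖K‖ ≤ k →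
      ‖G * K‖ ≤ g * k := fun {G K g k} h1 h2 => (norm_mul_le _ _).trans
        (mul_le_mul h1 h2 (norm_nonneg _) ((norm_nonneg _).trans h1))
  have n3 : ‖h • (B * X * Bᵀ)‖ ≤ T * (ρ * X.trace * ρ) := by
    rw [norm_smul, Real.norm_of_nonneg h0]
    exact mul_le_mul hh (hm (hm hB hXn) hBt) (norm_nonneg _) hT
  have n4 : ‖B * X + X * Bᵀ + h • (B * X * Bᵀ) + c‖ ≤ _ :=
    norm_add_le_of_le (norm_add_le_of_le (norm_add_le_of_le (hm hB hXn) (hm hXn hBt)) n3) hc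
  rw [e, norm_smul, Real.norm_of_nonneg h0, mul_comm]
  refine mul_le_mul_of_nonneg_right (n4.trans ?_) h0
  nlinarith [mul_nonneg hT (sq_nonneg ρ), mul_nonneg hρ htr]

theorem transpose_drift {B c X : Matrix (Fin n) (Fin n) ℝ} (hX : X.PosSemidef) (hc : cᵀ = c)
    (h : ℝ) : ((1 + h • B) * X * (1 + h • B)ᵀ + h • c - X)ᵀ
      = (1 + h • B) * X * (1 + h • B)ᵀ + h • c - X := by
  rw [Matrix.transpose_sub, Matrix.transpose_add, (hX.conj _).transpose_eq, hX.transpose_eq,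
    Matrix.transpose_smul, hc]

/-- Used on either side of a jump, where an O(h) error is affordable because a jump in the interval
is itself an event of probability O(h). -/
theorem IsSubflow.le_zeroth_order (n : ℕ) (ρ T : ℝ) (hρ : 0 ≤ ρ) (hT : 0 ≤ T) :
    ∃ C, 0 ≤ C ∧ ∀ (B c : Matrix (Fin n) (Fin n) ℝ) (a b : ℝ)
      (X : ℝ → Matrix (Fin n) (Fin n) ℝ), a ≤ b → b - a ≤ T → IsSubflow B c a b X →
      ‖B‖ ≤ ρ → ‖c‖ ≤ ρ → cᵀ = c →
      X b ≤ X a + (C * (1 + (X a).trace) * (b - a)) • 1 := by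
  obtain ⟨C, hC, h⟩ := IsSubflow.le_first_order n ρ T hρ hT
  refine ⟨C * T + (3 * ρ + T * ρ ^ 2), by positivity, ?_⟩
  intro B c a b X hab hT' hX hB hc hcs
  have hp := hX.posSemidef a ⟨le_rfl, hab⟩
  have htr := hp.trace_nonneg
  have h0 : 0 ≤ b - a := sub_nonneg.2 hab
  have h1 := h B c a b X hab hT' hX hB hc hcs
  have h2 := le_norm_smul_one (transpose_drift (B := B) hp hcs (b - a))
    (norm_drift_sub_le hT hB hc hp h0 hT')
  have h3 := add_le_add h1 h2
  have h4 := smul_one_le_smul_one (n := n)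
    (a := C * (1 + (X a).trace) * (b - a) ^ 2 + (3 * ρ + T * ρ ^ 2) * (1 + (X a).trace) * (b - a))
    (b := (C * T + (3 * ρ + T * ρ ^ 2)) * (1 + (X a).trace) * (b - a)) (by
      have : C * (1 + (X a).trace) * (b - a) * (b - a) ≤ C * (1 + (X a).trace) * (b - a) * T := by
        gcongr
      nlinarith)
  rw [add_smul] at h4
  have h5 := add_le_add h3 h4
  rw [← sub_nonneg] at h5 ⊢
  convert h5 using 1
  abel

/-- For D ≥ 2 one has 1 ≤ D ≤ D(D - 1), so the last summand absorbs every term except D y, which is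
absorbed after multiplication by 1 + y. -/
theorem scalar_le_of_two_le {T C0 ρ h D y z : ℝ} (hT : 0 ≤ T) (hC0 : 0 ≤ C0) (hρ : 0 ≤ ρ)
    (h0 : 0 ≤ h) (hh : h ≤ T) (hD2 : 2 ≤ D) (hy : 0 ≤ y) (t1 : z + 1 ≤ C0 * (y + 1 + D)) :
    z + h * ρ + D * (ρ + y) ≤
      (2 * C0 + T * ρ + ρ + 1) * (1 + y) * (h ^ 2 + h * D + D * (D - 1)) := by
  set x := 1 + y with hx
  have hx1 : 1 ≤ x := by linarith
  have hDD : D ≤ D * (D - 1) := by nlinarith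
  have c1 : x ≤ x * (D * (D - 1)) := le_mul_of_one_le_right (by linarith) (by linarith)
  have c2 : D * (D - 1) ≤ x * (D * (D - 1)) := le_mul_of_one_le_left (by linarith) hx1
  have c3 : x * D ≤ x * (D * (D - 1)) := mul_le_mul_of_nonneg_left hDD (by linarith)
  have d1 : z ≤ 2 * C0 * (x * (D * (D - 1))) := by
    have : C0 * (y + 1 + D) ≤ C0 * (2 * (x * (D * (D - 1)))) :=
      mul_le_mul_of_nonneg_left (by linarith) hC0
    linarith
  have d2 : h * ρ ≤ T * ρ * (x * (D * (D - 1))) :=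
    (mul_le_mul_of_nonneg_right hh hρ).trans
      (le_mul_of_one_le_right (mul_nonneg hT hρ) (by linarith))
  have e1 : ρ * D ≤ ρ * (x * (D * (D - 1))) := mul_le_mul_of_nonneg_left (by linarith) hρ
  have d5 : 0 ≤ (2 * C0 + T * ρ + ρ + 1) * x * (h ^ 2 + h * D) := by positivity
  have d6 : D * (ρ + y) = ρ * D + x * D - D := by rw [hx]; ring
  linarith

/-- With two or more jumps no cancellation is needed: X s is bounded above by its trace, and the
step is bounded below by -(hρ + D(ρ + tr X r)). -/
theorem IsJumpPath.le_step_of_two_le {T ρ C0 : ℝ} (hT : 0 ≤ T) (hρ : 0 ≤ ρ) {𝒯 : Set (Coeff n M)}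
    {N : Fin M → ℝ → ℕ} {X : ℝ → Matrix (Fin n) (Fin n) ℝ} (hX : IsJumpPath T N 𝒯 X)
    {r s : ℝ} (hr : 0 ≤ r) (hrs : r ≤ s) (hs : s ≤ T) (h : total N r + 2 ≤ total N s)
    {θ : Coeff n M} (hθρ : ‖θ‖ ≤ ρ) (hsym : θ.IsSymm) (hC0 : 0 ≤ C0)
    (t1 : (X s).trace + 1 ≤ C0 * ((X r).trace + 1 + ((total N s : ℝ) - total N r))) :
    X s ≤ step θ (s - r) (fun j => (N j s : ℝ) - N j r) (X r)
      + ((2 * C0 + T * ρ + ρ + 1) * (1 + (X r).trace) *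
        ((s - r) ^ 2 + (s - r) * ((total N s : ℝ) - total N r)
          + ((total N s : ℝ) - total N r) * ((total N s : ℝ) - total N r - 1))) • 1 := by
  obtain ⟨hB, hc, hG, hd⟩ := Coeff.norm_le hθρ
  have hrI : r ∈ Icc 0 T := ⟨hr, hrs.trans hs⟩
  have hsI : s ∈ Icc 0 T := ⟨hr.trans hrs, hs⟩
  have hp := hX.posSemidef r hrI
  have htr := hp.trace_nonneg
  have hh0 : 0 ≤ s - r := sub_nonneg.2 hrs
  have hhT : s - r ≤ T := by linarith
  set D : ℝ := (total N s : ℝ) - total N r with hD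
  have hD2 : 2 ≤ D := by
    have : ((total N r + 2 : ℕ) : ℝ) ≤ total N s := by exact_mod_cast h
    push_cast at this
    linarith
  have hsum : D = ∑ j, ((N j s : ℝ) - N j r) := by
    simp [hD, total, Finset.sum_sub_distrib]
  have hXs := le_trace_smul_one (hX.posSemidef s hsI)
  have hjump : ∀ j, ((N j s : ℝ) - N j r) • (-((ρ + (X r).trace) • (1 : Matrix (Fin n) (Fin n) ℝ)))
      ≤ ((N j s : ℝ) - N j r) • (θ.2.2.1 j * X r * (θ.2.2.1 j)ᵀ + θ.2.2.2 j - X r) := by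
    intro j
    have hNj : (N j r : ℝ) ≤ N j s := by exact_mod_cast hX.mono j hrI hsI hrs
    apply smul_le_smul_of_nonneg (sub_nonneg.2 hNj)
    have i1 := Matrix.nonneg_iff_posSemidef.2 (hp.conj (θ.2.2.1 j))
    have i2 := neg_norm_smul_one_le (hsym.2 j) (hd j)
    have i3 := neg_le_neg (le_trace_smul_one hp)
    have i4 := add_le_add (add_le_add i1 i2) i3
    rw [← sub_nonneg] at i4 ⊢
    convert i4 using 1
    rw [add_smul]
    abel
  have hjumps := Finset.sum_le_sum fun j (_ : j ∈ Finset.univ) => hjump j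
  rw [← Finset.sum_smul, ← hsum] at hjumps
  have i1 := Matrix.nonneg_iff_posSemidef.2 (hp.conj (1 + (s - r) • θ.1))
  have i2 := smul_le_smul_of_nonneg hh0 (neg_norm_smul_one_le hsym.1 hc)
  have k := scalar_le_of_two_le hT hC0 hρ hh0 hhT hD2 htr t1
  have g5 := smul_one_le_smul_one (n := n) k
  rw [add_smul, add_smul] at g5
  have g6 := add_le_add (add_le_add (add_le_add (add_le_add hXs i1) i2) hjumps) g5
  rw [← sub_nonneg] at g6 ⊢
  convert g6 using 1
  rw [step, smul_neg, smul_neg, smul_smul, smul_smul]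
  abel

/-- The three error terms match the cases of no jump, one jump and several jumps. Each has
expectation O(h²) for Poisson increments with bounded rates, which is small enough to be summed over
a grid of mesh h. -/
theorem IsJumpPath.le_step {T ρ : ℝ} (hT : 0 ≤ T) (hρ : 0 ≤ ρ) {𝒯 : Set (Coeff n M)}
    {θ₀ : Coeff n M} (hθ₀ : θ₀ ∈ 𝒯) (hG₀ : ∀ j, θ₀.2.2.1 j = 1) :
    ∃ C, 0 ≤ C ∧ ∀ (N : Fin M → ℝ → ℕ) (X : ℝ → Matrix (Fin n) (Fin n) ℝ), IsJumpPath T N 𝒯 X →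
      ∀ r s, 0 ≤ r → r ≤ s → s ≤ T → ∀ θ ∈ 𝒯, ‖θ‖ ≤ ρ → θ.IsSymm →
        X s ≤ step θ (s - r) (fun j => (N j s : ℝ) - N j r) (X r)
          + (C * (1 + (X r).trace) * ((s - r) ^ 2 + (s - r) * ((total N s : ℝ) - total N r)
            + ((total N s : ℝ) - total N r) * ((total N s : ℝ) - total N r - 1))) • 1 := by
  obtain ⟨C0, hC0, htrace⟩ := IsJumpPath.trace_le hT hθ₀ hG₀
  obtain ⟨C1, hC1, hfirst⟩ := IsSubflow.le_first_order n ρ T hρ hT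
  obtain ⟨C2, hC2, hzero⟩ := IsSubflow.le_zeroth_order n ρ T hρ hT
  set Cd := 3 * ρ + T * ρ ^ 2 with hCd
  set C3 := C2 * ρ ^ 2 + 2 * C0 * C2 + Cd with hC3
  set C4 := 2 * C0 + T * ρ + ρ + 1 with hC4
  have hCd0 : 0 ≤ Cd := by positivity
  have hC30 : 0 ≤ C3 := by positivity
  have hC40 : 0 ≤ C4 := by positivity
  refine ⟨C1 + C3 + C4, by positivity, ?_⟩
  intro N X hX r s hr hrs hs θ hθ hθρ hsym
  obtain ⟨hB, hc, hG, hd⟩ := Coeff.norm_le hθρ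
  have hrI : r ∈ Icc 0 T := ⟨hr, hrs.trans hs⟩
  have hsI : s ∈ Icc 0 T := ⟨hr.trans hrs, hs⟩
  have hp := hX.posSemidef r hrI
  have htr := hp.trace_nonneg
  have hh0 : 0 ≤ s - r := sub_nonneg.2 hrs
  have hhT : s - r ≤ T := by linarith
  have hNm := total_monotoneOn hX.mono hrI hsI hrs
  -- For a single jump the drift part of `step` has to be inserted; it differs from X r by O(h).
  have hdrift := neg_norm_smul_one_le (transpose_drift (B := θ.1) hp hsym.1 (s - r))
    (norm_drift_sub_le hT hB hc hp hh0 hhT)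
  rw [← hCd] at hdrift
  rcases (by omega : total N s = total N r ∨ total N s = total N r + 1 ∨
    total N r + 2 ≤ total N s) with h | h | h
  · have hN := eq_of_total_eq hX.mono hrI hsI hrs h
    have h1 := hfirst θ.1 θ.2.1 r s X hrs hhT (hX.flow r s hr hrs hs hN θ hθ) hB hc hsym.1
    have e : step θ (s - r) (fun j => (N j s : ℝ) - N j r) (X r) =
        (1 + (s - r) • θ.1) * X r * (1 + (s - r) • θ.1)ᵀ + (s - r) • θ.2.1 := by
      simp [step, hN]
    rw [e, h]
    refine h1.trans (add_le_add le_rfl (smul_one_le_smul_one ?_))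
    have : 0 ≤ (C3 + C4) * (1 + (X r).trace) * (s - r) ^ 2 := by positivity
    linarith
  · obtain ⟨j, τ, X', hrτ, hτs, hN, hX', hθ'⟩ := hX.jump r s hr hrs hs h
    obtain ⟨f1, f2, f3⟩ := hθ' θ hθ
    have hτI : τ ∈ Icc 0 T := ⟨hr.trans hrτ.le, hτs.trans hs⟩
    have e : step θ (s - r) (fun j => (N j s : ℝ) - N j r) (X r) =
        (1 + (s - r) • θ.1) * X r * (1 + (s - r) • θ.1)ᵀ + (s - r) • θ.2.1
        + (θ.2.2.1 j * X r * (θ.2.2.1 j)ᵀ + θ.2.2.2 j - X r) := by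
      simp [step, hN]
    have g1 := hzero θ.1 θ.2.1 r τ X' hrτ.le (by linarith) f1 hB hc hsym.1
    have g3 := hzero θ.1 θ.2.1 τ s X hτs (by linarith) f3 hB hc hsym.1
    rw [hX'] at g1
    have g2 := conj_le_conj g1 (θ.2.2.1 j)
    have hGG : θ.2.2.1 j * (θ.2.2.1 j)ᵀ ≤ (ρ ^ 2) • (1 : Matrix (Fin n) (Fin n) ℝ) := by
      apply le_norm_smul_one (by simp)
      refine (norm_mul_le _ _).trans ?_
      rw [Matrix.frobenius_norm_transpose, sq]
      exact mul_le_mul (hG j) (hG j) (norm_nonneg _) hρ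
    -- At most one jump occurs up to τ, whence the factor 2.
    have htτ : 1 + (X τ).trace ≤ 2 * C0 * (1 + (X r).trace) := by
      have t1 := htrace N X hX r τ hr hrτ.le hτI.2
      have t2 : (total N τ : ℝ) ≤ total N r + 1 := by
        exact_mod_cast (total_monotoneOn hX.mono hτI hsI hτs).trans h.le
      have : C0 * ((X r).trace + 1 + ((total N τ : ℝ) - total N r)) ≤
          C0 * (2 * (1 + (X r).trace)) := mul_le_mul_of_nonneg_left (by linarith) hC0
      linarith
    have g4 := smul_le_smul_of_nonneg
      (a := C2 * (1 + (X r).trace) * (τ - r)) (by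
        have := sub_nonneg.2 hrτ.le; positivity) hGG
    have k1 : C2 * (1 + (X r).trace) * (τ - r) * ρ ^ 2 + C2 * (1 + (X τ).trace) * (s - τ)
        + Cd * (1 + (X r).trace) * (s - r) ≤ C3 * (1 + (X r).trace) * (s - r) := by
      have a1 : C2 * (1 + (X r).trace) * (τ - r) * ρ ^ 2 ≤
          C2 * (1 + (X r).trace) * (s - r) * ρ ^ 2 := by gcongr
      have a2 : C2 * (1 + (X τ).trace) * (s - τ) ≤
          C2 * (2 * C0 * (1 + (X r).trace)) * (s - r) := by
        have := sub_nonneg.2 hτs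
        gcongr
      rw [hC3]; linarith
    have g5 := smul_one_le_smul_one (n := n) k1
    rw [add_smul, add_smul, mul_smul _ (ρ ^ 2)] at g5
    have g6 := add_le_add (add_le_add (add_le_add (add_le_add (add_le_add g3 f2) g2) g4) hdrift) g5
    have hfin : X s ≤ step θ (s - r) (fun j => (N j s : ℝ) - N j r) (X r) +
        (C3 * (1 + (X r).trace) * (s - r)) • 1 := by
      rw [e]
      rw [← sub_nonneg] at g6 ⊢
      convert g6 using 1
      simp only [mul_add, add_mul, mul_smul_comm, smul_mul_assoc, mul_one]
      abel
    refine hfin.trans (add_le_add le_rfl (smul_one_le_smul_one ?_))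
    rw [h]
    push_cast
    have b1 : 0 ≤ (C1 + C4) * (1 + (X r).trace) * (s - r) := by positivity
    have b2 : 0 ≤ (C1 + C3 + C4) * (1 + (X r).trace) * (s - r) ^ 2 := by positivity
    linarith
  · refine (hX.le_step_of_two_le hT hρ hr hrs hs h hθρ hsym hC0
      (htrace N X hX r s hr hrs hs)).trans (add_le_add le_rfl (smul_one_le_smul_one ?_))
    rw [← hC4]
    have hD : (0 : ℝ) ≤ (total N s : ℝ) - total N r - 1 := by
      have : ((total N r + 2 : ℕ) : ℝ) ≤ total N s := by exact_mod_cast h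
      push_cast at this
      linarith
    have hD' : (0 : ℝ) ≤ (total N s : ℝ) - total N r := by linarith
    have : 0 ≤ (C1 + C3) * (1 + (X r).trace) * ((s - r) ^ 2 + (s - r) *
        ((total N s : ℝ) - total N r) + ((total N s : ℝ) - total N r) *
        ((total N s : ℝ) - total N r - 1)) := by positivity
    linarith

end OneStep

end CDKF

namespace CDKF

/-! ### Càdlàg functions and counting paths -/

section Cadlag

/-- One-sided limits bound f on each side of every point; compactness makes the bound global. -/
theorem exists_bound_of_cadlag {f : ℝ → ℝ} {T : ℝ}
    (hr : ∀ t ∈ Ico 0 T, ContinuousWithinAt f (Ici t) t)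
    (hl : ∀ t ∈ Ioc 0 T, ∃ L, Tendsto f (𝓝[<] t) (𝓝 L)) :
    ∃ C, ∀ t ∈ Icc 0 T, ‖f t‖ ≤ C := by
  have key : ∃ C, ∀ t ∈ Icc 0 T, t ∈ Icc 0 T → ‖f t‖ ≤ C := by
    refine isCompact_Icc.induction_on (p := fun S => ∃ C, ∀ t ∈ S, t ∈ Icc 0 T → ‖f t‖ ≤ C)
      ⟨0, by simp⟩ (fun S S' h ⟨C, hC⟩ => ⟨C, fun t ht => hC t (h ht)⟩) ?_ ?_
    · rintro S S' ⟨C, hC⟩ ⟨C', hC'⟩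
      exact ⟨max C C', fun t ht hI => ht.elim (fun h => (hC t h hI).trans (le_max_left _ _))
        (fun h => (hC' t h hI).trans (le_max_right _ _))⟩
    · intro x hx
      have h1 : ∃ C, ∀ᶠ y in 𝓝[<] x, y ∈ Icc 0 T → ‖f y‖ ≤ C := by
        rcases hx.1.eq_or_lt with rfl | h0
        · refine ⟨0, ?_⟩
          filter_upwards [self_mem_nhdsWithin] with y hy hI
          exact absurd hI.1 (not_le.2 hy)
        · obtain ⟨L, hL⟩ := hl x ⟨h0, hx.2⟩
          refine ⟨‖L‖ + 1, ?_⟩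
          filter_upwards [hL.norm.eventually_lt_const (lt_add_one ‖L‖)] with y hy _
          exact hy.le
      have h2 : ∃ C, ∀ᶠ y in 𝓝[≥] x, y ∈ Icc 0 T → ‖f y‖ ≤ C := by
        rcases hx.2.eq_or_lt with rfl | h0
        · refine ⟨‖f x‖, ?_⟩
          filter_upwards [self_mem_nhdsWithin] with y hy hI
          rw [le_antisymm hI.2 hy]
        · refine ⟨‖f x‖ + 1, ?_⟩
          filter_upwards [(hr x ⟨hx.1, h0⟩).norm.tendsto.eventually_lt_const
            (lt_add_one ‖f x‖)] with y hy _
          exact hy.le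
      obtain ⟨C1, h1⟩ := h1
      obtain ⟨C2, h2⟩ := h2
      have h3 : ∀ᶠ y in 𝓝 x, y ∈ Icc 0 T → ‖f y‖ ≤ max C1 C2 := by
        rw [← nhdsLT_sup_nhdsGE, eventually_sup]
        exact ⟨h1.mono fun y hy hI => (hy hI).trans (le_max_left _ _),
          h2.mono fun y hy hI => (hy hI).trans (le_max_right _ _)⟩
      exact ⟨_, mem_nhdsWithin_of_mem_nhds h3, _, fun t ht => ht⟩
  obtain ⟨C, hC⟩ := key
  exact ⟨C, fun t ht => hC t ht ht⟩

theorem aestronglyMeasurable_of_rightContinuous {f : ℝ → ℝ} {T : ℝ}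
    (hr : ∀ t ∈ Ico 0 T, ContinuousWithinAt f (Ici t) t) :
    AEStronglyMeasurable f (volume.restrict (Ioc 0 T)) := by
  rw [← restrict_Ioo_eq_restrict_Ioc]
  -- The point of the grid (m + 1)⁻¹ℤ strictly to the right of t, capped at T. Each f ∘ g m factors
  -- through the integers, and right-continuity gives convergence.
  let g : ℕ → ℝ → ℝ := fun m t => min T ((⌊(m + 1 : ℝ) * t⌋ + 1 : ℝ) / (m + 1))
  refine aestronglyMeasurable_of_tendsto_ae atTop (f := fun m t => f (g m t)) (fun m => ?_) ?_
  · apply Measurable.aestronglyMeasurable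
    have h1 : Measurable (fun z : ℤ => f (min T (((z : ℝ) + 1) / (m + 1)))) :=
      measurable_from_top
    exact h1.comp (Int.measurable_floor.comp (measurable_const.mul measurable_id))
  · filter_upwards [ae_restrict_mem measurableSet_Ioo] with t ht
    refine (hr t ⟨ht.1.le, ht.2⟩).tendsto.comp (tendsto_nhdsWithin_iff.2 ⟨?_, ?_⟩)
    · have hlim : Tendsto (fun m : ℕ => t + 1 / ((m : ℝ) + 1)) atTop (𝓝 t) := by
        simpa using tendsto_const_nhds.add (tendsto_one_div_add_atTop_nhds_zero_nat (𝕜 := ℝ))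
      refine tendsto_of_tendsto_of_tendsto_of_le_of_le tendsto_const_nhds hlim (fun m => ?_)
        (fun m => ?_)
      · refine le_min ht.2.le ?_
        rw [le_div_iff₀ (by positivity), mul_comm]
        exact (Int.lt_floor_add_one _).le
      · refine (min_le_right _ _).trans ?_
        have hm : (0 : ℝ) < m + 1 := by positivity
        have := Int.floor_le ((m + 1 : ℝ) * t)
        have e : (t + 1 / ((m : ℝ) + 1)) * (m + 1) = (m + 1) * t + 1 := by field_simp
        rw [div_le_iff₀ hm, e]
        linarith
    · refine Eventually.of_forall fun m => ?_
      refine le_min ht.2.le ?_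
      rw [le_div_iff₀ (by positivity), mul_comm]
      exact (Int.lt_floor_add_one _).le

theorem intervalIntegrable_of_cadlag {f : ℝ → ℝ} {T : ℝ} (hT : 0 ≤ T)
    (hr : ∀ t ∈ Ico 0 T, ContinuousWithinAt f (Ici t) t)
    (hl : ∀ t ∈ Ioc 0 T, ∃ L, Tendsto f (𝓝[<] t) (𝓝 L)) : IntervalIntegrable f volume 0 T := by
  obtain ⟨C, hC⟩ := exists_bound_of_cadlag hr hl
  rw [intervalIntegrable_iff_integrableOn_Ioc_of_le hT]
  refine Integrable.of_bound (aestronglyMeasurable_of_rightContinuous hr) C ?_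
  filter_upwards [ae_restrict_mem measurableSet_Ioc] with t ht
  exact hC t ⟨ht.1.le, ht.2⟩

variable {N : ℝ → ℕ} {T : ℝ}

/-- A monotone integer-valued path bounded by N v attains its maximum on [0, v) and is constant from
there up to v. -/
theorem exists_eq_leftLim (hN : MonotoneOn N (Icc 0 T)) {v : ℝ} (hv : v ∈ Ioc 0 T) :
    ∃ a ∈ Ico 0 v, ∀ y ∈ Ico a v, N y = Function.leftLim N v := by
  have hvI : v ∈ Icc 0 T := ⟨hv.1.le, hv.2⟩
  have hfin : (N '' Ico 0 v).Finite := by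
    refine (finite_Iic (N v)).subset ?_
    rintro _ ⟨y, hy, rfl⟩
    exact hN ⟨hy.1, hy.2.le.trans hv.2⟩ hvI hy.2.le
  obtain ⟨a, ha, hmax⟩ := hfin.exists_maximalFor' N (Ico 0 v) ⟨0, le_rfl, hv.1⟩
  have hconst : ∀ y ∈ Ico a v, N y = N a := fun y hy =>
    le_antisymm
      (by
        by_contra hc
        exact hc (hmax ⟨ha.1.trans hy.1, hy.2⟩ (not_le.1 hc).le))
      (hN ⟨ha.1, ha.2.le.trans hv.2⟩ ⟨ha.1.trans hy.1, hy.2.le.trans hv.2⟩ hy.1)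
  have hlim : Function.leftLim N v = N a := by
    apply leftLim_eq_of_tendsto
    apply tendsto_nhds_of_eventually_eq
    filter_upwards [Ico_mem_nhdsLT ha.2] with y hy using hconst y hy
  exact ⟨a, ha, fun y hy => (hconst y hy).trans hlim.symm⟩

theorem leftLim_eq_of_const {r v : ℝ} (hrv : r < v) {k : ℕ} (h : ∀ y ∈ Ico r v, N y = k) :
    Function.leftLim N v = k := by
  apply leftLim_eq_of_tendsto
  apply tendsto_nhds_of_eventually_eq
  filter_upwards [Ico_mem_nhdsLT hrv] with y hy using h y hy

/-- The path strictly increases from one jump time to the next, so N embeds the jump times into the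
integers up to N T. This makes the `finsum` in `countingIntegral` a genuine finite sum. -/
theorem finite_jumps (hN : MonotoneOn N (Icc 0 T)) :
    {v ∈ Ioc 0 T | N v ≠ Function.leftLim N v}.Finite := by
  rcases lt_or_ge T 0 with hT | hT
  · exact (Set.finite_empty).subset fun v hv => absurd (hv.1.1.trans_le hv.1.2) (not_lt.2 hT.le)
  refine Set.Finite.of_finite_image (f := N) ((finite_Iic (N T)).subset ?_) ?_
  · rintro _ ⟨y, hy, rfl⟩
    exact hN ⟨hy.1.1.le, hy.1.2⟩ ⟨hT, le_rfl⟩ hy.1.2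
  · have key : ∀ u ∈ {v ∈ Ioc 0 T | N v ≠ Function.leftLim N v},
        ∀ v ∈ {v ∈ Ioc 0 T | N v ≠ Function.leftLim N v}, u < v → N u < N v := by
      intro u hu v hv huv
      obtain ⟨a, ha, hav⟩ := exists_eq_leftLim hN hv.1
      have hm : max a u ∈ Ico a v := ⟨le_max_left _ _, max_lt ha.2 huv⟩
      have h1 : N u ≤ N (max a u) := hN ⟨hu.1.1.le, hu.1.2⟩
        ⟨ha.1.trans hm.1, hm.2.le.trans hv.1.2⟩ (le_max_right _ _)
      have h2 : N (max a u) ≤ N v := hN ⟨ha.1.trans hm.1, hm.2.le.trans hv.1.2⟩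
        ⟨hv.1.1.le, hv.1.2⟩ hm.2.le
      rw [hav _ hm] at h1 h2
      exact h1.trans_lt (lt_of_le_of_ne h2 (Ne.symm hv.2))
    intro u hu v hv huv
    rcases lt_trichotomy u v with h | h | h
    · exact absurd huv (key u hu v hv h).ne
    · exact h
    · exact absurd huv (key v hv u hu h).ne'

theorem countingIntegral_eq_add {m n : Type*} (hN : MonotoneOn N (Icc 0 T))
    (F : ℝ → Matrix m n ℝ) {r u : ℝ} (hr : 0 ≤ r) (hru : r ≤ u) (hu : u ≤ T) :
    countingIntegral N F u = countingIntegral N F r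
      + ∑ᶠ s ∈ Ioc r u, ((N s : ℝ) - ((Function.leftLim N s : ℕ) : ℝ)) • F s := by
  have hfin : ∀ a b, 0 ≤ a → b ≤ T → (Ioc a b ∩ Function.support
      (fun s => ((N s : ℝ) - ((Function.leftLim N s : ℕ) : ℝ)) • F s)).Finite := by
    intro a b ha hb
    refine (finite_jumps hN).subset ?_
    rintro v ⟨hv, hs⟩
    refine ⟨⟨ha.trans_lt hv.1, hv.2.trans hb⟩, fun h => hs ?_⟩
    simp [← h]
  rw [countingIntegral, ← Ioc_union_Ioc_eq_Ioc hr hru,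
    finsum_mem_union' _ (hfin 0 r le_rfl (hru.trans hu)) (hfin r u hr hu)]
  · rfl
  · exact Set.disjoint_left.2 fun x hx hx' => absurd hx.2 (not_le.2 hx'.1)

theorem countingIntegral_eq_of_const {m n : Type*} (hN : MonotoneOn N (Icc 0 T))
    (F : ℝ → Matrix m n ℝ) {r u : ℝ} (hr : 0 ≤ r) (hru : r ≤ u) (hu : u ≤ T) (h : N u = N r) :
    countingIntegral N F u = countingIntegral N F r := by
  have hc : ∀ y ∈ Icc r u, N y = N r := fun y hy => le_antisymm
    ((hN ⟨hr.trans hy.1, hy.2.trans hu⟩ ⟨hr.trans hru, hu⟩ hy.2).trans h.le)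
    (hN ⟨hr, hru.trans hu⟩ ⟨hr.trans hy.1, hy.2.trans hu⟩ hy.1)
  rw [countingIntegral_eq_add hN F hr hru hu, finsum_mem_eq_zero_of_forall_eq_zero, add_zero]
  intro v hv
  rw [leftLim_eq_of_const hv.1 (k := N r) fun y hy => hc y ⟨hy.1, hy.2.le.trans hv.2⟩,
    hc v ⟨hv.1.le, hv.2⟩]
  simp

theorem countingIntegral_eq_of_jump {m n : Type*} (hN : MonotoneOn N (Icc 0 T))
    (F : ℝ → Matrix m n ℝ) {r u : ℝ} (hr : 0 ≤ r) (hru : r < u) (hu : u ≤ T)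
    (hc : ∀ y ∈ Ico r u, N y = N r) (h : N u = N r + 1) :
    countingIntegral N F u = countingIntegral N F r + F u := by
  rw [countingIntegral_eq_add hN F hr hru.le hu]
  congr 1
  rw [finsum_eq_single _ u]
  · have : u ∈ Ioc r u := ⟨hru, le_rfl⟩
    rw [finsum_eq_if, if_pos this, leftLim_eq_of_const hru hc, h]
    simp
  · intro v hv
    rw [finsum_eq_if]
    split_ifs with hvI
    · have hvu : v < u := lt_of_le_of_ne hvI.2 hv
      rw [leftLim_eq_of_const hvI.1 (k := N r) fun y hy => hc y ⟨hy.1, hy.2.trans hvu⟩,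
        hc v ⟨hvI.1.le, hvu⟩]
      simp
    · rfl

end Cadlag

end CDKF

namespace CDKF

/-! ### Paths of the error covariance -/

section CovPath

variable {n M : ℕ}

theorem hasDerivAt_of_entries {f : ℝ → Matrix (Fin n) (Fin n) ℝ} {f' : Matrix (Fin n) (Fin n) ℝ}
    {x : ℝ} (h : ∀ i k, HasDerivAt (fun t => f t i k) (f' i k) x) : HasDerivAt f f' x := by
  have e : ∀ X : Matrix (Fin n) (Fin n) ℝ, X = ∑ i, ∑ k, X i k • Matrix.single i k (1 : ℝ) := by
    intro X
    conv_lhs => rw [Matrix.matrix_eq_sum_single X]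
    simp
  have h1 : HasDerivAt (fun t => ∑ i, ∑ k, f t i k • Matrix.single i k (1 : ℝ))
      (∑ i, ∑ k, f' i k • Matrix.single i k (1 : ℝ)) x :=
    HasDerivAt.fun_sum fun i _ => HasDerivAt.fun_sum fun k _ => (h i k).smul_const _
  rw [← e f'] at h1
  exact h1.congr_of_eventuallyEq (Eventually.of_forall fun t => e (f t))

theorem continuousOn_of_entries {f : ℝ → Matrix (Fin n) (Fin n) ℝ} {s : Set ℝ}
    (h : ∀ i k, ContinuousOn (fun t => f t i k) s) : ContinuousOn f s :=
  continuousOn_pi.2 fun i => continuousOn_pi.2 fun k => h i k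

theorem continuousOn_matIntegral {F : ℝ → Matrix (Fin n) (Fin n) ℝ} {T : ℝ} (hT : 0 ≤ T)
    (hF : ∀ i k, IntervalIntegrable (fun s => F s i k) volume 0 T) :
    ContinuousOn (matIntegral F) (Icc 0 T) := by
  refine continuousOn_of_entries fun i k => ?_
  have := intervalIntegral.continuousOn_primitive_interval' (hF i k) (left_mem_uIcc)
  rwa [uIcc_of_le hT] at this

theorem hasDerivAt_matIntegral {F : ℝ → Matrix (Fin n) (Fin n) ℝ} {T : ℝ} (hT : 0 ≤ T)
    (hF : ∀ i k, IntervalIntegrable (fun s => F s i k) volume 0 T) {u : ℝ} (hu : u ∈ Ioo 0 T)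
    (hc : ContinuousAt F u) : HasDerivAt (matIntegral F) (F u) u := by
  refine hasDerivAt_of_entries fun i k => ?_
  refine intervalIntegral.integral_hasDerivAt_right ((hF i k).mono_set ?_) ?_
    (((entryCLM i k).continuous.continuousAt).comp hc)
  · rw [uIcc_of_le hT, uIcc_of_le hu.1.le]
    exact Icc_subset_Icc_right hu.2.le
  · have h1 := ((intervalIntegrable_iff_integrableOn_Ioc_of_le hT).1 (hF i k)).1
    exact ⟨Ioc 0 T, Ioc_mem_nhds hu.1 hu.2, h1⟩

variable {p : Fin M → ℕ} {T : ℝ} {A Q : Matrix (Fin n) (Fin n) ℝ}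
  {H : (j : Fin M) → Matrix (Fin (p j)) (Fin n) ℝ}
  {R : (j : Fin M) → Matrix (Fin (p j)) (Fin (p j)) ℝ}
  {N : Fin M → ℝ → ℕ} {P : ℝ → Matrix (Fin n) (Fin n) ℝ}

theorem IsCovPath.integrable (h : IsCovPath T A Q H R N P) (hT : 0 ≤ T) (i k : Fin n) :
    IntervalIntegrable (fun s => (A * P s + P s * Aᵀ + Q) i k) volume 0 T := by
  have hc : Continuous fun X : Matrix (Fin n) (Fin n) ℝ => (A * X + X * Aᵀ + Q) i k := by
    have : Continuous fun X : Matrix (Fin n) (Fin n) ℝ => A * X + X * Aᵀ + Q := by fun_prop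
    exact this.matrix_elem i k
  refine intervalIntegrable_of_cadlag hT (fun t ht => ?_) fun t ht => ?_
  · exact hc.continuousAt.comp_continuousWithinAt (h.rightContinuous t ht)
  · obtain ⟨L, hL⟩ := h.leftLimits t ht
    exact ⟨_, (hc.tendsto L).comp hL⟩

/-- The continuous path which follows the drift of `P` from `P r` on. -/
noncomputable def driftPath (A Q : Matrix (Fin n) (Fin n) ℝ) (P : ℝ → Matrix (Fin n) (Fin n) ℝ)
    (r u : ℝ) : Matrix (Fin n) (Fin n) ℝ :=
  P r + (matIntegral (fun s => A * P s + P s * Aᵀ + Q) u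
    - matIntegral (fun s => A * P s + P s * Aᵀ + Q) r)

theorem driftPath_self (r : ℝ) : driftPath A Q P r r = P r := by simp [driftPath]

theorem IsCovPath.eq_driftPath (h : IsCovPath T A Q H R N P)
    (hN : ∀ j, MonotoneOn (N j) (Icc 0 T)) {r u : ℝ} (hr : 0 ≤ r) (hru : r ≤ u) (hu : u ≤ T)
    (hc : ∀ j, N j u = N j r) : P u = driftPath A Q P r u := by
  rw [driftPath, h.eq u ⟨hr.trans hru, hu⟩, h.eq r ⟨hr, hru.trans hu⟩]
  rw [Finset.sum_congr rfl fun j _ =>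
    countingIntegral_eq_of_const (hN j) _ hr hru hu (hc j)]
  abel

/-- Agreement with P is required only on the open interval, so the flow extends continuously to a
jump time τ, where its value is the left limit of P. -/
theorem IsCovPath.isFlow_driftPath (h : IsCovPath T A Q H R N P) (hT : 0 ≤ T) {r τ : ℝ}
    (hr : 0 ≤ r) (hτ : τ ≤ T) (he : ∀ u ∈ Ioo r τ, P u = driftPath A Q P r u) :
    IsFlow A Q r τ (driftPath A Q P r) where
  continuousOn := by
    have := (continuousOn_matIntegral hT (h.integrable hT)).mono (Icc_subset_Icc hr hτ)
    exact continuousOn_const.add (this.sub continuousOn_const)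
  hasDerivAt u hu := by
    have hcont : ContinuousOn (driftPath A Q P r) (Icc r τ) := by
      have := (continuousOn_matIntegral hT (h.integrable hT)).mono (Icc_subset_Icc hr hτ)
      exact continuousOn_const.add (this.sub continuousOn_const)
    have hPc : ContinuousAt P u := by
      refine ((hcont.continuousAt (Icc_mem_nhds hu.1 hu.2)).congr ?_)
      filter_upwards [Ioo_mem_nhds hu.1 hu.2] with v hv using (he v hv).symm
    have hFc : ContinuousAt (fun s => A * P s + P s * Aᵀ + Q) u := by fun_prop
    have := hasDerivAt_matIntegral hT (h.integrable hT)
      ⟨hr.trans_lt hu.1, hu.2.trans_le hτ⟩ hFc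
    refine ((this.sub_const _).const_add (P r)).congr_deriv ?_
    rw [he u hu]

theorem IsFlow.congr {X X' : ℝ → Matrix (Fin n) (Fin n) ℝ} {a b : ℝ} (h : IsFlow A Q a b X)
    (he : ∀ u ∈ Icc a b, X' u = X u) : IsFlow A Q a b X' where
  continuousOn := h.continuousOn.congr he
  hasDerivAt u hu := by
    have := h.hasDerivAt u hu
    rw [← he u (Ioo_subset_Icc_self hu)] at this
    refine this.congr_of_eventuallyEq ?_
    filter_upwards [Icc_mem_nhds hu.1 hu.2] with v hv using he v hv

theorem IsCovPath.isFlow (h : IsCovPath T A Q H R N P) (hT : 0 ≤ T)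
    (hN : ∀ j, MonotoneOn (N j) (Icc 0 T)) {r s : ℝ} (hr : 0 ≤ r) (hs : s ≤ T)
    (hc : ∀ j, N j s = N j r) : IsFlow A Q r s P := by
  have he : ∀ u ∈ Icc r s, P u = driftPath A Q P r u := fun u hu =>
    h.eq_driftPath hN hr hu.1 (hu.2.trans hs) fun j => le_antisymm
      ((hN j ⟨hr.trans hu.1, hu.2.trans hs⟩ ⟨(hr.trans hu.1).trans hu.2, hs⟩ hu.2).trans (hc j).le)
      (hN j ⟨hr, hu.1.trans (hu.2.trans hs)⟩ ⟨hr.trans hu.1, hu.2.trans hs⟩ hu.1)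
  exact (h.isFlow_driftPath hT hr hs fun u hu => he u (Ioo_subset_Icc_self hu)).congr he

theorem exists_unique_jump (hN : ∀ j, MonotoneOn (N j) (Icc 0 T)) {r s : ℝ} (hr : 0 ≤ r)
    (hrs : r ≤ s) (hs : s ≤ T) (h : total N s = total N r + 1) :
    ∃ j, ∀ i, N i s = N i r + if i = j then 1 else 0 := by
  have hle : ∀ i, N i r ≤ N i s := fun i => hN i ⟨hr, hrs.trans hs⟩ ⟨hr.trans hrs, hs⟩ hrs
  have hsum : ∑ i, (N i s - N i r) = 1 := by
    have : ∑ i, (N i s - N i r) + ∑ i, N i r = ∑ i, N i s := by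
      rw [← Finset.sum_add_distrib]
      exact Finset.sum_congr rfl fun i _ => Nat.sub_add_cancel (hle i)
    simp only [total] at h
    omega
  obtain ⟨j, hj⟩ : ∃ j, N j s - N j r ≠ 0 := by
    by_contra hc
    push Not at hc
    simp [hc] at hsum
  have hrest := Finset.add_sum_erase Finset.univ (fun i => N i s - N i r) (Finset.mem_univ j)
  rw [hsum] at hrest
  have h0 : ∑ i ∈ Finset.univ.erase j, (N i s - N i r) = 0 := by omega
  refine ⟨j, fun i => ?_⟩
  have := hle i
  split_ifs with hij
  · subst hij; omega
  · have := Finset.sum_eq_zero_iff.1 h0 i (Finset.mem_erase.2 ⟨hij, Finset.mem_univ i⟩)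
    omega

/-- A path with one jump is cut at the jump time: drift up to the left limit, one Kalman update,
drift again. The auxiliary X is needed because P itself is discontinuous at τ. -/
theorem IsCovPath.exists_jump (h : IsCovPath T A Q H R N P) (hT : 0 ≤ T)
    (hN : ∀ j, MonotoneOn (N j) (Icc 0 T))
    (hrc : ∀ j, ∀ t ∈ Ico 0 T, ContinuousWithinAt (N j) (Ici t) t) {r s : ℝ} (hr : 0 ≤ r)
    (hrs : r ≤ s) (hs : s ≤ T) (h1 : total N s = total N r + 1) :
    ∃ (j : Fin M) (τ : ℝ) (X : ℝ → Matrix (Fin n) (Fin n) ℝ), r < τ ∧ τ ≤ s ∧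
      (∀ i, N i s = N i r + if i = j then 1 else 0) ∧ X r = P r ∧ IsFlow A Q r τ X ∧
      P τ = X τ - covGain (H j) (R j) (X τ) ∧ IsFlow A Q τ s P := by
  obtain ⟨j, hj⟩ := exists_unique_jump hN hr hrs hs h1
  have hI : ∀ {u}, u ∈ Icc r s → u ∈ Icc 0 T := fun hu => ⟨hr.trans hu.1, hu.2.trans hs⟩
  have hrI : r ∈ Icc r s := ⟨le_rfl, hrs⟩
  have hsI : s ∈ Icc r s := ⟨hrs, le_rfl⟩
  have hjj : N j s = N j r + 1 := by simpa using hj j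
  set S : Set ℝ := {u ∈ Icc r s | N j u = N j r + 1} with hS
  have hsS : s ∈ S := ⟨hsI, hjj⟩
  have hSb : BddBelow S := ⟨r, fun u hu => hu.1.1⟩
  set τ := sInf S with hτ
  have hτs : τ ≤ s := csInf_le hSb hsS
  have hrτ' : r ≤ τ := le_csInf ⟨s, hsS⟩ fun u hu => hu.1.1
  have hτI : τ ∈ Icc r s := ⟨hrτ', hτs⟩
  -- Right-continuity of the counter makes the infimum attained.
  have hNτ : N j τ = N j r + 1 := by
    rcases hτs.eq_or_lt with he | hlt
    · rw [he, hjj]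
    · have hev := (hrc j τ ⟨(hI hτI).1, hlt.trans_le hs⟩)
      have hev' : ∀ᶠ u in 𝓝[≥] τ, N j u = N j τ := by
        have := hev.tendsto (IsOpen.mem_nhds (isOpen_discrete {N j τ}) rfl)
        exact this
      obtain ⟨b, hb, hb'⟩ := mem_nhdsGE_iff_exists_Ico_subset.1 hev'
      obtain ⟨u, huS, hub⟩ := exists_lt_of_csInf_lt ⟨s, hsS⟩ hb
      have := hb' ⟨csInf_le hSb huS, hub⟩
      exact this.symm.trans huS.2
  have hrτ : r < τ := lt_of_le_of_ne hrτ' fun he => by rw [← he] at hNτ; omega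
  have hbefore : ∀ u ∈ Ico r τ, ∀ i, N i u = N i r := by
    intro u hu i
    have huI : u ∈ Icc r s := ⟨hu.1, hu.2.le.trans hτs⟩
    have a1 := hN i (hI hrI) (hI huI) hu.1
    have a2 := hN i (hI huI) (hI hsI) huI.2
    have a3 := hj i
    by_cases hij : i = j
    · subst hij
      have : N i u ≠ N i r + 1 := fun hc => absurd (csInf_le hSb (⟨huI, hc⟩ : u ∈ S))
        (not_le.2 hu.2)
      simp only [if_true] at a3
      omega
    · simp only [if_neg hij] at a3
      omega
  have hafter : ∀ i, N i s = N i τ := by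
    intro i
    have a1 := hN i (hI hrI) (hI hτI) hrτ'
    have a2 := hN i (hI hτI) (hI hsI) hτs
    have a3 := hj i
    by_cases hij : i = j
    · subst hij
      rw [hjj, hNτ]
    · simp only [if_neg hij] at a3
      omega
  have heq : ∀ u ∈ Ico r τ, P u = driftPath A Q P r u := fun u hu =>
    h.eq_driftPath hN hr hu.1 ((hu.2.le.trans hτs).trans hs) fun i => hbefore u hu i
  have hflow := h.isFlow_driftPath hT hr (hτs.trans hs) fun u hu => heq u ⟨hu.1.le, hu.2⟩
  -- The counting integral evaluates the gain at the left limit, which is the end point of the drift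
  -- path.
  have hlim : Function.leftLim P τ = driftPath A Q P r τ := by
    apply leftLim_eq_of_tendsto
    have h2 := (hflow.continuousOn τ ⟨hrτ', le_rfl⟩).mono Ico_subset_Icc_self
    have h3 : Tendsto (driftPath A Q P r) (𝓝[<] τ) (𝓝 (driftPath A Q P r τ)) := by
      have := h2.tendsto
      rwa [nhdsWithin_Ico_eq_nhdsLT hrτ] at this
    refine h3.congr' ?_
    filter_upwards [Ico_mem_nhdsLT hrτ] with u hu using (heq u hu).symm
  refine ⟨j, τ, driftPath A Q P r, hrτ, hτs, hj, driftPath_self r, hflow, ?_,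
    h.isFlow hT hN (hr.trans hrτ') hs hafter⟩
  have hsum : ∑ i, countingIntegral (N i)
      (fun s => covGain (H i) (R i) (Function.leftLim P s)) τ
      = ∑ i, countingIntegral (N i) (fun s => covGain (H i) (R i) (Function.leftLim P s)) r
        + covGain (H j) (R j) (driftPath A Q P r τ) := by
    have hterm : ∀ i, countingIntegral (N i)
        (fun s => covGain (H i) (R i) (Function.leftLim P s)) τ
        = countingIntegral (N i) (fun s => covGain (H i) (R i) (Function.leftLim P s)) r
          + if i = j then covGain (H j) (R j) (driftPath A Q P r τ) else 0 := by
      intro i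
      split_ifs with hij
      · subst hij
        rw [countingIntegral_eq_of_jump (hN i) _ hr hrτ (hτs.trans hs)
          (fun y hy => hbefore y hy i) hNτ, hlim]
      · rw [countingIntegral_eq_of_const (hN i) _ hr hrτ' (hτs.trans hs), add_zero]
        rw [← hafter i, hj i, if_neg hij, add_zero]
    rw [Finset.sum_congr rfl fun i _ => hterm i, Finset.sum_add_distrib]
    simp
  rw [h.eq τ (hI hτI), hsum]
  conv_rhs => rw [driftPath, h.eq r (hI hrI)]
  rw [driftPath]
  conv_lhs => rw [h.eq r (hI hrI)]
  abel

/-- Induction over grid cells: each contains at most one jump, and both the Lyapunov flow and the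
Kalman update preserve definiteness. -/
theorem IsCovPath.posDef (h : IsCovPath T A Q H R N P) (hT : 0 ≤ T) (hQ : Q.PosSemidef)
    (hR : ∀ j, (R j).PosDef) (hN : ∀ j, MonotoneOn (N j) (Icc 0 T))
    (hrc : ∀ j, ∀ t ∈ Ico 0 T, ContinuousWithinAt (N j) (Ici t) t)
    (hcells : ∃ m : ℕ, ∀ k < 2 ^ m, total N (gridPt T m (k + 1)) ≤ total N (gridPt T m k) + 1)
    (h0 : (P 0).PosDef) : ∀ t ∈ Icc 0 T, (P t).PosDef := by
  obtain ⟨m, hm⟩ := hcells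
  have key : ∀ k ≤ 2 ^ m, ∀ t ∈ Icc 0 (gridPt T m k), (P t).PosDef := by
    intro k
    induction k with
    | zero =>
      intro _ t ht
      rw [gridPt_zero] at ht
      rwa [le_antisymm ht.2 ht.1]
    | succ k ih =>
      intro hk t ht
      have hka := gridPt_mem hT (m := m) (Nat.le_of_succ_le hk)
      have hkb := gridPt_mem hT (m := m) hk
      rcases le_total t (gridPt T m k) with h1 | h1
      · exact ih (Nat.le_of_succ_le hk) t ⟨ht.1, h1⟩
      have hPa := ih (Nat.le_of_succ_le hk) _ ⟨hka.1, le_rfl⟩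
      have htI : t ∈ Icc 0 T := ⟨ht.1, ht.2.trans hkb.2⟩
      have hmono := total_monotoneOn hN
      have a1 := hmono hka htI h1
      have a2 := hmono htI hkb ht.2
      have a3 := hm k hk
      rcases (by omega : total N t = total N (gridPt T m k) ∨
          total N t = total N (gridPt T m k) + 1) with h2 | h2
      · exact (h.isFlow hT hN hka.1 htI.2 (eq_of_total_eq hN hka htI h1 h2)).posDef hQ hPa t
          ⟨h1, le_rfl⟩
      · obtain ⟨j, τ, X, hrτ, hτs, -, hX, f1, f2, f3⟩ :=
          h.exists_jump hT hN hrc hka.1 h1 htI.2 h2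
        rw [← hX] at hPa
        have hτ := sub_covGain_posDef (H := H j) (hR j) (f1.posDef hQ hPa τ ⟨hrτ.le, le_rfl⟩)
        rw [← f2] at hτ
        exact f3.posDef hQ hτ t ⟨hτs, le_rfl⟩
  intro t ht
  exact key _ le_rfl t (by rwa [gridPt_last])

/-- Coefficients of the affine dynamics which dominate the covariance: one for each choice of
gains. -/
def covCoeffs (A Q : Matrix (Fin n) (Fin n) ℝ) (H : (j : Fin M) → Matrix (Fin (p j)) (Fin n) ℝ)
    (R : (j : Fin M) → Matrix (Fin (p j)) (Fin (p j)) ℝ) : Set (Coeff n M) :=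
  range fun K : (j : Fin M) → Matrix (Fin n) (Fin (p j)) ℝ =>
    (A, Q, fun j => 1 - K j * H j, fun j => K j * R j * (K j)ᵀ)

/-- Coefficients of the affine dynamics which dominate the information matrix: one for each
linearization point. -/
def infoCoeffs (A Q : Matrix (Fin n) (Fin n) ℝ) (H : (j : Fin M) → Matrix (Fin (p j)) (Fin n) ℝ)
    (R : (j : Fin M) → Matrix (Fin (p j)) (Fin (p j)) ℝ) : Set (Coeff n M) :=
  range fun Z : Matrix (Fin n) (Fin n) ℝ =>
    (-(A + Q * Z)ᵀ, Zᵀ * Q * Z, fun _ => 1, fun j => infoGain (H j) (R j))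

theorem isSymm_of_mem_covCoeffs (hQ : Q.PosSemidef) (hR : ∀ j, (R j).PosDef) {θ : Coeff n M}
    (h : θ ∈ covCoeffs A Q H R) : θ.IsSymm := by
  obtain ⟨K, rfl⟩ := h
  exact ⟨hQ.transpose_eq, fun j => ((hR j).posSemidef.conj (K j)).transpose_eq⟩

theorem isSymm_of_mem_infoCoeffs (hQ : Q.PosSemidef) (hR : ∀ j, (R j).PosDef) {θ : Coeff n M}
    (h : θ ∈ infoCoeffs A Q H R) : θ.IsSymm := by
  obtain ⟨Z, rfl⟩ := h
  exact ⟨by simp [hQ.transpose_eq, Matrix.mul_assoc],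
    fun j => (infoGain_posSemidef (hR j)).transpose_eq⟩

theorem IsCovPath.isJumpPath (h : IsCovPath T A Q H R N P) (hT : 0 ≤ T) (hQ : Q.PosSemidef)
    (hR : ∀ j, (R j).PosDef) (hN : ∀ j, MonotoneOn (N j) (Icc 0 T))
    (hrc : ∀ j, ∀ t ∈ Ico 0 T, ContinuousWithinAt (N j) (Ici t) t)
    (hcells : ∃ m : ℕ, ∀ k < 2 ^ m, total N (gridPt T m (k + 1)) ≤ total N (gridPt T m k) + 1)
    (h0 : (P 0).PosDef) : IsJumpPath T N (covCoeffs A Q H R) P := by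
  have hpd := h.posDef hT hQ hR hN hrc hcells h0
  refine ⟨hN, hcells, fun s hs => (hpd s hs).posSemidef, ?_, ?_⟩
  · rintro r s hr hrs hs hc _ ⟨K, rfl⟩
    exact (h.isFlow hT hN hr hs hc).isSubflow hQ (hpd r ⟨hr, hrs.trans hs⟩)
  · intro r s hr hrs hs h1
    obtain ⟨j, τ, X, hrτ, hτs, hNj, hX, f1, f2, f3⟩ := h.exists_jump hT hN hrc hr hrs hs h1
    refine ⟨j, τ, X, hrτ, hτs, hNj, hX, ?_⟩
    have hXr : (X r).PosDef := hX ▸ hpd r ⟨hr, hrs.trans hs⟩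
    rintro _ ⟨K, rfl⟩
    refine ⟨f1.isSubflow hQ hXr, ?_,
      f3.isSubflow hQ (hpd τ ⟨hr.trans hrτ.le, hτs.trans hs⟩)⟩
    rw [f2]
    exact sub_covGain_le (hR j) (f1.posDef hQ hXr τ ⟨hrτ.le, le_rfl⟩).posSemidef (K j)

theorem IsCovPath.isJumpPath_inv (h : IsCovPath T A Q H R N P) (hT : 0 ≤ T) (hQ : Q.PosSemidef)
    (hR : ∀ j, (R j).PosDef) (hN : ∀ j, MonotoneOn (N j) (Icc 0 T))
    (hrc : ∀ j, ∀ t ∈ Ico 0 T, ContinuousWithinAt (N j) (Ici t) t)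
    (hcells : ∃ m : ℕ, ∀ k < 2 ^ m, total N (gridPt T m (k + 1)) ≤ total N (gridPt T m k) + 1)
    (h0 : (P 0).PosDef) : IsJumpPath T N (infoCoeffs A Q H R) (fun t => (P t)⁻¹) := by
  have hpd := h.posDef hT hQ hR hN hrc hcells h0
  refine ⟨hN, hcells, fun s hs => (hpd s hs).inv.posSemidef, ?_, ?_⟩
  · rintro r s hr hrs hs hc _ ⟨Z, rfl⟩
    exact (h.isFlow hT hN hr hs hc).isSubflow_inv hQ (hpd r ⟨hr, hrs.trans hs⟩) Z
  · intro r s hr hrs hs h1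
    obtain ⟨j, τ, X, hrτ, hτs, hNj, hX, f1, f2, f3⟩ := h.exists_jump hT hN hrc hr hrs hs h1
    refine ⟨j, τ, fun u => (X u)⁻¹, hrτ, hτs, hNj, by simp only [hX], ?_⟩
    have hXr : (X r).PosDef := hX ▸ hpd r ⟨hr, hrs.trans hs⟩
    rintro _ ⟨Z, rfl⟩
    refine ⟨f1.isSubflow_inv hQ hXr Z, ?_,
      f3.isSubflow_inv hQ (hpd τ ⟨hr.trans hrτ.le, hτs.trans hs⟩) Z⟩
    simp only [f2]
    rw [inv_sub_covGain (hR j) (f1.posDef hQ hXr τ ⟨hrτ.le, le_rfl⟩)]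
    simp

end CovPath

end CDKF

namespace CDKF

/-! ### Moments of Poisson increments -/

section Poisson

open scoped NNReal

theorem hasSum_poisson_id (r : ℝ≥0) :
    HasSum (fun n : ℕ => Real.exp (-r) * (r : ℝ) ^ n / n.factorial * (n : ℝ)) r := by
  rw [← hasSum_nat_add_iff' 1]
  have h := (hasSum_one_poissonMeasure r).mul_left (r : ℝ)
  simp only [mul_one] at h
  simp only [Finset.range_one, Finset.sum_singleton, Nat.cast_zero, mul_zero, sub_zero]
  refine h.congr_fun fun n => ?_
  rw [Nat.factorial_succ]
  push_cast
  field_simp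
  ring

theorem hasSum_poisson_sq (r : ℝ≥0) :
    HasSum (fun n : ℕ => Real.exp (-r) * (r : ℝ) ^ n / n.factorial * ((n : ℝ) * (n - 1)))
      ((r : ℝ) ^ 2) := by
  rw [← hasSum_nat_add_iff' 1]
  have h := (hasSum_poisson_id r).mul_left (r : ℝ)
  simp only [Finset.range_one, Finset.sum_singleton, Nat.cast_zero, mul_zero, zero_mul, sub_zero]
  rw [sq]
  refine h.congr_fun fun n => ?_
  rw [Nat.factorial_succ]
  push_cast
  field_simp
  ring

end Poisson

section Increments

variable {Ω : Type*} {mΩ : MeasurableSpace Ω} {μ : Measure Ω}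

/-- Tower property through m₂: there f is pulled out and ξ, being independent of m₂, averages to a
constant. Independence from all of m₂, not merely from 𝒢, is what permits f to be non-𝒢-measurable.
-/
theorem condExp_smul_of_indep {E : Type*} [NormedAddCommGroup E] [NormedSpace ℝ E]
    [CompleteSpace E] [MeasurableSpace E] [BorelSpace E] [IsFiniteMeasure μ]
    {m₁ m₂ 𝒢 : MeasurableSpace Ω} (h₁ : m₁ ≤ mΩ) (h₂ : m₂ ≤ mΩ) (h𝒢 : 𝒢 ≤ m₂)
    (hind : Indep m₁ m₂ μ) {ξ : Ω → ℝ} (hξm : StronglyMeasurable[m₁] ξ) (hξ : Integrable ξ μ)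
    {f : Ω → E} (hfm : StronglyMeasurable[m₂] f) (hf : Integrable f μ) :
    Integrable (ξ • f) μ ∧ μ[ξ • f | 𝒢] =ᵐ[μ] (∫ ω, ξ ω ∂μ) • μ[f | 𝒢] := by
  have hif : IndepFun ξ f μ := by
    rw [IndepFun_iff_Indep]
    exact indep_of_indep_of_le_left (indep_of_indep_of_le_right hind hfm.measurable.comap_le)
      hξm.measurable.comap_le
  have hint : Integrable (ξ • f) μ := hif.integrable_smul hξ hf
  refine ⟨hint, ?_⟩
  have h1 : μ[ξ • f | m₂] =ᵐ[μ] (∫ ω, ξ ω ∂μ) • f := by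
    filter_upwards [condExp_smul_of_aestronglyMeasurable_right hξ hint
      hfm.aestronglyMeasurable, condExp_indep_eq h₁ h₂ hξm hind] with ω a1 a2
    rw [a1, Pi.smul_apply', a2, Pi.smul_apply]
  calc μ[ξ • f | 𝒢] =ᵐ[μ] μ[μ[ξ • f | m₂] | 𝒢] := (condExp_condExp_of_le h𝒢 h₂).symm
    _ =ᵐ[μ] μ[(∫ ω, ξ ω ∂μ) • f | 𝒢] := condExp_congr_ae h1
    _ =ᵐ[μ] _ := condExp_smul _ _ _

variable {ℱ : Filtration ℝ mΩ} {M : ℕ} {T : ℝ} {lam : Fin M → ℝ → ℝ} {N : Fin M → ℝ → Ω → ℕ}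

theorem IsSchedule.intervalIntegrable (hlam : IsSchedule T lam) {s t : ℝ} (hs : 0 ≤ s)
    (hst : s ≤ t) (ht : t ≤ T) (j : Fin M) : IntervalIntegrable (lam j) volume s t := by
  obtain ⟨C, hC⟩ := hlam.bounded
  rw [intervalIntegrable_iff_integrableOn_Icc_of_le hst]
  have hsub : Icc s t ⊆ Icc 0 T := Icc_subset_Icc hs ht
  refine IntegrableOn.mono_set (t := Icc 0 T) ?_ hsub
  refine Integrable.of_bound (hlam.aemeasurable j).aestronglyMeasurable C ?_
  filter_upwards [hlam.nonneg j, hC j] with u h0 h1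
  rwa [Real.norm_of_nonneg h0]

theorem IsSchedule.integral_nonneg (hlam : IsSchedule T lam) {s t : ℝ} (hs : 0 ≤ s)
    (hst : s ≤ t) (ht : t ≤ T) (j : Fin M) : 0 ≤ ∫ r in s..t, lam j r := by
  apply intervalIntegral.integral_nonneg_of_ae_restrict hst
  exact ae_restrict_of_ae_restrict_of_subset (Icc_subset_Icc hs ht) (hlam.nonneg j)

theorem IsSchedule.exists_integral_le (hlam : IsSchedule T lam) :
    ∃ C, 0 ≤ C ∧ ∀ j s t, 0 ≤ s → s ≤ t → t ≤ T → ∫ r in s..t, lam j r ≤ C * (t - s) := by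
  obtain ⟨C, hC⟩ := hlam.bounded
  refine ⟨max C 0, le_max_right _ _, fun j s t hs hst ht => ?_⟩
  have h1 : ∫ r in s..t, lam j r ≤ ∫ _ in s..t, max C 0 := by
    apply intervalIntegral.integral_mono_ae_restrict hst (hlam.intervalIntegrable hs hst ht j)
      intervalIntegrable_const
    filter_upwards [ae_restrict_of_ae_restrict_of_subset (Icc_subset_Icc hs ht) (hC j)] with u hu
    exact hu.trans (le_max_left _ _)
  rw [intervalIntegral.integral_const, smul_eq_mul, mul_comm] at h1
  exact h1

/-- The number of counts in `(s, t]`, as a real number. -/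
def inc (N : Fin M → ℝ → Ω → ℕ) (j : Fin M) (s t : ℝ) (ω : Ω) : ℝ :=
  ((N j t ω - N j s ω : ℕ) : ℝ)

/-- The total number of counts in `(s, t]`, as a real number. -/
def totalInc (N : Fin M → ℝ → Ω → ℕ) (s t : ℝ) (ω : Ω) : ℝ := ∑ j, inc N j s t ω

theorem inc_nonneg (j : Fin M) (s t : ℝ) (ω : Ω) : 0 ≤ inc N j s t ω := Nat.cast_nonneg _

theorem totalInc_nonneg (s t : ℝ) (ω : Ω) : 0 ≤ totalInc N s t ω :=
  Finset.sum_nonneg fun _ _ => inc_nonneg _ _ _ _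

theorem totalInc_mul_sub_one_nonneg (s t : ℝ) (ω : Ω) :
    0 ≤ totalInc N s t ω * (totalInc N s t ω - 1) := by
  have e : totalInc N s t ω = ((∑ j, (N j t ω - N j s ω) : ℕ) : ℝ) := by
    simp [totalInc, inc]
  rw [e]
  rcases Nat.eq_zero_or_pos (∑ j, (N j t ω - N j s ω)) with h | h
  · rw [h]; simp
  · have : (1 : ℝ) ≤ ((∑ j, (N j t ω - N j s ω) : ℕ) : ℝ) := by exact_mod_cast h
    exact mul_nonneg (by linarith) (by linarith)

theorem IsPoissonFamily.measurable (hN : IsPoissonFamily μ ℱ T lam N) (j : Fin M) {t : ℝ}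
    (ht : t ∈ Icc 0 T) : Measurable (N j t) :=
  (hN.adapted j t ht).mono (ℱ.le t) le_rfl

theorem IsPoissonFamily.measurable_nat_sub (hN : IsPoissonFamily μ ℱ T lam N) (j : Fin M)
    {s t : ℝ} (hs : s ∈ Icc 0 T) (ht : t ∈ Icc 0 T) :
    Measurable (fun ω => N j t ω - N j s ω) :=
  (Measurable.of_discrete (f := fun x : ℕ × ℕ => x.1 - x.2)).comp
    ((hN.measurable j ht).prodMk (hN.measurable j hs))

/-- The factorial moment is used rather than the second moment since it is exactly Λ² and hence
O(h²); E[Δ²] is only O(h). -/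
theorem IsPoissonFamily.moments (hlam : IsSchedule T lam) (hN : IsPoissonFamily μ ℱ T lam N)
    (j : Fin M) {s t : ℝ} (hs : 0 ≤ s) (hst : s ≤ t) (ht : t ≤ T) :
    Integrable (inc N j s t) μ ∧ ∫ ω, inc N j s t ω ∂μ = ∫ r in s..t, lam j r ∧
    Integrable (fun ω => inc N j s t ω * (inc N j s t ω - 1)) μ ∧
    ∫ ω, inc N j s t ω * (inc N j s t ω - 1) ∂μ = (∫ r in s..t, lam j r) ^ 2 := by
  have hsI : s ∈ Icc 0 T := ⟨hs, hst.trans ht⟩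
  have htI : t ∈ Icc 0 T := ⟨hs.trans hst, ht⟩
  have hm := hN.measurable_nat_sub j hsI htI
  have hlaw := hN.law j s hsI t htI hst
  have h0 := hlam.integral_nonneg hs hst ht j
  set r := (∫ r in s..t, lam j r).toNNReal with hr
  have hr' : (r : ℝ) = ∫ r in s..t, lam j r := Real.coe_toNNReal _ h0
  have transfer : ∀ g : ℕ → ℝ, (∀ n, 0 ≤ g n) → ∀ a : ℝ,
      HasSum (fun n : ℕ => Real.exp (-r) * (r : ℝ) ^ n / n.factorial * g n) a →
      Integrable (fun ω => g (N j t ω - N j s ω)) μ ∧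
        ∫ ω, g (N j t ω - N j s ω) ∂μ = a := by
    intro g hg a ha
    have hi : Integrable g (poissonMeasure r) := by
      rw [integrable_poissonMeasure_iff]
      refine ha.summable.congr fun n => ?_
      rw [Real.norm_of_nonneg (hg n)]
    have hgm : AEStronglyMeasurable g (μ.map fun ω => N j t ω - N j s ω) :=
      (measurable_from_top).aestronglyMeasurable
    constructor
    · rw [← hlaw] at hi
      exact (integrable_map_measure hgm hm.aemeasurable).1 hi
    · have h1 := integral_map hm.aemeasurable hgm
      rw [hlaw, integral_poissonMeasure' hi] at h1
      rw [← h1]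
      exact ha.tsum_eq
  obtain ⟨a1, a2⟩ := transfer (fun n => (n : ℝ)) (fun n => Nat.cast_nonneg n) _
    (hasSum_poisson_id r)
  obtain ⟨a3, a4⟩ := transfer (fun n => (n : ℝ) * (n - 1)) (fun n => by
    rcases Nat.eq_zero_or_pos n with h | h
    · simp [h]
    · have : (1 : ℝ) ≤ n := by exact_mod_cast h
      exact mul_nonneg (by linarith) (by linarith)) _ (hasSum_poisson_sq r)
  rw [hr'] at a2 a4
  exact ⟨a1, a2, a3, a4⟩

theorem IsPoissonFamily.indepFun_inc (hN : IsPoissonFamily μ ℱ T lam N) {s t : ℝ}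
    (hs : s ∈ Icc 0 T) (ht : t ∈ Icc 0 T) {i j : Fin M} (hij : i ≠ j) :
    IndepFun (inc N i s t) (inc N j s t) μ := by
  have h := hN.indep.indepFun hij
  have hg : Measurable (fun f : Icc (0 : ℝ) T → ℕ => ((f ⟨t, ht⟩ - f ⟨s, hs⟩ : ℕ) : ℝ)) := by
    have h1 : Measurable (fun x : ℕ × ℕ => ((x.1 - x.2 : ℕ) : ℝ)) := .of_discrete
    have h2 : Measurable (fun f : Icc (0 : ℝ) T → ℕ => (f ⟨t, ht⟩, f ⟨s, hs⟩)) :=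
      (measurable_pi_apply _).prodMk (measurable_pi_apply _)
    exact h1.comp h2
  exact h.comp hg hg

/-- The product Δ(Δ - 1) splits into the diagonal terms Δ_i(Δ_i - 1) and the cross terms Δ_i Δ_j. By
independence of the sensors every pair contributes Λ_i Λ_j. -/
theorem IsPoissonFamily.total_moments (hlam : IsSchedule T lam)
    (hN : IsPoissonFamily μ ℱ T lam N) {s t : ℝ} (hs : 0 ≤ s) (hst : s ≤ t) (ht : t ≤ T) :
    Integrable (totalInc N s t) μ ∧
    ∫ ω, totalInc N s t ω ∂μ = ∑ j, ∫ r in s..t, lam j r ∧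
    Integrable (fun ω => totalInc N s t ω * (totalInc N s t ω - 1)) μ ∧
    ∫ ω, totalInc N s t ω * (totalInc N s t ω - 1) ∂μ = (∑ j, ∫ r in s..t, lam j r) ^ 2 := by
  have hsI : s ∈ Icc 0 T := ⟨hs, hst.trans ht⟩
  have htI : t ∈ Icc 0 T := ⟨hs.trans hst, ht⟩
  have hm := fun j => hN.moments hlam j hs hst ht
  have hpair : ∀ i j, Integrable (fun ω => if i = j then inc N i s t ω * (inc N i s t ω - 1)
      else inc N i s t ω * inc N j s t ω) μ ∧
      ∫ ω, (if i = j then inc N i s t ω * (inc N i s t ω - 1)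
        else inc N i s t ω * inc N j s t ω) ∂μ
        = (∫ r in s..t, lam i r) * ∫ r in s..t, lam j r := by
    intro i j
    by_cases hij : i = j
    · subst hij
      simp only [if_true]
      exact ⟨(hm i).2.2.1, by rw [(hm i).2.2.2, sq]⟩
    · simp only [if_neg hij]
      have hi := hN.indepFun_inc hsI htI hij
      refine ⟨hi.integrable_mul (hm i).1 (hm j).1, ?_⟩
      rw [hi.integral_fun_mul_eq_mul_integral (hm i).1.1 (hm j).1.1, (hm i).2.1, (hm j).2.1]
  have e : ∀ ω, totalInc N s t ω * (totalInc N s t ω - 1) =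
      ∑ i, ∑ j, if i = j then inc N i s t ω * (inc N i s t ω - 1)
        else inc N i s t ω * inc N j s t ω := by
    intro ω
    have h1 : ∀ i j : Fin M, (if i = j then inc N i s t ω * (inc N i s t ω - 1)
        else inc N i s t ω * inc N j s t ω) =
        inc N i s t ω * inc N j s t ω - if i = j then inc N i s t ω else 0 := by
      intro i j
      split_ifs with hij
      · subst hij; ring
      · ring
    simp only [h1, Finset.sum_sub_distrib, Finset.sum_ite_eq, Finset.mem_univ, if_true]
    rw [← Finset.sum_mul_sum, totalInc]
    ring
  refine ⟨integrable_finsetSum _ fun j _ => (hm j).1, ?_, ?_, ?_⟩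
  · simp only [totalInc]
    rw [integral_finsetSum _ fun j _ => (hm j).1]
    exact Finset.sum_congr rfl fun j _ => (hm j).2.1
  · simp only [e]
    exact integrable_finsetSum _ fun i _ => integrable_finsetSum _ fun j _ => (hpair i j).1
  · simp only [e]
    rw [integral_finsetSum _ fun i _ => integrable_finsetSum _ fun j _ => (hpair i j).1, sq,
      Finset.sum_mul_sum]
    refine Finset.sum_congr rfl fun i _ => ?_
    rw [integral_finsetSum _ fun j _ => (hpair i j).1]
    exact Finset.sum_congr rfl fun j _ => (hpair i j).2

theorem IsPoissonFamily.ae_mono (hN : IsPoissonFamily μ ℱ T lam N) :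
    ∀ᵐ ω ∂μ, ∀ j, MonotoneOn (fun t => N j t ω) (Icc 0 T) :=
  ae_all_iff.2 fun j => hN.monotone j

theorem inc_eq_sub {s t : ℝ} {ω : Ω} (h : ∀ j, MonotoneOn (fun t => N j t ω) (Icc 0 T))
    (hs : 0 ≤ s) (hst : s ≤ t) (ht : t ≤ T) (j : Fin M) :
    inc N j s t ω = (N j t ω : ℝ) - N j s ω :=
  Nat.cast_sub (h j ⟨hs, hst.trans ht⟩ ⟨hs.trans hst, ht⟩ hst)

theorem totalInc_eq_sub {s t : ℝ} {ω : Ω} (h : ∀ j, MonotoneOn (fun t => N j t ω) (Icc 0 T))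
    (hs : 0 ≤ s) (hst : s ≤ t) (ht : t ≤ T) :
    totalInc N s t ω = (total (fun j t => N j t ω) t : ℝ) - total (fun j t => N j t ω) s := by
  simp only [totalInc, inc_eq_sub h hs hst ht, total, Finset.sum_sub_distrib]
  push_cast
  rfl

/-- Almost surely, the jumps of the Poisson processes are separated by some dyadic grid. -/
theorem IsPoissonFamily.ae_cells [IsProbabilityMeasure μ] (hT : 0 ≤ T) (hlam : IsSchedule T lam)
    (hN : IsPoissonFamily μ ℱ T lam N) :
    ∀ᵐ ω ∂μ, ∃ m : ℕ, ∀ k < 2 ^ m, total (fun j t => N j t ω) (gridPt T m (k + 1)) ≤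
      total (fun j t => N j t ω) (gridPt T m k) + 1 := by
  obtain ⟨C, hC0, hC⟩ := hlam.exists_integral_le
  set D := ((M : ℝ) * C * T) ^ 2 with hD
  -- Markov's inequality for the factorial moment: Δ ≥ 2 forces Δ(Δ - 1) ≥ 2. There are 2^m cells,
  -- each bad with probability O(4^(-m)), so a level is bad with probability O(2^(-m)).
  have hcell : ∀ m k : ℕ, k < 2 ^ m →
      μ.real {ω | 2 ≤ totalInc N (gridPt T m k) (gridPt T m (k + 1)) ω *
        (totalInc N (gridPt T m k) (gridPt T m (k + 1)) ω - 1)} ≤ D / (2 ^ m) ^ 2 := by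
    intro m k hk
    have h1 := gridPt_mem hT (m := m) hk.le
    have h2 := gridPt_mem hT (m := m) (Nat.succ_le_of_lt hk)
    have h12 := gridPt_mono hT m (Nat.le_succ k)
    obtain ⟨-, -, hi, he⟩ := hN.total_moments hlam h1.1 h12 h2.2
    have := mul_meas_ge_le_integral_of_nonneg (Eventually.of_forall fun ω =>
      totalInc_mul_sub_one_nonneg (N := N) (gridPt T m k) (gridPt T m (k + 1)) ω) hi 2
    rw [Nat.succ_eq_add_one] at he
    rw [he] at this
    have hsum : ∑ j, ∫ r in (gridPt T m k)..(gridPt T m (k + 1)), lam j r ≤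
        M * C * T / 2 ^ m := by
      calc _ ≤ ∑ _j : Fin M, C * (T / 2 ^ m) := Finset.sum_le_sum fun j _ => by
            have := hC j _ _ h1.1 h12 h2.2
            rwa [Nat.succ_eq_add_one, gridPt_succ_sub] at this
        _ = _ := by simp; ring
    have hsum0 : 0 ≤ ∑ j, ∫ r in (gridPt T m k)..(gridPt T m (k + 1)), lam j r :=
      Finset.sum_nonneg fun j _ => hlam.integral_nonneg h1.1 h12 h2.2 j
    have h3 : (∑ j, ∫ r in (gridPt T m k)..(gridPt T m (k + 1)), lam j r) ^ 2 ≤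
        (M * C * T / 2 ^ m) ^ 2 := by gcongr
    rw [div_pow, ← hD] at h3
    have h4 := measureReal_nonneg (μ := μ) (s := {ω | 2 ≤ totalInc N (gridPt T m k)
      (gridPt T m (k + 1)) ω * (totalInc N (gridPt T m k) (gridPt T m (k + 1)) ω - 1)})
    linarith
  set bad : ℕ → Set Ω := fun m => ⋃ k ∈ Finset.range (2 ^ m),
    {ω | 2 ≤ totalInc N (gridPt T m k) (gridPt T m (k + 1)) ω *
        (totalInc N (gridPt T m k) (gridPt T m (k + 1)) ω - 1)} with hbad
  have hbadm : ∀ m, μ.real (bad m) ≤ D * (1 / 2) ^ m := by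
    intro m
    refine (measureReal_biUnion_finset_le _ _).trans ?_
    refine (Finset.sum_le_sum fun k hk => hcell m k (Finset.mem_range.1 hk)).trans (le_of_eq ?_)
    simp only [Finset.sum_const, Finset.card_range, nsmul_eq_mul]
    push_cast
    rw [one_div, inv_pow]
    field_simp
  have hnull : μ (⋂ m, bad m) = 0 := by
    rw [← measureReal_eq_zero_iff]
    refine le_antisymm ?_ measureReal_nonneg
    have hlim : Tendsto (fun m : ℕ => D * (1 / 2 : ℝ) ^ m) atTop (𝓝 0) := by
      have := (tendsto_pow_atTop_nhds_zero_of_lt_one (r := (1 / 2 : ℝ)) (by norm_num)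
        (by norm_num)).const_mul D
      simpa using this
    exact ge_of_tendsto' hlim fun m =>
      (measureReal_mono (iInter_subset _ m) (measure_ne_top _ _)).trans (hbadm m)
  filter_upwards [measure_eq_zero_iff_ae_notMem.1 hnull, hN.ae_mono] with ω hω hmono
  rw [mem_iInter, not_forall] at hω
  obtain ⟨m, hm⟩ := hω
  refine ⟨m, fun k hk => ?_⟩
  by_contra hc
  apply hm
  refine mem_biUnion (Finset.mem_range.2 hk) ?_
  have h1 := gridPt_mem hT (m := m) hk.le
  have h2 := gridPt_mem hT (m := m) (Nat.succ_le_of_lt hk)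
  have h12 := gridPt_mono hT m (Nat.le_succ k)
  have e := totalInc_eq_sub hmono h1.1 h12 h2.2
  have h3 : (total (fun j t => N j t ω) (gridPt T m k) : ℝ) + 2 ≤
      total (fun j t => N j t ω) (gridPt T m (k + 1)) := by
    have : total (fun j t => N j t ω) (gridPt T m k) + 2 ≤
      total (fun j t => N j t ω) (gridPt T m (k + 1)) := by omega
    exact_mod_cast this
  have h4 : 2 ≤ totalInc N (gridPt T m k) (gridPt T m (k + 1)) ω := by
    rw [Nat.succ_eq_add_one] at e
    rw [e]; linarith
  show (2 : ℝ) ≤ _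
  nlinarith

end Increments

end CDKF

namespace CDKF

/-! ### Conditional means of jump paths -/

section ConditionalMeans

variable {n M : ℕ}

theorem isClosed_posSemidef : IsClosed {X : Matrix (Fin n) (Fin n) ℝ | X.PosSemidef} := by
  have : {X : Matrix (Fin n) (Fin n) ℝ | X.PosSemidef} =
      {X | Xᵀ = X} ∩ ⋂ v : Fin n → ℝ, {X | 0 ≤ v ⬝ᵥ X *ᵥ v} := by
    ext X
    simp [posSemidef_iff_transpose]
  rw [this]
  refine (isClosed_eq (by fun_prop) (by fun_prop)).inter (isClosed_iInter fun v => ?_)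
  exact isClosed_le (by fun_prop) (by fun_prop)

instance instOrderClosedTopologyMatrix : OrderClosedTopology (Matrix (Fin n) (Fin n) ℝ) where
  isClosed_le' := by
    simp only [Matrix.le_iff]
    exact isClosed_posSemidef.preimage (by fun_prop :
      Continuous fun x : Matrix (Fin n) (Fin n) ℝ × Matrix (Fin n) (Fin n) ℝ => x.2 - x.1)

theorem borelSpace_matrix : BorelSpace (Matrix (Fin n) (Fin n) ℝ) :=
  inferInstanceAs (BorelSpace (Fin n → Fin n → ℝ))

theorem secondCountableTopology_matrix : SecondCountableTopology (Matrix (Fin n) (Fin n) ℝ) :=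
  inferInstanceAs (SecondCountableTopology (Fin n → Fin n → ℝ))

/-- The norm topology, in the form in which it is found for general normed spaces. -/
noncomputable local instance instTopologicalSpaceFrobenius : TopologicalSpace (Matrix (Fin n) (Fin n) ℝ) :=
  @UniformSpace.toTopologicalSpace _ PseudoMetricSpace.toUniformSpace

local instance instBorelSpaceFrobenius : BorelSpace (Matrix (Fin n) (Fin n) ℝ) :=
  borelSpace_matrix

local instance instSecondCountableTopologyFrobenius :
    SecondCountableTopology (Matrix (Fin n) (Fin n) ℝ) :=
  secondCountableTopology_matrix

local instance instOrderClosedTopologyFrobenius :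
    OrderClosedTopology (Matrix (Fin n) (Fin n) ℝ) :=
  instOrderClosedTopologyMatrix

/-- Congruence `X ↦ G X Gᵀ` as a continuous linear map. -/
noncomputable def conjCLM (G : Matrix (Fin n) (Fin n) ℝ) :
    Matrix (Fin n) (Fin n) ℝ →L[ℝ] Matrix (Fin n) (Fin n) ℝ :=
  LinearMap.toContinuousLinearMap
    { toFun := fun X => G * X * Gᵀ
      map_add' := fun X Y => by rw [mul_add, add_mul]
      map_smul' := fun c X => by simp }

/-- The map `X ↦ G X Gᵀ - X` as a continuous linear map. -/
noncomputable def conjSubCLM (G : Matrix (Fin n) (Fin n) ℝ) :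
    Matrix (Fin n) (Fin n) ℝ →L[ℝ] Matrix (Fin n) (Fin n) ℝ :=
  conjCLM G - ContinuousLinearMap.id ℝ _

/-- The trace as a continuous linear map. -/
noncomputable def traceL (n : ℕ) : Matrix (Fin n) (Fin n) ℝ →L[ℝ] ℝ :=
  LinearMap.toContinuousLinearMap (Matrix.traceLinearMap (Fin n) ℝ ℝ)

theorem traceL_apply (X : Matrix (Fin n) (Fin n) ℝ) : traceL n X = X.trace := rfl

theorem conjSubCLM_apply (G X : Matrix (Fin n) (Fin n) ℝ) :
    conjSubCLM G X = G * X * Gᵀ - X := rfl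

theorem conjCLM_apply (G X : Matrix (Fin n) (Fin n) ℝ) : conjCLM G X = G * X * Gᵀ := rfl

section IncrementSigma

variable {Ω : Type*}

/-- The σ-algebra generated by the counts in `(s, t]`. -/
abbrev incSigma (N : Fin M → ℝ → Ω → ℕ) (s t : ℝ) : MeasurableSpace Ω :=
  MeasurableSpace.comap (fun ω j => N j t ω - N j s ω) inferInstance

theorem stronglyMeasurable_inc (N : Fin M → ℝ → Ω → ℕ) (s t : ℝ) (j : Fin M) :
    StronglyMeasurable[incSigma N s t] (inc N j s t) := by
  have h1 : Measurable (fun x : Fin M → ℕ => (x j : ℝ)) := by fun_prop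
  have h2 : Measurable[incSigma N s t] (fun ω j => N j t ω - N j s ω) := comap_measurable _
  exact (h1.comp h2).stronglyMeasurable

theorem stronglyMeasurable_totalInc (N : Fin M → ℝ → Ω → ℕ) (s t : ℝ) :
    StronglyMeasurable[incSigma N s t] (totalInc N s t) := by
  have h1 : Measurable (fun x : Fin M → ℕ => ∑ j, (x j : ℝ)) := by fun_prop
  have h2 : Measurable[incSigma N s t] (fun ω j => N j t ω - N j s ω) := comap_measurable _
  exact (h1.comp h2).stronglyMeasurable

theorem IsPoissonFamily.incSigma_le {mΩ : MeasurableSpace Ω} {μ : Measure Ω}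
    {ℱ : Filtration ℝ mΩ} {T : ℝ} {lam : Fin M → ℝ → ℝ} {N : Fin M → ℝ → Ω → ℕ}
    (hN : IsPoissonFamily μ ℱ T lam N) {s t : ℝ} (hs : s ∈ Icc 0 T) (ht : t ∈ Icc 0 T) :
    incSigma N s t ≤ mΩ :=
  (measurable_pi_iff.2 fun j => hN.measurable_nat_sub j hs ht).comap_le

end IncrementSigma

variable {Ω : Type*} {𝒢 mΩ : MeasurableSpace Ω} {μ : Measure Ω} {B : Set Ω}

/-- X need only be integrable on B. The identity is asserted on B alone because the indicator also
cuts off the constant d. -/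
theorem condExp_indicator_affine [IsFiniteMeasure μ] {E F : Type*} [NormedAddCommGroup E]
    [NormedSpace ℝ E] [CompleteSpace E] [NormedAddCommGroup F] [NormedSpace ℝ F] [CompleteSpace F]
    (h𝒢 : 𝒢 ≤ mΩ) (hB : MeasurableSet[𝒢] B) {X : Ω → E} (hX : Integrable (B.indicator X) μ)
    (L : E →L[ℝ] F) (d : F) :
    Integrable (B.indicator fun ω => L (X ω) + d) μ ∧ ∀ᵐ ω ∂μ, ω ∈ B →
      μ[B.indicator fun ω => L (X ω) + d | 𝒢] ω = L (μ[B.indicator X | 𝒢] ω) + d := by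
  have e : (B.indicator fun ω => L (X ω) + d) = L ∘ (B.indicator X) + B.indicator fun _ => d := by
    funext ω
    by_cases h : ω ∈ B <;> simp [h]
  have i1 : Integrable (L ∘ B.indicator X) μ := L.integrable_comp hX
  have i2 : Integrable (B.indicator fun _ => d) μ := (integrable_const d).indicator (h𝒢 _ hB)
  rw [e]
  refine ⟨i1.add i2, ?_⟩
  have e2 : μ[B.indicator fun _ => d | 𝒢] = B.indicator fun _ => d :=
    condExp_of_stronglyMeasurable h𝒢 (stronglyMeasurable_const.indicator hB) i2
  filter_upwards [condExp_add i1 i2 𝒢, L.comp_condExp_comm hX (m := 𝒢)] with ω h1 h2 hω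
  rw [h1, Pi.add_apply, ← h2, e2]
  simp [hω]

variable [IsProbabilityMeasure μ] {ℱ : Filtration ℝ mΩ} {T : ℝ} {lam : Fin M → ℝ → ℝ}
  {N : Fin M → ℝ → Ω → ℕ} {𝒯 : Set (Coeff n M)} {X : ℝ → Ω → Matrix (Fin n) (Fin n) ℝ} {K : ℝ}

/-- On B the pathwise trace bound is a constant plus a multiple of the number of jumps. That number
is independent of 𝒢, so its conditional mean is deterministic and the bound is uniform in t and ω.
-/
theorem exists_trace_condExp_le (hT : 0 ≤ T) (hlam : IsSchedule T lam)
    (hN : IsPoissonFamily μ ℱ T lam N) {θ₀ : Coeff n M} (hθ₀ : θ₀ ∈ 𝒯)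
    (hG₀ : ∀ j, θ₀.2.2.1 j = 1) (h𝒢 : 𝒢 ≤ ℱ 0) (hB : MeasurableSet[𝒢] B)
    (hXm : ∀ t ∈ Icc 0 T, Measurable[ℱ t] (X t))
    (hX : ∀ᵐ ω ∂μ, IsJumpPath T (fun j t => N j t ω) 𝒯 fun t => X t ω)
    (hK : ∀ ω ∈ B, (X 0 ω).trace ≤ K) :
    ∃ C, 0 ≤ C ∧ ∀ t ∈ Icc 0 T, Integrable (B.indicator (X t)) μ ∧
      ∀ᵐ ω ∂μ, (μ[B.indicator (X t) | 𝒢] ω).PosSemidef ∧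
        (μ[B.indicator (X t) | 𝒢] ω).trace ≤ C := by
  obtain ⟨C0, hC0, htr⟩ := IsJumpPath.trace_le hT hθ₀ hG₀
  obtain ⟨C1, hC1, hint⟩ := hlam.exists_integral_le
  have h𝒢' : 𝒢 ≤ mΩ := h𝒢.trans (ℱ.le 0)
  have hbase : ∀ t ∈ Icc 0 T, Integrable (B.indicator (X t)) μ ∧
      (0 : Ω → Matrix (Fin n) (Fin n) ℝ) ≤ᵐ[μ] B.indicator (X t) ∧
      (traceL n ∘ B.indicator (X t)) ≤ᵐ[μ] fun ω => C0 * (|K| + 1 + totalInc N 0 t ω) := by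
    intro t ht
    have hb : ∀ᵐ ω ∂μ, (B.indicator (X t) ω).PosSemidef ∧
        (B.indicator (X t) ω).trace ≤ C0 * (|K| + 1 + totalInc N 0 t ω) := by
      filter_upwards [hX, hN.ae_mono] with ω hω hmono
      by_cases h : ω ∈ B
      · rw [indicator_of_mem h]
        refine ⟨hω.posSemidef t ht, ?_⟩
        have h1 := htr _ _ hω 0 t le_rfl ht.1 ht.2
        rw [totalInc_eq_sub hmono le_rfl ht.1 ht.2]
        have h2 : C0 * ((X 0 ω).trace + 1 + ((total (fun j t => N j t ω) t : ℝ) -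
            total (fun j t => N j t ω) 0)) ≤ C0 * (|K| + 1 +
            ((total (fun j t => N j t ω) t : ℝ) - total (fun j t => N j t ω) 0)) := by
          gcongr
          exact (hK ω h).trans (le_abs_self K)
        linarith
      · rw [indicator_of_notMem h]
        refine ⟨Matrix.PosSemidef.zero, ?_⟩
        rw [Matrix.trace_zero]
        have := totalInc_nonneg (N := N) 0 t ω
        positivity
    have hm : Measurable (B.indicator (X t)) :=
      ((hXm t ht).mono (ℱ.le t) le_rfl).indicator (h𝒢' _ hB)
    refine ⟨?_, ?_, ?_⟩
    · refine Integrable.mono' (g := fun ω => C0 * (|K| + 1 + totalInc N 0 t ω)) ?_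
        hm.aestronglyMeasurable ?_
      · exact ((integrable_const _).add (hN.total_moments hlam le_rfl ht.1 ht.2).1).const_mul _
      · filter_upwards [hb] with ω hω
        exact (norm_le_trace hω.1).trans hω.2
    · filter_upwards [hb] with ω hω
      exact hω.1.nonneg
    · filter_upwards [hb] with ω hω
      exact hω.2
  refine ⟨C0 * (|K| + 1 + M * (C1 * T)), by positivity, fun t ht => ?_⟩
  obtain ⟨hi, hpos, htrace⟩ := hbase t ht
  refine ⟨hi, ?_⟩
  obtain ⟨hti, hte, -, -⟩ := hN.total_moments hlam le_rfl ht.1 ht.2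
  have h0 : (0 : ℝ) ∈ Icc 0 T := ⟨le_rfl, hT⟩
  have hcond : μ[totalInc N 0 t | 𝒢] =ᵐ[μ] fun _ => ∫ ω, totalInc N 0 t ω ∂μ :=
    condExp_indep_eq (hN.incSigma_le h0 ht) h𝒢' (stronglyMeasurable_totalInc N 0 t)
      (indep_of_indep_of_le_right (hN.indepIncrements 0 h0 t ht ht.1) h𝒢)
  have e : (fun ω => C0 * (|K| + 1 + totalInc N 0 t ω)) =
      (fun _ => C0 * (|K| + 1)) + C0 • totalInc N 0 t := by
    funext ω
    simp only [Pi.add_apply, Pi.smul_apply, smul_eq_mul]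
    ring
  rw [e] at htrace
  have hi2 : Integrable (C0 • totalInc N 0 t) μ := hti.smul C0
  filter_upwards [condExp_nonneg (m := 𝒢) hpos, (traceL n).comp_condExp_comm hi (m := 𝒢),
    condExp_mono (m := 𝒢) ((traceL n).integrable_comp hi)
      ((integrable_const _).add hi2) htrace,
    condExp_add (integrable_const (C0 * (|K| + 1))) hi2 𝒢,
    condExp_smul C0 (totalInc N 0 t) 𝒢, hcond] with ω a1 a2 a3 a4 a5 a6
  refine ⟨Matrix.nonneg_iff_posSemidef.1 a1, ?_⟩
  change μ[traceL n ∘ B.indicator (X t) | 𝒢] ω ≤ _ at a3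
  rw [← a2, a4, Pi.add_apply, a5, condExp_const h𝒢', Pi.smul_apply, a6, hte] at a3
  refine (show _ ≤ _ from a3).trans ?_
  rw [smul_eq_mul, ← mul_add]
  gcongr
  calc ∑ j, ∫ r in (0 : ℝ)..t, lam j r ≤ ∑ _j : Fin M, C1 * T := Finset.sum_le_sum fun j _ => by
        refine (hint j 0 t le_rfl ht.1 ht.2).trans ?_
        rw [sub_zero]
        gcongr
        exact ht.2
    _ = _ := by simp

/-- The pathwise one-step bound is affine in X s with the increments as coefficients. These are
independent of ℱ s, so conditioning replaces counts by their means and the random error by O(h²). -/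
theorem exists_condExp_le_step (hT : 0 ≤ T) (hlam : IsSchedule T lam)
    (hN : IsPoissonFamily μ ℱ T lam N) {θ₀ : Coeff n M} (hθ₀ : θ₀ ∈ 𝒯)
    (hG₀ : ∀ j, θ₀.2.2.1 j = 1) (h𝒢 : 𝒢 ≤ ℱ 0) (hB : MeasurableSet[𝒢] B)
    (hXm : ∀ t ∈ Icc 0 T, Measurable[ℱ t] (X t))
    (hX : ∀ᵐ ω ∂μ, IsJumpPath T (fun j t => N j t ω) 𝒯 fun t => X t ω)
    (hK : ∀ ω ∈ B, (X 0 ω).trace ≤ K) {ρ : ℝ} (hρ : 0 ≤ ρ) :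
    ∃ C, 0 ≤ C ∧ ∀ s t, 0 ≤ s → s ≤ t → t ≤ T → ∀ θ ∈ 𝒯, ‖θ‖ ≤ ρ → θ.IsSymm →
      ∀ᵐ ω ∂μ, ω ∈ B → μ[B.indicator (X t) | 𝒢] ω ≤
        step θ (t - s) (fun j => ∫ r in s..t, lam j r) (μ[B.indicator (X s) | 𝒢] ω)
          + (C * (t - s) ^ 2) • 1 := by
  obtain ⟨C0, hC0, hstep⟩ := IsJumpPath.le_step hT hρ hθ₀ hG₀
  obtain ⟨C1, hC1, hint⟩ := hlam.exists_integral_le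
  obtain ⟨C2, hC2, hmean⟩ := exists_trace_condExp_le hT hlam hN hθ₀ hG₀ h𝒢 hB hXm hX hK
  have h𝒢' : 𝒢 ≤ mΩ := h𝒢.trans (ℱ.le 0)
  refine ⟨(1 + M * C1 + (M * C1) ^ 2) * (C0 * (1 + C2)), by positivity, ?_⟩
  intro s t hs hst ht θ hθ hθρ hsym
  have hsI : s ∈ Icc 0 T := ⟨hs, hst.trans ht⟩
  have htI : t ∈ Icc 0 T := ⟨hs.trans hst, ht⟩
  have hh : 0 ≤ t - s := sub_nonneg.2 hst
  obtain ⟨hXs, hms⟩ := hmean s hsI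
  obtain ⟨hXt, -⟩ := hmean t htI
  obtain ⟨ht1, ht2, ht3, ht4⟩ := hN.total_moments hlam hs hst ht
  have hm₁le := hN.incSigma_le hsI htI
  have hind := hN.indepIncrements s hsI t htI hst
  have hBs : MeasurableSet[ℱ s] B := (h𝒢.trans (ℱ.mono hs)) _ hB
  have hXsm := hXm s hsI
  have haff : ∀ (L : Matrix (Fin n) (Fin n) ℝ →L[ℝ] Matrix (Fin n) (Fin n) ℝ)
      (d : Matrix (Fin n) (Fin n) ℝ),
      StronglyMeasurable[ℱ s] (B.indicator fun ω => L (X s ω) + d) := fun L d =>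
    (((L.continuous.measurable.comp hXsm).add_const d).indicator hBs).stronglyMeasurable
  -- drift, jump and error terms of the one-step bound
  set U : Ω → Matrix (Fin n) (Fin n) ℝ := B.indicator fun ω =>
    conjCLM (1 + (t - s) • θ.1) (X s ω) + (t - s) • θ.2.1 with hU
  set V : Fin M → Ω → Matrix (Fin n) (Fin n) ℝ := fun j => B.indicator fun ω =>
    (conjSubCLM (θ.2.2.1 j)) (X s ω) + θ.2.2.2 j with hV
  set W : Ω → Matrix (Fin n) (Fin n) ℝ := B.indicator fun ω =>
    ((C0 • (traceL n)).smulRight (1 : Matrix (Fin n) (Fin n) ℝ)) (X s ω) + C0 • 1 with hW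
  set ξ : Ω → ℝ := fun ω => (t - s) ^ 2 + (t - s) * totalInc N s t ω +
    totalInc N s t ω * (totalInc N s t ω - 1) with hξ
  obtain ⟨hUi, hUc⟩ := condExp_indicator_affine h𝒢' hB hXs
    (conjCLM (1 + (t - s) • θ.1)) ((t - s) • θ.2.1)
  have hVa := fun j => condExp_indicator_affine h𝒢' hB hXs
    (conjSubCLM (θ.2.2.1 j)) (θ.2.2.2 j)
  obtain ⟨hWi, hWc⟩ := condExp_indicator_affine h𝒢' hB hXs
    ((C0 • (traceL n)).smulRight (1 : Matrix (Fin n) (Fin n) ℝ)) (C0 • 1)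
  rw [← hU] at hUi hUc
  rw [← hW] at hWi hWc
  have htm := stronglyMeasurable_totalInc N s t
  have hξm : StronglyMeasurable[incSigma N s t] ξ :=
    (stronglyMeasurable_const.add (htm.const_mul _)).add
      (htm.mul (htm.sub stronglyMeasurable_const))
  have hξi : Integrable ξ μ := ((integrable_const _).add (ht1.const_mul _)).add ht3
  -- Each of the three summands of ξ has mean of order (t - s)², the total intensity being at most M
  -- C1 (t - s).
  have hξE : ∫ ω, ξ ω ∂μ ≤ (1 + M * C1 + (M * C1) ^ 2) * (t - s) ^ 2 := by
    have hsum : ∑ j, ∫ r in s..t, lam j r ≤ M * C1 * (t - s) :=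
      (Finset.sum_le_sum fun j _ => hint j s t hs hst ht).trans (by simp [mul_assoc])
    have hsum0 : 0 ≤ ∑ j, ∫ r in s..t, lam j r :=
      Finset.sum_nonneg fun j _ => hlam.integral_nonneg hs hst ht j
    have i1 : Integrable (fun ω => (t - s) * totalInc N s t ω) μ := ht1.const_mul _
    have i2 : Integrable (fun ω => (t - s) ^ 2 + (t - s) * totalInc N s t ω) μ :=
      (integrable_const _).add i1
    have e1 := integral_add i2 ht3
    have e2 := integral_add (integrable_const ((t - s) ^ 2)) i1
    rw [integral_const_mul, ht2] at e2
    rw [e2, ht4] at e1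
    simp only [integral_const, probReal_univ, one_smul] at e1
    rw [hξ]
    refine e1.le.trans ?_
    have := pow_le_pow_left₀ hsum0 hsum 2
    nlinarith [mul_le_mul_of_nonneg_left hsum hh]
  have hVs := fun j => condExp_smul_of_indep hm₁le (ℱ.le s) (h𝒢.trans (ℱ.mono hs)) hind
    (stronglyMeasurable_inc N s t j) (hN.moments hlam j hs hst ht).1 (haff (conjSubCLM (θ.2.2.1 j)) (θ.2.2.2 j)) (hVa j).1
  obtain ⟨hξWi, hξWc⟩ := condExp_smul_of_indep hm₁le (ℱ.le s) (h𝒢.trans (ℱ.mono hs)) hind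
    hξm hξi (haff _ _) hWi
  have hVsum : Integrable (∑ j, inc N j s t • V j) μ :=
    integrable_finsetSum' _ fun j _ => (hVs j).1
  have hle : B.indicator (X t) ≤ᵐ[μ] U + ∑ j, inc N j s t • V j + ξ • W := by
    filter_upwards [hX, hN.ae_mono] with ω hω hmono
    by_cases h : ω ∈ B
    · have h1 := hstep _ _ hω s t hs hst ht θ hθ hθρ hsym
      rw [indicator_of_mem h]
      refine h1.trans (le_of_eq ?_)
      simp only [Pi.add_apply, Finset.sum_apply, Pi.smul_apply', hU, hV, hW, indicator_of_mem h,
        hξ, totalInc_eq_sub hmono hs hst ht, inc_eq_sub hmono hs hst ht, step,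
        conjSubCLM_apply, conjCLM_apply,
        ContinuousLinearMap.smulRight_apply, _root_.smul_apply, traceL_apply]
      congr 1
      · congr 1
        refine Finset.sum_congr rfl fun j _ => ?_
        congr 1
        abel
      · rw [← add_smul, smul_smul]
        congr 1
        simp only [smul_eq_mul]
        ring
    · simp [h, hU, hV, hW]
  filter_upwards [condExp_mono (m := 𝒢) hXt ((hUi.add hVsum).add hξWi) hle,
    condExp_add (hUi.add hVsum) hξWi 𝒢, condExp_add hUi hVsum 𝒢,
    condExp_finsetSum (s := Finset.univ) (fun j _ => (hVs j).1) 𝒢,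
    ae_all_iff.2 fun j => (hVs j).2, hξWc, hUc, hWc, ae_all_iff.2 fun j => (hVa j).2, hms]
    with ω a1 a2 a3 a4 a5 a6 a7 a8 a9 a10 hω
  refine a1.trans ?_
  rw [a2, Pi.add_apply, a3, Pi.add_apply, a4, a6, Pi.smul_apply, a7 hω, a8 hω, Finset.sum_apply]
  have hW1 : (∫ ω, ξ ω ∂μ) • (((C0 • (traceL n)).smulRight (1 : Matrix (Fin n) (Fin n) ℝ))
      (μ[B.indicator (X s) | 𝒢] ω) + C0 • 1) ≤
      ((1 + M * C1 + (M * C1) ^ 2) * (C0 * (1 + C2)) * (t - s) ^ 2) •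
        (1 : Matrix (Fin n) (Fin n) ℝ) := by
    simp only [ContinuousLinearMap.smulRight_apply, _root_.smul_apply, traceL_apply]
    rw [← add_smul, smul_smul]
    apply smul_one_le_smul_one
    rw [smul_eq_mul]
    have h1 : 0 ≤ (μ[B.indicator (X s) | 𝒢] ω).trace := a10.1.trace_nonneg
    have h2 : C0 * (μ[B.indicator (X s) | 𝒢] ω).trace + C0 ≤ C0 * (1 + C2) := by
      nlinarith [mul_le_mul_of_nonneg_left a10.2 hC0]
    have h3 : 0 ≤ C0 * (μ[B.indicator (X s) | 𝒢] ω).trace + C0 := by positivity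
    calc _ ≤ ((1 + M * C1 + (M * C1) ^ 2) * (t - s) ^ 2) *
          (C0 * (μ[B.indicator (X s) | 𝒢] ω).trace + C0) := by gcongr
      _ ≤ ((1 + M * C1 + (M * C1) ^ 2) * (t - s) ^ 2) * (C0 * (1 + C2)) := by gcongr
      _ = _ := by ring
  refine add_le_add (le_of_eq ?_) hW1
  rw [step, conjCLM_apply]
  congr 1
  refine Finset.sum_congr rfl fun j _ => ?_
  rw [a5 j, Pi.smul_apply, a9 j hω, (hN.moments hlam j hs hst ht).2.1]
  congr 1
  simp only [conjSubCLM_apply]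
  abel

end ConditionalMeans

end CDKF

namespace CDKF

/-! ### Discrete subsolutions -/

section Subsolution

variable {n M : ℕ} {T : ℝ} {lam : Fin M → ℝ → ℝ} {𝒯 : Set (Coeff n M)}

/-- A bounded positive semidefinite trajectory which satisfies, along the dyadic grids, the
first-order inequalities for the affine dynamics with coefficients in `𝒯` and jump rates `lam`. -/
structure IsDiscreteSubsolution (T : ℝ) (lam : Fin M → ℝ → ℝ) (𝒯 : Set (Coeff n M))
    (y : ℝ → Matrix (Fin n) (Fin n) ℝ) : Prop where
  posSemidef : ∀ m k, k ≤ 2 ^ m → (y (gridPt T m k)).PosSemidef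
  trace_le : ∃ C, 0 ≤ C ∧ ∀ m k, k ≤ 2 ^ m → (y (gridPt T m k)).trace ≤ C
  le_step : ∀ ρ : ℝ, ∃ C, 0 ≤ C ∧ ∀ m k, k < 2 ^ m → ∀ θ ∈ 𝒯, ‖θ‖ ≤ ρ →
    y (gridPt T m (k + 1)) ≤
      step θ (T / 2 ^ m) (fun j => ∫ r in (gridPt T m k)..(gridPt T m (k + 1)), lam j r)
        (y (gridPt T m k)) + (C * (T / 2 ^ m) ^ 2) • 1

theorem isClosed_le_step (Y X c : Matrix (Fin n) (Fin n) ℝ) (h : ℝ) (l : Fin M → ℝ) :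
    IsClosed {θ : Coeff n M | Y ≤ step θ h l X + c} := by
  refine isClosed_le continuous_const ?_
  unfold step
  fun_prop

/-- The inequality is closed in θ, so countably many coefficients suffice. This places the choice of
θ, which will depend on ω, inside a single null set. -/
theorem le_step_of_dense {S : Set (Coeff n M)} {D : Set S} (hD : Dense D)
    (Y X c : Matrix (Fin n) (Fin n) ℝ) (h : ℝ) (l : Fin M → ℝ)
    (H : ∀ θ ∈ D, Y ≤ step θ.1 h l X + c) (θ : Coeff n M) (hθ : θ ∈ S) : Y ≤ step θ h l X + c := by
  have hcl := (isClosed_le_step Y X c h l).preimage (continuous_subtype_val (p := (· ∈ S)))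
  have hsub := hcl.closure_subset_iff.2 fun θ hθ => by
    rw [mem_preimage, mem_ofPred_eq]
    exact H θ hθ
  have := hsub (hD ⟨θ, hθ⟩)
  rwa [mem_preimage, mem_ofPred_eq] at this

/-- Only dyadic times, integer radii and a countable dense set of coefficients enter, so one null
set serves for all of them. -/
theorem ae_isDiscreteSubsolution {Ω : Type*} {𝒢 mΩ : MeasurableSpace Ω} {μ : Measure Ω}
    {B : Set Ω} [IsProbabilityMeasure μ] {ℱ : Filtration ℝ mΩ} {N : Fin M → ℝ → Ω → ℕ}
    {X : ℝ → Ω → Matrix (Fin n) (Fin n) ℝ} {K : ℝ}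
    (hT : 0 ≤ T) (hlam : IsSchedule T lam)
    (hN : IsPoissonFamily μ ℱ T lam N) (hsym : ∀ θ ∈ 𝒯, θ.IsSymm) {θ₀ : Coeff n M} (hθ₀ : θ₀ ∈ 𝒯)
    (hG₀ : ∀ j, θ₀.2.2.1 j = 1) (h𝒢 : 𝒢 ≤ ℱ 0) (hB : MeasurableSet[𝒢] B)
    (hXm : ∀ t ∈ Icc 0 T, Measurable[ℱ t] (X t))
    (hX : ∀ᵐ ω ∂μ, IsJumpPath T (fun j t => N j t ω) 𝒯 fun t => X t ω)
    (hK : ∀ ω ∈ B, (X 0 ω).trace ≤ K) :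
    ∀ᵐ ω ∂μ, ω ∈ B → IsDiscreteSubsolution T lam 𝒯 fun t => μ[B.indicator (X t) | 𝒢] ω := by
  obtain ⟨C, hC, hmean⟩ := exists_trace_condExp_le hT hlam hN hθ₀ hG₀ h𝒢 hB hXm hX hK
  have h1 : ∀ᵐ ω ∂μ, ∀ m k : ℕ, k ≤ 2 ^ m →
      (μ[B.indicator (X (gridPt T m k)) | 𝒢] ω).PosSemidef ∧
        (μ[B.indicator (X (gridPt T m k)) | 𝒢] ω).trace ≤ C := by
    refine ae_all_iff.2 fun m => ae_all_iff.2 fun k => ?_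
    by_cases hk : k ≤ 2 ^ m
    · filter_upwards [(hmean _ (gridPt_mem hT hk)).2] with ω hω _ using hω
    · exact Eventually.of_forall fun ω h => absurd h hk
  have h2 : ∀ᵐ ω ∂μ, ∀ ρ : ℕ, ω ∈ B → ∃ C, 0 ≤ C ∧ ∀ m k, k < 2 ^ m → ∀ θ ∈ 𝒯, ‖θ‖ ≤ ρ →
      μ[B.indicator (X (gridPt T m (k + 1))) | 𝒢] ω ≤
        step θ (T / 2 ^ m) (fun j => ∫ r in (gridPt T m k)..(gridPt T m (k + 1)), lam j r)
          (μ[B.indicator (X (gridPt T m k)) | 𝒢] ω) + (C * (T / 2 ^ m) ^ 2) • 1 := by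
    refine ae_all_iff.2 fun ρ => ?_
    obtain ⟨C, hC, hstep⟩ := exists_condExp_le_step hT hlam hN hθ₀ hG₀ h𝒢 hB hXm hX hK
      (Nat.cast_nonneg ρ)
    have := secondCountableTopology_matrix (n := n)
    set S : Set (Coeff n M) := {θ | θ ∈ 𝒯 ∧ ‖θ‖ ≤ ρ} with hS
    obtain ⟨D, hDc, hDd⟩ := TopologicalSpace.exists_countable_dense S
    have h3 : ∀ᵐ ω ∂μ, ∀ m k : ℕ, ∀ θ ∈ D, k < 2 ^ m → ω ∈ B →
        μ[B.indicator (X (gridPt T m (k + 1))) | 𝒢] ω ≤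
          step θ.1 (T / 2 ^ m) (fun j => ∫ r in (gridPt T m k)..(gridPt T m (k + 1)), lam j r)
            (μ[B.indicator (X (gridPt T m k)) | 𝒢] ω) + (C * (T / 2 ^ m) ^ 2) • 1 := by
      refine ae_all_iff.2 fun m => ae_all_iff.2 fun k => (ae_ball_iff hDc).2 fun θ _ => ?_
      by_cases hk : k < 2 ^ m
      · have a1 := gridPt_mem hT hk.le
        have a2 := gridPt_mem hT (Nat.succ_le_of_lt hk)
        have := hstep _ _ a1.1 (gridPt_mono hT m (Nat.le_succ k)) a2.2 θ.1 θ.2.1 θ.2.2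
          (hsym _ θ.2.1)
        rw [Nat.succ_eq_add_one, gridPt_succ_sub] at this
        filter_upwards [this] with ω hω _ using hω
      · exact Eventually.of_forall fun ω h => absurd h hk
    filter_upwards [h3] with ω hω hωB
    refine ⟨C, hC, fun m k hk θ hθ hθρ => ?_⟩
    exact le_step_of_dense hDd _ _ _ _ _ (fun θ hθD => hω m k θ hθD hk hωB) θ ⟨hθ, hθρ⟩
  filter_upwards [h1, h2] with ω hω1 hω2 hωB
  refine ⟨fun m k hk => (hω1 m k hk).1, ⟨C, hC, fun m k hk => (hω1 m k hk).2⟩, fun ρ => ?_⟩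
  obtain ⟨r, hr⟩ := exists_nat_ge ρ
  obtain ⟨C, hC, h⟩ := hω2 r hωB
  exact ⟨C, hC, fun m k hk θ hθ hθρ => h m k hk θ hθ (hθρ.trans hr)⟩

/-! ### Comparison with solutions -/

/-- The linear part of `step`. -/
noncomputable def stepLin (θ : Coeff n M) (h : ℝ) (l : Fin M → ℝ) (D : Matrix (Fin n) (Fin n) ℝ) :
    Matrix (Fin n) (Fin n) ℝ :=
  (1 + h • θ.1) * D * (1 + h • θ.1)ᵀ + ∑ j, l j • (θ.2.2.1 j * D * (θ.2.2.1 j)ᵀ - D)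

theorem stepLin_sub (θ : Coeff n M) (h : ℝ) (l : Fin M → ℝ) (D E : Matrix (Fin n) (Fin n) ℝ) :
    stepLin θ h l (D - E) = stepLin θ h l D - stepLin θ h l E := by
  have : ∀ j, l j • (θ.2.2.1 j * (D - E) * (θ.2.2.1 j)ᵀ - (D - E)) =
      l j • (θ.2.2.1 j * D * (θ.2.2.1 j)ᵀ - D) - l j • (θ.2.2.1 j * E * (θ.2.2.1 j)ᵀ - E) := by
    intro j
    rw [← smul_sub, mul_sub, sub_mul]
    congr 1
    abel
  simp only [stepLin, this, Finset.sum_sub_distrib]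
  rw [mul_sub, sub_mul]
  abel

theorem stepLin_smul (θ : Coeff n M) (h : ℝ) (l : Fin M → ℝ) (c : ℝ)
    (D : Matrix (Fin n) (Fin n) ℝ) : stepLin θ h l (c • D) = c • stepLin θ h l D := by
  simp only [stepLin, smul_add, Finset.smul_sum, Matrix.mul_smul, Matrix.smul_mul]
  congr 1
  refine Finset.sum_congr rfl fun j _ => ?_
  rw [← smul_sub, smul_comm]

theorem step_sub_step (θ : Coeff n M) (h : ℝ) (l : Fin M → ℝ) (X Y : Matrix (Fin n) (Fin n) ℝ) :
    step θ h l X - step θ h l Y = stepLin θ h l (X - Y) := by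
  have : ∀ j, l j • (θ.2.2.1 j * X * (θ.2.2.1 j)ᵀ + θ.2.2.2 j - X) =
      l j • (θ.2.2.1 j * X * (θ.2.2.1 j)ᵀ - X) + l j • θ.2.2.2 j := by
    intro j
    rw [← smul_add]
    congr 1
    abel
  have h2 : ∀ j, l j • (θ.2.2.1 j * Y * (θ.2.2.1 j)ᵀ + θ.2.2.2 j - Y) =
      l j • (θ.2.2.1 j * Y * (θ.2.2.1 j)ᵀ - Y) + l j • θ.2.2.2 j := by
    intro j
    rw [← smul_add]
    congr 1
    abel
  rw [stepLin_sub]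
  simp only [step, stepLin, this, h2, Finset.sum_add_distrib]
  abel

theorem norm_transpose_le {m n : ℕ} (X : Matrix (Fin m) (Fin n) ℝ) : ‖Xᵀ‖ ≤ ‖X‖ :=
  (Matrix.frobenius_norm_transpose X).le

theorem norm_mul_mul_transpose_le (G D : Matrix (Fin n) (Fin n) ℝ) :
    ‖G * D * Gᵀ‖ ≤ ‖G‖ ^ 2 * ‖D‖ := by
  refine (norm_mul_le _ _).trans ?_
  have h1 := norm_mul_le G D
  have h2 := norm_transpose_le G
  calc ‖G * D‖ * ‖Gᵀ‖ ≤ (‖G‖ * ‖D‖) * ‖G‖ := by gcongr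
    _ = _ := by ring

/-- A first-order step maps positive semidefinite matrices to almost positive semidefinite ones. -/
theorem neg_smul_one_le_stepLin {θ : Coeff n M} {ρ h c : ℝ} {l : Fin M → ℝ} (hθ : ‖θ‖ ≤ ρ)
    (hh : 0 ≤ h) (hl0 : ∀ j, 0 ≤ l j) (hl : ∀ j, l j ≤ c * h)
    {D : Matrix (Fin n) (Fin n) ℝ} (hD : D.PosSemidef) :
    -((((M * c) ^ 2 + M * c * ρ) * D.trace * h ^ 2) • (1 : Matrix (Fin n) (Fin n) ℝ))
      ≤ stepLin θ h l D := by
  set L := ∑ j, l j with hL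
  have hL0 : 0 ≤ L := Finset.sum_nonneg fun j _ => hl0 j
  have hLc : L ≤ M * c * h :=
    (Finset.sum_le_sum fun j _ => hl j).trans (by simp [mul_assoc])
  have hB := (Coeff.norm_le hθ).1
  have hρ := (norm_nonneg _).trans hB
  have hDt := hD.transpose_eq
  have hDn := norm_le_trace hD
  have htr := hD.trace_nonneg
  -- The jumps contribute -L D, which spoils positivity. Moving half of it into each factor, as 1 -
  -- L/2 + hB, completes a congruence up to this remainder of order h².
  set R := (L * h / 2) • (θ.1 * D + D * θ.1ᵀ) - (L ^ 2 / 4) • D with hR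
  have e : stepLin θ h l D = ((1 - L / 2) • 1 + h • θ.1) * D * ((1 - L / 2) • 1 + h • θ.1)ᵀ
      + ∑ j, l j • (θ.2.2.1 j * D * (θ.2.2.1 j)ᵀ) + R := by
    have e1 : ∑ j, l j • (θ.2.2.1 j * D * (θ.2.2.1 j)ᵀ - D) =
        ∑ j, l j • (θ.2.2.1 j * D * (θ.2.2.1 j)ᵀ) - L • D := by
      simp only [smul_sub, Finset.sum_sub_distrib, hL, Finset.sum_smul]
    rw [stepLin, e1, hR]
    simp only [Matrix.transpose_add, Matrix.transpose_smul, Matrix.transpose_one, mul_add, add_mul,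
      Matrix.smul_mul, Matrix.mul_smul, one_mul, mul_one, smul_add, smul_smul]
    module
  have h1 : (0 : Matrix (Fin n) (Fin n) ℝ) ≤
      ((1 - L / 2) • 1 + h • θ.1) * D * ((1 - L / 2) • 1 + h • θ.1)ᵀ := (hD.conj _).nonneg
  have h2 : (0 : Matrix (Fin n) (Fin n) ℝ) ≤ ∑ j, l j • (θ.2.2.1 j * D * (θ.2.2.1 j)ᵀ) :=
    Finset.sum_nonneg fun j _ => ((hD.conj _).smul (hl0 j)).nonneg
  have hRt : Rᵀ = R := by
    rw [hR]
    simp only [Matrix.transpose_sub, Matrix.transpose_smul, Matrix.transpose_add,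
      Matrix.transpose_mul, Matrix.transpose_transpose, hDt]
    rw [add_comm]
  have hRn : ‖R‖ ≤ ((M * c) ^ 2 + M * c * ρ) * D.trace * h ^ 2 := by
    have b1 : ‖θ.1 * D + D * θ.1ᵀ‖ ≤ 2 * (ρ * D.trace) := by
      refine (norm_add_le _ _).trans ?_
      have c1 : ‖θ.1 * D‖ ≤ ρ * D.trace := (norm_mul_le _ _).trans (by gcongr)
      have c2 : ‖D * θ.1ᵀ‖ ≤ D.trace * ρ := (norm_mul_le _ _).trans
        (mul_le_mul hDn ((norm_transpose_le _).trans hB) (norm_nonneg _) htr)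
      linarith
    rw [hR]
    refine (norm_sub_le _ _).trans ?_
    rw [norm_smul, norm_smul, Real.norm_of_nonneg (by positivity : 0 ≤ L * h / 2),
      Real.norm_of_nonneg (by positivity : 0 ≤ L ^ 2 / 4)]
    have hMc : 0 ≤ M * c * h := hL0.trans hLc
    have c1 : L * h / 2 * ‖θ.1 * D + D * θ.1ᵀ‖ ≤ (M * c * h) * h / 2 * (2 * (ρ * D.trace)) := by
      gcongr
    have c2 : L ^ 2 / 4 * ‖D‖ ≤ (M * c * h) ^ 2 / 4 * D.trace := by gcongr
    have c3 : 0 ≤ (M * c * h) ^ 2 * D.trace := by positivity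
    nlinarith
  have h3 := neg_norm_smul_one_le hRt hRn
  rw [e]
  have := add_le_add (add_le_add h1 h2) h3
  simpa using this

/-- Gives the Grönwall rate at which a scalar error e • 1 is amplified by one step. -/
theorem stepLin_one_le {θ : Coeff n M} {ρ h c T : ℝ} {l : Fin M → ℝ} (hθ : ‖θ‖ ≤ ρ)
    (hh : 0 ≤ h) (hhT : h ≤ T) (hl0 : ∀ j, 0 ≤ l j) (hl : ∀ j, l j ≤ c * h) :
    stepLin θ h l 1 ≤ (1 + (2 * ρ + T * ρ ^ 2 + M * c * ρ ^ 2) * h) •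
      (1 : Matrix (Fin n) (Fin n) ℝ) := by
  obtain ⟨hB, -, hG, -⟩ := Coeff.norm_le hθ
  have hρ := (norm_nonneg _).trans hB
  set E := h • (θ.1 + θ.1ᵀ) + h ^ 2 • (θ.1 * θ.1ᵀ) + ∑ j, l j • (θ.2.2.1 j * (θ.2.2.1 j)ᵀ) with hE
  have e : stepLin θ h l 1 = 1 + E - (∑ j, l j) • (1 : Matrix (Fin n) (Fin n) ℝ) := by
    rw [hE, stepLin]
    simp only [mul_one, Matrix.transpose_add, Matrix.transpose_smul, Matrix.transpose_one, mul_add,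
      add_mul, Matrix.smul_mul, Matrix.mul_smul, one_mul, smul_add, smul_smul, smul_sub,
      Finset.sum_sub_distrib, Finset.sum_smul]
    module
  have hEt : Eᵀ = E := by
    rw [hE]
    simp only [Matrix.transpose_add, Matrix.transpose_smul, Matrix.transpose_mul,
      Matrix.transpose_transpose, Matrix.transpose_sum]
    rw [add_comm θ.1ᵀ]
  have hGG : ∀ G : Matrix (Fin n) (Fin n) ℝ, ‖G‖ ≤ ρ → ‖G * Gᵀ‖ ≤ ρ ^ 2 := fun G hG => by
    rw [sq]
    exact (norm_mul_le _ _).trans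
      (mul_le_mul hG ((norm_transpose_le _).trans hG) (norm_nonneg _) hρ)
  have hEn : ‖E‖ ≤ (2 * ρ + T * ρ ^ 2 + M * c * ρ ^ 2) * h := by
    have b1 : ‖h • (θ.1 + θ.1ᵀ)‖ ≤ h * (2 * ρ) := by
      rw [norm_smul, Real.norm_of_nonneg hh]
      have := (norm_add_le θ.1 θ.1ᵀ).trans (add_le_add hB ((norm_transpose_le _).trans hB))
      gcongr
      linarith
    have b2 : ‖h ^ 2 • (θ.1 * θ.1ᵀ)‖ ≤ h * T * ρ ^ 2 := by
      rw [norm_smul, Real.norm_of_nonneg (by positivity)]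
      calc h ^ 2 * ‖θ.1 * θ.1ᵀ‖ ≤ h ^ 2 * ρ ^ 2 := by gcongr; exact hGG _ hB
        _ = h * h * ρ ^ 2 := by ring
        _ ≤ _ := by gcongr
    have b3 : ‖∑ j, l j • (θ.2.2.1 j * (θ.2.2.1 j)ᵀ)‖ ≤ M * (c * h * ρ ^ 2) := by
      refine (norm_sum_le _ _).trans ?_
      calc _ ≤ ∑ _j : Fin M, c * h * ρ ^ 2 := Finset.sum_le_sum fun j _ => by
            rw [norm_smul, Real.norm_of_nonneg (hl0 j)]
            exact mul_le_mul (hl j) (hGG _ (hG j)) (norm_nonneg _) ((hl0 j).trans (hl j))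
        _ = _ := by simp
    have := (norm_add_le (h • (θ.1 + θ.1ᵀ) + h ^ 2 • (θ.1 * θ.1ᵀ)) _).trans
      (add_le_add ((norm_add_le _ _).trans (add_le_add b1 b2)) b3)
    rw [hE]
    linarith
  have h1 := le_norm_smul_one hEt hEn
  have h2 : (0 : Matrix (Fin n) (Fin n) ℝ) ≤ (∑ j, l j) • 1 :=
    (Matrix.PosSemidef.one.smul (Finset.sum_nonneg fun j _ => hl0 j)).nonneg
  rw [e, add_smul, one_smul]
  have := sub_le_sub (add_le_add_right h1 1) h2
  simpa using this

end Subsolution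

end CDKF

namespace CDKF

/-! ### Grönwall comparison along dyadic grids -/

section Comparison

variable {n M : ℕ} {T S : ℝ} {lam : Fin M → ℝ → ℝ} {𝒯 : Set (Coeff n M)}
  {x f₀ y : ℝ → Matrix (Fin n) (Fin n) ℝ} {f : Fin M → ℝ → Matrix (Fin n) (Fin n) ℝ}

theorem intervalIntegral_add_sum {ι : Type*} [Fintype ι] {a b : ℝ} {g₀ : ℝ → ℝ} {g : ι → ℝ → ℝ}
    (h₀ : IntervalIntegrable g₀ volume a b) (h : ∀ j, IntervalIntegrable (g j) volume a b) :
    ∫ r in a..b, g₀ r + ∑ j, g j r = (∫ r in a..b, g₀ r) + ∑ j, ∫ r in a..b, g j r := by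
  have h1 : IntervalIntegrable (fun r => ∑ j, g j r) volume a b := by
    have e : (fun r => ∑ j, g j r) = ∑ j, g j := by
      funext r
      rw [Finset.sum_apply]
    rw [e]
    exact IntervalIntegrable.sum Finset.univ fun j _ => h j
  rw [intervalIntegral.integral_add h₀ h1, intervalIntegral.integral_finsetSum fun j _ => h j]

/-- The rates are merely bounded and measurable, so x need not be differentiable at a given time.
The continuous factors are frozen at s while the integrals of the rates are kept exact; uniform
continuity makes the error o(h) uniformly in s. -/
theorem exists_norm_increment_le (hlam : IsSchedule T lam) (hS : S ≤ T)
    (hf₀ : ContinuousOn f₀ (Icc 0 S)) (hf : ∀ j, ContinuousOn (f j) (Icc 0 S))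
    (hx : ∀ s t, 0 ≤ s → s ≤ t → t ≤ S → ∀ i k,
      x t i k - x s i k = ∫ r in s..t, f₀ r i k + ∑ j, lam j r * f j r i k)
    {ε : ℝ} (hε : 0 < ε) :
    ∃ δ > 0, ∀ s t, 0 ≤ s → s ≤ t → t ≤ S → t - s ≤ δ →
      ‖x t - x s - (t - s) • f₀ s - ∑ j, (∫ r in s..t, lam j r) • f j s‖ ≤ ε * (t - s) := by
  obtain ⟨C, hC0, hC⟩ := hlam.exists_integral_le
  -- The n² entries and the total weight 1 + MC are divided out; the extra 1 covers n = 0.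
  set ε' := ε / ((n * n + 1) * (1 + M * C)) with hε'
  have hε'0 : 0 < ε' := by positivity
  have hent : ∀ {g : ℝ → Matrix (Fin n) (Fin n) ℝ}, ContinuousOn g (Icc 0 S) → ∀ i k,
      ContinuousOn (fun r => g r i k) (Icc 0 S) := fun hg i k =>
    (continuous_apply_apply i k).comp_continuousOn hg
  have hF : ContinuousOn (fun r => ((fun i k => f₀ r i k, fun j i k => f j r i k) :
      (Fin n → Fin n → ℝ) × (Fin M → Fin n → Fin n → ℝ))) (Icc 0 S) :=
    (continuousOn_pi.2 fun i => continuousOn_pi.2 fun k => hent hf₀ i k).prodMk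
      (continuousOn_pi.2 fun j => continuousOn_pi.2 fun i => continuousOn_pi.2 fun k =>
        hent (hf j) i k)
  obtain ⟨δ, hδ, hδF⟩ := Metric.uniformContinuousOn_iff.1
    (isCompact_Icc.uniformContinuousOn_of_continuous hF) ε' hε'0
  refine ⟨δ / 2, by positivity, fun s t hs hst ht hts => ?_⟩
  have hts0 : 0 ≤ t - s := sub_nonneg.2 hst
  have hsub : Icc s t ⊆ Icc 0 S := Icc_subset_Icc hs ht
  have hclose : ∀ r ∈ Icc s t, (∀ i k, |f₀ r i k - f₀ s i k| ≤ ε') ∧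
      ∀ j i k, |f j r i k - f j s i k| ≤ ε' := by
    intro r hr
    have hd := hδF r (hsub hr) s (hsub ⟨le_rfl, hst⟩) (by
      rw [Real.dist_eq, abs_of_nonneg (sub_nonneg.2 hr.1)]
      linarith [hr.2])
    rw [Prod.dist_eq, max_lt_iff, dist_pi_lt_iff hε'0, dist_pi_lt_iff hε'0] at hd
    refine ⟨fun i k => ?_, fun j i k => ?_⟩
    · exact ((dist_pi_lt_iff hε'0).1 (hd.1 i) k).le
    · exact ((dist_pi_lt_iff hε'0).1 ((dist_pi_lt_iff hε'0).1 (hd.2 j) i) k).le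
  have hint : ∀ {g : ℝ → Matrix (Fin n) (Fin n) ℝ}, ContinuousOn g (Icc 0 S) → ∀ i k,
      IntervalIntegrable (fun r => g r i k - g s i k) volume s t := fun hg i k =>
    (((hent hg i k).mono (by rwa [uIcc_of_le hst])).intervalIntegrable).sub
      intervalIntegrable_const
  have hintl : ∀ j i k, IntervalIntegrable (fun r => lam j r * (f j r i k - f j s i k))
      volume s t := fun j i k =>
    (hlam.intervalIntegrable hs hst (ht.trans hS) j).mul_continuousOn
      ((((hent (hf j) i k).mono (by rwa [uIcc_of_le hst]))).sub continuousOn_const)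
  have hentry : ∀ i k, |(x t - x s - (t - s) • f₀ s - ∑ j, (∫ r in s..t, lam j r) • f j s) i k| ≤
      ε' * (1 + M * C) * (t - s) := by
    intro i k
    have hl3 : ∀ j, IntervalIntegrable (fun r => lam j r * f j r i k) volume s t := fun j =>
      (hlam.intervalIntegrable hs hst (ht.trans hS) j).mul_continuousOn
        (((hent (hf j) i k).mono (by rwa [uIcc_of_le hst])))
    have hl2 : ∀ j, IntervalIntegrable (fun r => lam j r * f j s i k) volume s t := fun j =>
      (hlam.intervalIntegrable hs hst (ht.trans hS) j).mul_const _
    have hl0 : IntervalIntegrable (fun r => f₀ r i k) volume s t :=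
      ((hent hf₀ i k).mono (by rwa [uIcc_of_le hst])).intervalIntegrable
    have e : (x t - x s - (t - s) • f₀ s - ∑ j, (∫ r in s..t, lam j r) • f j s) i k =
        (∫ r in s..t, (f₀ r i k - f₀ s i k)) +
          ∑ j, ∫ r in s..t, lam j r * (f j r i k - f j s i k) := by
      have e1 := hx s t hs hst ht i k
      rw [intervalIntegral_add_sum hl0 hl3] at e1
      have e2 : ∀ j, ∫ r in s..t, lam j r * (f j r i k - f j s i k) =
          (∫ r in s..t, lam j r * f j r i k) - (∫ r in s..t, lam j r) * f j s i k := fun j => by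
        rw [← intervalIntegral.integral_mul_const, ← intervalIntegral.integral_sub (hl3 j) (hl2 j)]
        simp only [mul_sub]
      rw [intervalIntegral.integral_sub hl0 intervalIntegrable_const,
        Finset.sum_congr rfl fun j _ => e2 j, Finset.sum_sub_distrib, Matrix.sub_apply,
        Matrix.sub_apply, Matrix.sub_apply, e1, Matrix.sum_apply]
      simp only [Matrix.smul_apply, smul_eq_mul, intervalIntegral.integral_const]
      ring
    rw [e]
    have b1 : |∫ r in s..t, (f₀ r i k - f₀ s i k)| ≤ ε' * (t - s) := by
      have := intervalIntegral.norm_integral_le_of_norm_le_const (a := s) (b := t)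
        (f := fun r => f₀ r i k - f₀ s i k) (C := ε') fun r hr => by
          rw [uIoc_of_le hst] at hr
          exact (hclose r (Ioc_subset_Icc_self hr)).1 i k
      rwa [abs_of_nonneg hts0] at this
    have b2 : ∀ j, |∫ r in s..t, lam j r * (f j r i k - f j s i k)| ≤ C * (t - s) * ε' := by
      intro j
      have h1 := intervalIntegral.norm_integral_le_of_norm_le (μ := volume) hst
        (f := fun r => lam j r * (f j r i k - f j s i k)) (g := fun r => lam j r * ε') (by
          have := (ae_restrict_iff' measurableSet_Icc).1 (hlam.nonneg j)
          filter_upwards [this] with r hr hrst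
          have hrI := Ioc_subset_Icc_self hrst
          have hr0 := hr (Icc_subset_Icc hs (ht.trans hS) hrI)
          rw [norm_mul, Real.norm_of_nonneg hr0]
          exact mul_le_mul_of_nonneg_left ((hclose r hrI).2 j i k) hr0)
        ((hlam.intervalIntegrable hs hst (ht.trans hS) j).mul_const _)
      rw [intervalIntegral.integral_mul_const] at h1
      exact h1.trans (mul_le_mul_of_nonneg_right (hC j s t hs hst (ht.trans hS)) hε'0.le)
    refine (abs_add_le _ _).trans ?_
    have b3 : |∑ j, ∫ r in s..t, lam j r * (f j r i k - f j s i k)| ≤ M * (C * (t - s) * ε') :=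
      (Finset.abs_sum_le_sum_abs _ _).trans
        ((Finset.sum_le_sum fun j _ => b2 j).trans (by simp))
    linarith
  refine (norm_le_sum_abs _).trans ?_
  refine (Finset.sum_le_sum fun i _ => Finset.sum_le_sum fun k _ => hentry i k).trans ?_
  simp only [Finset.sum_const, Finset.card_univ, Fintype.card_fin, nsmul_eq_mul]
  rw [← mul_assoc, ← mul_assoc]
  apply mul_le_mul_of_nonneg_right _ hts0
  have e2 : (n : ℝ) * n * (ε' * (1 + M * C)) = ε * (n * n / (n * n + 1)) := by
    rw [hε']
    have : (1 + M * C) ≠ 0 := by positivity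
    field_simp
  rw [← mul_assoc] at e2 ⊢
  rw [e2]
  have : (n * n / (n * n + 1) : ℝ) ≤ 1 := by
    rw [div_le_one (by positivity)]
    linarith
  nlinarith

theorem le_of_forall_le_add_smul_one {X Y : Matrix (Fin n) (Fin n) ℝ} {c : ℝ}
    (h : ∀ η : ℝ, 0 < η → η ≤ 1 → Y ≤ X + (c * η) • 1) : Y ≤ X := by
  have hlim : Tendsto (fun η : ℝ => X + (c * η) • (1 : Matrix (Fin n) (Fin n) ℝ)) (𝓝[>] 0)
      (𝓝 X) := by
    have : Continuous (fun η : ℝ => X + (c * η) • (1 : Matrix (Fin n) (Fin n) ℝ)) := by fun_prop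
    have h2 := (this.tendsto 0).mono_left (nhdsWithin_le_nhds (s := Ioi 0))
    simpa using h2
  refine ge_of_tendsto hlim ?_
  filter_upwards [Ioc_mem_nhdsGT (zero_lt_one' ℝ)] with η hη using h η hη.1 hη.2

/-- One step of the comparison of a discrete subsolution `Y, Y'` with a solution `X, X'`. -/
theorem le_add_smul_one_of_step {θ : Coeff n M} {X X' Y Y' F₀ : Matrix (Fin n) (Fin n) ℝ}
    {F : Fin M → Matrix (Fin n) (Fin n) ℝ} {ρ h c a e Dx Dt η : ℝ} {Λ : Fin M → ℝ}
    (hθρ : ‖θ‖ ≤ ρ) (hθs : θ.IsSymm) (hh0 : 0 ≤ h) (hhT : h ≤ T) (hΛ0 : ∀ j, 0 ≤ Λ j)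
    (hΛC : ∀ j, Λ j ≤ c * h) (hc : 0 ≤ c) (he0 : 0 ≤ e) (hX : Xᵀ = X) (hX' : X'ᵀ = X')
    (hF₀ : F₀ = θ.1 * X + X * θ.1ᵀ + θ.2.1)
    (hF : ∀ j, F j = θ.2.2.1 j * X * (θ.2.2.1 j)ᵀ + θ.2.2.2 j - X)
    (hXn : ‖X‖ ≤ Dx) (htr : (X + e • 1 - Y).trace ≤ Dt)
    (hY' : Y' ≤ step θ h Λ Y + (a * h ^ 2) • 1)
    (hinc : ‖X' - X - h • F₀ - ∑ j, Λ j • F j‖ ≤ η * h) (hYX : Y ≤ X + e • 1) :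
    Y' ≤ X' + (a * h ^ 2 + ((M * c) ^ 2 + M * c * ρ) * Dt * h ^ 2 +
      e * (1 + (2 * ρ + T * ρ ^ 2 + M * c * ρ ^ 2) * h) + ρ ^ 2 * Dx * h ^ 2 + η * h) • 1 := by
  have hρ : 0 ≤ ρ := (norm_nonneg _).trans hθρ
  have hD : (X + e • 1 - Y).PosSemidef := Matrix.le_iff.1 hYX
  -- Monotonicity of the step up to O(h²), applied to the gap X + e - Y ≥ 0.
  have i2 := neg_smul_one_le_stepLin hθρ hh0 hΛ0 hΛC hD
  have i2' : (((M * c) ^ 2 + M * c * ρ) * (X + e • 1 - Y).trace * h ^ 2) •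
      (1 : Matrix (Fin n) (Fin n) ℝ) ≤ (((M * c) ^ 2 + M * c * ρ) * Dt * h ^ 2) • 1 :=
    smul_one_le_smul_one (by gcongr)
  have e2 : stepLin θ h Λ (X + e • 1 - Y) =
      step θ h Λ X - step θ h Λ Y + e • stepLin θ h Λ 1 := by
    rw [step_sub_step, ← stepLin_smul]
    have : X + e • 1 - Y = (X - Y) - (-e) • 1 := by rw [neg_smul]; abel
    rw [this, stepLin_sub, stepLin_smul, stepLin_smul, neg_smul, sub_neg_eq_add]
  have i3 := smul_le_smul_of_nonneg he0 (stepLin_one_le (T := T) hθρ hh0 hhT hΛ0 hΛC)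
  rw [smul_smul] at i3
  -- Since θ is tangent at X, the affine step from X is the Euler step of the nonlinear equation
  -- plus a second-order term.
  have e5 : step θ h Λ X = X + h • F₀ + ∑ j, Λ j • F j + h ^ 2 • (θ.1 * X * θ.1ᵀ) := by
    rw [step, hF₀]
    simp only [hF, Matrix.transpose_add, Matrix.transpose_smul, Matrix.transpose_one, mul_add,
      add_mul, Matrix.smul_mul, Matrix.mul_smul, one_mul, mul_one]
    module
  have i5 : h ^ 2 • (θ.1 * X * θ.1ᵀ) ≤ (ρ ^ 2 * Dx * h ^ 2) •
      (1 : Matrix (Fin n) (Fin n) ℝ) := by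
    apply le_norm_smul_one
    · simp [Matrix.transpose_mul, hX, Matrix.mul_assoc]
    · rw [norm_smul, Real.norm_of_nonneg (by positivity)]
      have b1 := norm_mul_mul_transpose_le θ.1 X
      have b2 := (Coeff.norm_le hθρ).1
      have b3 : ‖θ.1‖ ^ 2 * ‖X‖ ≤ ρ ^ 2 * Dx := by gcongr
      have b4 := mul_le_mul_of_nonneg_left (b1.trans b3) (sq_nonneg h)
      linarith
  have i4 : -((η * h) • (1 : Matrix (Fin n) (Fin n) ℝ)) ≤ X' - X - h • F₀ - ∑ j, Λ j • F j := by
    refine neg_norm_smul_one_le ?_ hinc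
    have t1 : F₀ᵀ = F₀ := by
      rw [hF₀]
      simp only [Matrix.transpose_add, Matrix.transpose_mul, Matrix.transpose_transpose, hX, hθs.1]
      abel
    have t2 : ∀ j, (F j)ᵀ = F j := fun j => by
      rw [hF]
      simp only [Matrix.transpose_add, Matrix.transpose_sub, Matrix.transpose_mul,
        Matrix.transpose_transpose, hX, hθs.2 j, Matrix.mul_assoc]
    simp only [Matrix.transpose_sub, Matrix.transpose_smul, Matrix.transpose_sum, t1, t2, hX, hX']
  rw [e2, e5] at i2
  have tot := add_le_add (add_le_add (add_le_add hY' i2) (add_le_add i2' i3)) (add_le_add i5 i4)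
  rw [← sub_nonneg] at tot ⊢
  convert tot using 1
  module

/-- The profile k h η exp(κ k h) dominates the recursion e ↦ (1 + κh) e + ηh. Half of ηh pays for
the O(h²) errors, half for freezing the coefficients. -/
theorem error_recursion {k : ℕ} {κ h η C e : ℝ} (hκ : 0 ≤ κ) (hh : 0 ≤ h) (hη : 0 ≤ η)
    (hC : C * h ≤ η / 2) (he : e = k * h * η * Real.exp (κ * (k * h))) :
    C * h ^ 2 + e * (1 + κ * h) + η / 2 * h ≤
      ((k + 1 : ℕ) : ℝ) * h * η * Real.exp (κ * (((k + 1 : ℕ) : ℝ) * h)) := by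
  have he0 : 0 ≤ e := by rw [he]; positivity
  have b1 : C * h * h ≤ η / 2 * h := mul_le_mul_of_nonneg_right hC hh
  have b2 : 1 + κ * h ≤ Real.exp (κ * h) := by
    have := Real.add_one_le_exp (κ * h); linarith
  have b3 : Real.exp (κ * (((k + 1 : ℕ) : ℝ) * h)) =
      Real.exp (κ * (k * h)) * Real.exp (κ * h) := by
    rw [← Real.exp_add]; congr 1; push_cast; ring
  have b4 : e * (1 + κ * h) ≤ e * Real.exp (κ * h) := by gcongr
  have b5 : 1 ≤ Real.exp (κ * (k * h)) * Real.exp (κ * h) := by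
    rw [← Real.exp_add]; exact Real.one_le_exp (by positivity)
  have b6 : η * h * 1 ≤ η * h * (Real.exp (κ * (k * h)) * Real.exp (κ * h)) := by gcongr
  have b8 : e * Real.exp (κ * h) =
      k * h * η * (Real.exp (κ * (k * h)) * Real.exp (κ * h)) := by rw [he]; ring
  rw [b3]
  push_cast
  linarith

/-- A discrete subsolution stays below a solution of the nonlinear equation which the affine
dynamics linearize. -/
theorem IsDiscreteSubsolution.le_of_linearized (hy : IsDiscreteSubsolution T lam 𝒯 y)
    (hT : 0 ≤ T) (hlam : IsSchedule T lam) (hS : S ≤ T)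
    (hxc : ContinuousOn x (Icc 0 S)) (hxs : ∀ s ∈ Icc 0 S, (x s)ᵀ = x s)
    (hf₀ : ContinuousOn f₀ (Icc 0 S)) (hf : ∀ j, ContinuousOn (f j) (Icc 0 S))
    (hx : ∀ s t, 0 ≤ s → s ≤ t → t ≤ S → ∀ i k,
      x t i k - x s i k = ∫ r in s..t, f₀ r i k + ∑ j, lam j r * f j r i k)
    {ρ : ℝ} (hlin : ∀ s ∈ Icc 0 S, ∃ θ ∈ 𝒯, ‖θ‖ ≤ ρ ∧ θ.IsSymm ∧
      f₀ s = θ.1 * x s + x s * θ.1ᵀ + θ.2.1 ∧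
      ∀ j, f j s = θ.2.2.1 j * x s * (θ.2.2.1 j)ᵀ + θ.2.2.2 j - x s)
    (h0 : y 0 = x 0) (m k : ℕ) (hk : k ≤ 2 ^ m) (hkS : gridPt T m k ≤ S) :
    y (gridPt T m k) ≤ x (gridPt T m k) := by
  obtain ⟨Cl, hCl0, hCl⟩ := hlam.exists_integral_le
  obtain ⟨Cy, hCy0, hCy⟩ := hy.trace_le
  obtain ⟨Cs, hCs0, hCs⟩ := hy.le_step ρ
  obtain ⟨Dx, hDx⟩ := isCompact_Icc.exists_bound_of_continuousOn hxc
  have hS0 : 0 ≤ S := (gridPt_mem hT hk).1.trans hkS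
  have hDx0 : 0 ≤ Dx := (norm_nonneg _).trans (hDx 0 ⟨le_rfl, hS0⟩)
  have hρ : 0 ≤ ρ := by
    obtain ⟨θ, -, h, -⟩ := hlin 0 ⟨le_rfl, hS0⟩
    exact (norm_nonneg _).trans h
  set κ := 2 * ρ + T * ρ ^ 2 + M * Cl * ρ ^ 2 with hκ
  have hκ0 : 0 ≤ κ := by positivity
  set E := T * Real.exp (κ * T) with hE
  have hE0 : 0 ≤ E := by positivity
  set Dt := n * Dx + n * E with hDt
  have hDt0 : 0 ≤ Dt := by positivity
  set C₁ := (M * Cl) ^ 2 + M * Cl * ρ with hC₁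
  have hC₁0 : 0 ≤ C₁ := by positivity
  set C := Cs + ρ ^ 2 * Dx + C₁ * Dt with hC
  have hC0 : 0 ≤ C := by positivity
  refine le_of_forall_le_add_smul_one (c := E) fun η hη hη1 => ?_
  obtain ⟨δ, hδ, hinc⟩ := exists_norm_increment_le hlam hS hf₀ hf hx (half_pos hη)
  -- The given grid is refined until the freezing error and the second-order errors are both at most
  -- η/2 per unit time. The original point becomes index k · 2^a of the finer grid.
  obtain ⟨a, ha1, ha2⟩ : ∃ a : ℕ, T / 2 ^ (m + a) ≤ δ ∧ C * (T / 2 ^ (m + a)) ≤ η / 2 := by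
    have h1 : Tendsto (fun a : ℕ => T * (1 / 2 : ℝ) ^ (m + a)) atTop (𝓝 (T * 0)) :=
      ((tendsto_pow_atTop_nhds_zero_of_lt_one (by norm_num) (by norm_num)).comp
        (tendsto_add_atTop_nat m |>.congr fun a => add_comm a m)).const_mul T
    rw [mul_zero] at h1
    have h2 := h1.const_mul C
    rw [mul_zero] at h2
    obtain ⟨a, h3, h4⟩ := ((h1.eventually_le_const hδ).and
      (h2.eventually_le_const (half_pos hη))).exists
    have e : T * (1 / 2 : ℝ) ^ (m + a) = T / 2 ^ (m + a) := by
      rw [one_div, inv_pow]; rfl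
    rw [e] at h3 h4
    exact ⟨a, h3, h4⟩
  set m' := m + a with hm'
  set h := T / 2 ^ m' with hh
  have hh0 : 0 ≤ h := by positivity
  have hhT : h ≤ T := div_le_self hT (one_le_pow₀ (by norm_num))
  have hgrid : ∀ k : ℕ, gridPt T m' k = k * h := fun k => by rw [gridPt, hh]; ring
  have key : ∀ k : ℕ, k ≤ 2 ^ m' → gridPt T m' k ≤ S →
      y (gridPt T m' k) ≤ x (gridPt T m' k) +
        (k * h * η * Real.exp (κ * (k * h))) • (1 : Matrix (Fin n) (Fin n) ℝ) := by
    intro k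
    induction k with
    | zero => intro _ _; simp [gridPt_zero, h0]
    | succ k ih =>
      intro hk hkS
      have hk' : k < 2 ^ m' := hk
      have g1 := gridPt_mem hT hk'.le
      have g2 := gridPt_mem hT hk
      have g12 := gridPt_mono hT m' (Nat.le_succ k)
      rw [Nat.succ_eq_add_one] at g12
      have hsI : gridPt T m' k ∈ Icc 0 S := ⟨g1.1, g12.trans hkS⟩
      have IH := ih hk'.le (g12.trans hkS)
      obtain ⟨θ, hθ, hθρ, hθs, hl0, hlj⟩ := hlin _ hsI
      have hgap : gridPt T m' (k + 1) - gridPt T m' k = h := by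
        rw [hgrid, hgrid]; push_cast; ring
      have i1 := hCs m' k hk' θ hθ hθρ
      have i4 := hinc _ _ g1.1 g12 hkS (by rw [hgap]; exact ha1)
      rw [hgap] at i4
      have hkh : k * h ≤ T := by rw [← hgrid]; exact g1.2
      set e := k * h * η * Real.exp (κ * (k * h)) with he
      have he0 : 0 ≤ e := by positivity
      have heE : e ≤ E := by
        calc e ≤ T * 1 * Real.exp (κ * T) := by rw [he]; gcongr
          _ = E := by rw [mul_one]
      have hyk := hy.posSemidef m' k hk'.le
      have hxn := hDx _ hsI
      have hDtr : (x (gridPt T m' k) + e • 1 - y (gridPt T m' k)).trace ≤ Dt := by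
        rw [Matrix.trace_sub, Matrix.trace_add, Matrix.trace_smul, Matrix.trace_one,
          Fintype.card_fin, smul_eq_mul]
        have b1 := (le_abs_self _).trans (abs_trace_le (x (gridPt T m' k)))
        have b2 := hyk.trace_nonneg
        have b3 : (n : ℝ) * ‖x (gridPt T m' k)‖ ≤ n * Dx := by gcongr
        have b4 : e * n ≤ E * n := by gcongr
        linarith
      have hfin := le_add_smul_one_of_step hθρ hθs hh0 hhT
        (fun j => hlam.integral_nonneg g1.1 g12 g2.2 j)
        (fun j => by
          have := hCl j _ _ g1.1 g12 g2.2
          rwa [hgap] at this)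
        hCl0 he0 (hxs _ hsI) (hxs _ ⟨g2.1, hkS⟩) hl0 hlj hxn hDtr i1 i4 IH
      refine hfin.trans (add_le_add_right (smul_one_le_smul_one ?_) _)
      have := error_recursion hκ0 hh0 hη.le ha2 he
      rw [hC] at this
      linarith
  have hpow : (2 : ℝ) ^ m' = 2 ^ m * 2 ^ a := by rw [hm', pow_add]
  have hg : gridPt T m' (k * 2 ^ a) = gridPt T m k := by
    unfold gridPt
    rw [hpow]
    push_cast
    rw [mul_div_mul_right _ _ (by positivity)]
  have hk2 : k * 2 ^ a ≤ 2 ^ m' := by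
    rw [hm', pow_add]
    exact Nat.mul_le_mul_right _ hk
  have hfin := key (k * 2 ^ a) hk2 (by rw [hg]; exact hkS)
  rw [hg] at hfin
  refine hfin.trans (add_le_add_right (smul_one_le_smul_one ?_) _)
  have hle : ((k * 2 ^ a : ℕ) : ℝ) * h ≤ T := by
    rw [← hgrid]; exact (gridPt_mem hT hk2).2
  have h00 : (0 : ℝ) ≤ ((k * 2 ^ a : ℕ) : ℝ) * h := by positivity
  calc _ ≤ T * η * Real.exp (κ * T) := by gcongr
    _ = E * η := by rw [hE]; ring

end Comparison

end CDKF

namespace CDKF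

/-! ### The deterministic bracket -/

section Bracket

variable {n M : ℕ} {p : Fin M → ℕ} {T S : ℝ} {lam : Fin M → ℝ → ℝ}
  {A Q : Matrix (Fin n) (Fin n) ℝ} {H : (j : Fin M) → Matrix (Fin (p j)) (Fin n) ℝ}
  {R : (j : Fin M) → Matrix (Fin (p j)) (Fin (p j)) ℝ}
  {x y yP yY : ℝ → Matrix (Fin n) (Fin n) ℝ}

theorem IsSolution.sub_apply {F : ℝ → Matrix (Fin n) (Fin n) ℝ → Matrix (Fin n) (Fin n) ℝ}
    (h : IsSolution T F x) {s t : ℝ} (hs : 0 ≤ s) (hst : s ≤ t) (ht : t ≤ T) (i k : Fin n) :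
    x t i k - x s i k = ∫ r in s..t, F r (x r) i k := by
  have hi : ∀ u ∈ Icc 0 T, IntervalIntegrable (fun r => F r (x r) i k) volume 0 u := fun u hu =>
    (h.integrable i k).mono_set (by
      rw [uIcc_of_le hu.1, uIcc_of_le (hu.1.trans hu.2)]
      exact Icc_subset_Icc_right hu.2)
  have hsI : s ∈ Icc 0 T := ⟨hs, hst.trans ht⟩
  have htI : t ∈ Icc 0 T := ⟨hs.trans hst, ht⟩
  rw [h.eq t htI, h.eq s hsI, ← intervalIntegral.integral_interval_sub_left (hi t htI) (hi s hsI)]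
  simp [matIntegral]

/-- The linearization point at time s is Z = x s, where the tangent to YQY is exact. Continuity on a
compact interval bounds the coefficients. -/
theorem IsDiscreteSubsolution.le_infoSolution
    (hy : IsDiscreteSubsolution T lam (infoCoeffs A Q H R) y) (hT : 0 ≤ T)
    (hlam : IsSchedule T lam) (hQ : Q.PosSemidef) (hR : ∀ j, (R j).PosDef)
    (hx : IsSolution T (infoField A Q H R lam) x) (h0 : y 0 = x 0) {m k : ℕ} (hk : k ≤ 2 ^ m) :
    y (gridPt T m k) ≤ x (gridPt T m k) := by
  have hc := hx.continuousOn
  set Θ : Matrix (Fin n) (Fin n) ℝ → Coeff n M := fun Z =>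
    (-(A + Q * Z)ᵀ, Zᵀ * Q * Z, fun _ => 1, fun j => infoGain (H j) (R j)) with hΘ
  have hΘc : Continuous Θ := by fun_prop
  obtain ⟨ρ, hρ⟩ := isCompact_Icc.exists_bound_of_continuousOn (hΘc.comp_continuousOn hc)
  refine hy.le_of_linearized hT hlam le_rfl hc (fun s hs => hx.isSymm s hs)
    (f₀ := fun s => -(x s * A) - Aᵀ * x s - x s * Q * x s)
    (f := fun j _ => infoGain (H j) (R j)) ?_ (fun j => continuousOn_const) ?_ (ρ := ρ) ?_ h0 m k hk
    (gridPt_mem hT hk).2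
  · fun_prop
  · intro s t hs hst ht i k
    rw [hx.sub_apply hs hst ht]
    simp [infoField, Matrix.sum_apply]
  · intro s hs
    have hxs : (x s)ᵀ = x s := hx.isSymm s hs
    have hmem : Θ (x s) ∈ infoCoeffs A Q H R := ⟨x s, rfl⟩
    refine ⟨Θ (x s), hmem, hρ s hs, isSymm_of_mem_infoCoeffs hQ hR hmem, ?_, fun j => ?_⟩
    · simp only [hΘ, Matrix.transpose_neg, Matrix.transpose_transpose, Matrix.transpose_add,
        Matrix.transpose_mul, hxs, hQ.transpose_eq]
      simp only [mul_add, add_mul, neg_mul, mul_neg, Matrix.mul_assoc]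
      abel
    · simp [hΘ]

theorem continuousOn_kalmanGain {p : ℕ} {H : Matrix (Fin p) (Fin n) ℝ}
    {R : Matrix (Fin p) (Fin p) ℝ} (hR : R.PosDef) {I : Set ℝ} (hx : ContinuousOn x I)
    (hpsd : ∀ s ∈ I, (x s).PosSemidef) : ContinuousOn (fun s => kalmanGain H R (x s)) I := by
  intro s hs
  have h1 : ContinuousWithinAt (fun s => H * x s * Hᵀ + R) I s := by
    have := hx s hs
    fun_prop
  have hinv : ContinuousAt (fun X : Matrix (Fin p) (Fin p) ℝ => X⁻¹) (H * x s * Hᵀ + R) :=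
    (hasFDerivAt_matrix_inv (innovation_posDef hR (hpsd s hs))).continuousAt
  have h2 : ContinuousWithinAt (fun s => (H * x s * Hᵀ + R)⁻¹) I s :=
    ContinuousAt.comp_continuousWithinAt (f := fun s => H * x s * Hᵀ + R) hinv h1
  have h3 : ContinuousWithinAt (fun s => x s * Hᵀ) I s := by
    have := hx s hs
    fun_prop
  unfold kalmanGain
  exact ContinuousWithinAt.comp_of_eq (f := fun s => (x s * Hᵀ, (H * x s * Hᵀ + R)⁻¹))
    (g := fun q : Matrix (Fin n) (Fin p) ℝ × Matrix (Fin p) (Fin p) ℝ => q.1 * q.2) (t := univ)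
    (by fun_prop : Continuous fun q : Matrix (Fin n) (Fin p) ℝ × Matrix (Fin p) (Fin p) ℝ =>
      q.1 * q.2).continuousWithinAt (h3.prodMk h2) (mapsTo_univ _ _) rfl

/-- The tangent coefficient at time s is the Kalman gain of x s. Positive semidefiniteness keeps the
innovation matrix invertible and the gain continuous, hence bounded. It is assumed only up to S,
since it must be bootstrapped. -/
theorem IsDiscreteSubsolution.le_covSolution_of_posSemidef
    (hy : IsDiscreteSubsolution T lam (covCoeffs A Q H R) y) (hT : 0 ≤ T)
    (hlam : IsSchedule T lam) (hQ : Q.PosSemidef) (hR : ∀ j, (R j).PosDef)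
    (hx : IsSolution T (covField A Q H R lam) x) (h0 : y 0 = x 0) (hS : S ≤ T)
    (hpsd : ∀ s ∈ Icc 0 S, (x s).PosSemidef) {m k : ℕ} (hk : k ≤ 2 ^ m) (hkS : gridPt T m k ≤ S) :
    y (gridPt T m k) ≤ x (gridPt T m k) := by
  have hc := hx.continuousOn.mono (Icc_subset_Icc_right hS)
  have hK := fun j => continuousOn_kalmanGain (H := H j) (hR j) hc hpsd
  set Θ : ((j : Fin M) → Matrix (Fin n) (Fin (p j)) ℝ) → Coeff n M := fun K =>
    (A, Q, fun j => 1 - K j * H j, fun j => K j * R j * (K j)ᵀ) with hΘ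
  have hΘc : Continuous Θ := by fun_prop
  obtain ⟨ρ, hρ⟩ := isCompact_Icc.exists_bound_of_continuousOn
    (hΘc.comp_continuousOn (continuousOn_pi.2 hK))
  have hcov : ∀ j s, covGain (H j) (R j) (x s) = kalmanGain (H j) (R j) (x s) * H j * x s :=
    fun j s => rfl
  refine hy.le_of_linearized hT hlam hS hc (fun s hs => (hpsd s hs).transpose_eq)
    (f₀ := fun s => A * x s + x s * Aᵀ + Q)
    (f := fun j s => -covGain (H j) (R j) (x s)) ?_ (fun j => ?_) ?_ (ρ := ρ) ?_ h0 m k hk hkS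
  · fun_prop
  · simp only [hcov]
    have h1 : Continuous fun q : Matrix (Fin n) (Fin (p j)) ℝ × Matrix (Fin n) (Fin n) ℝ =>
      -(q.1 * H j * q.2) := by fun_prop
    exact Continuous.comp_continuousOn (f := fun s => (kalmanGain (H j) (R j) (x s), x s)) h1
      ((hK j).prodMk hc)
  · intro s t hs hst ht i k
    rw [hx.sub_apply hs hst (ht.trans hS)]
    simp [covField, Matrix.sum_apply, sub_eq_add_neg]
  · intro s hs
    have hmem : Θ (fun j => kalmanGain (H j) (R j) (x s)) ∈ covCoeffs A Q H R := ⟨_, rfl⟩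
    refine ⟨_, hmem, hρ s hs, isSymm_of_mem_covCoeffs hQ hR hmem, rfl, fun j => ?_⟩
    have := joseph_form_kalmanGain (H := H j) (hR j) (hpsd s hs)
    simp only [hΘ]
    rw [this]
    abel

theorem le_of_le_gridPt {c : Matrix (Fin n) (Fin n) ℝ} (hT : 0 < T) (hS : S ≤ T)
    (hx : ContinuousOn x (Icc 0 T))
    (h : ∀ m k, k ≤ 2 ^ m → gridPt T m k ≤ S → c ≤ x (gridPt T m k)) {s : ℝ} (hs : s ∈ Icc 0 S) :
    c ≤ x s := by
  have hsT : s ≤ T := hs.2.trans hS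
  set k : ℕ → ℕ := fun m => ⌊s / T * 2 ^ m⌋₊ with hk
  have ha : ∀ m : ℕ, 0 ≤ s / T * 2 ^ m := fun m => by
    have := hs.1
    positivity
  have h1 : ∀ m, gridPt T m (k m) ≤ s := fun m => by
    have := Nat.floor_le (ha m)
    rw [gridPt]
    calc T * ((k m : ℝ) / 2 ^ m) ≤ T * (s / T * 2 ^ m / 2 ^ m) := by gcongr
      _ = s := by field_simp
  have h2 : ∀ m, s - T * (1 / 2) ^ m ≤ gridPt T m (k m) := fun m => by
    have := Nat.lt_floor_add_one (s / T * 2 ^ m)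
    rw [gridPt]
    have e : s - T * (1 / 2) ^ m = T * ((s / T * 2 ^ m - 1) / 2 ^ m) := by
      rw [one_div, inv_pow]; field_simp
    rw [e]
    gcongr
    linarith
  have hk2 : ∀ m, k m ≤ 2 ^ m := fun m => by
    have h3 : s / T * 2 ^ m ≤ ((2 ^ m : ℕ) : ℝ) := by
      push_cast
      have : s / T ≤ 1 := (div_le_one hT).2 hsT
      have h2 : (0 : ℝ) ≤ 2 ^ m := by positivity
      nlinarith
    exact (Nat.floor_mono h3).trans (Nat.floor_natCast _).le
  have hlim : Tendsto (fun m => gridPt T m (k m)) atTop (𝓝 s) := by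
    refine tendsto_of_tendsto_of_tendsto_of_le_of_le ?_ tendsto_const_nhds h2 h1
    have := (tendsto_pow_atTop_nhds_zero_of_lt_one (r := (1 / 2 : ℝ)) (by norm_num)
      (by norm_num)).const_mul T
    simpa using this.const_sub s
  have hlim2 : Tendsto (fun m => gridPt T m (k m)) atTop (𝓝[Icc 0 T] s) :=
    tendsto_nhdsWithin_iff.2 ⟨hlim, Eventually.of_forall fun m => gridPt_mem hT.le (hk2 m)⟩
  exact ge_of_tendsto' ((hx s ⟨hs.1, hsT⟩).tendsto.comp hlim2) fun m =>
    h m _ (hk2 m) ((h1 m).trans hs.2)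

/-- Continuation: while x ≥ δ, continuity keeps x positive semidefinite a little longer, and there
comparison with y ≥ δ restores the bound x ≥ δ. The set of times reached is closed and extends to
the right, so it is all of [0, T]. -/
theorem IsDiscreteSubsolution.le_covSolution
    (hy : IsDiscreteSubsolution T lam (covCoeffs A Q H R) y) (hT : 0 ≤ T)
    (hlam : IsSchedule T lam) (hQ : Q.PosSemidef) (hR : ∀ j, (R j).PosDef)
    (hx : IsSolution T (covField A Q H R lam) x) (h0 : y 0 = x 0) {δ : ℝ} (hδ : 0 < δ)
    (hyδ : ∀ m k, k ≤ 2 ^ m → δ • 1 ≤ y (gridPt T m k)) {m k : ℕ} (hk : k ≤ 2 ^ m) :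
    y (gridPt T m k) ≤ x (gridPt T m k) := by
  have hc := hx.continuousOn
  have hδ1 : (0 : Matrix (Fin n) (Fin n) ℝ) ≤ δ • 1 := (Matrix.PosSemidef.one.smul hδ.le).nonneg
  set J : Set ℝ := {t | ∀ s ∈ Icc 0 t, δ • 1 ≤ x s} with hJ
  have hxcl : IsClosed (Icc 0 T ∩ x ⁻¹' Ici (δ • 1)) :=
    hc.preimage_isClosed_of_isClosed isClosed_Icc isClosed_Ici
  have hJcl : IsClosed (J ∩ Icc 0 T) := by
    refine isClosed_of_closure_subset fun t ht => ?_
    have htI : t ∈ Icc 0 T := isClosed_Icc.closure_subset_iff.2 inter_subset_right ht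
    refine ⟨fun s hs => ?_, htI⟩
    rcases hs.2.lt_or_eq with hst | rfl
    · obtain ⟨t', ht', htJ⟩ := mem_closure_iff_nhds.1 ht (Ioi s) (Ioi_mem_nhds hst)
      exact htJ.1 s ⟨hs.1, (mem_Ioi.1 ht').le⟩
    · have hsub : J ∩ Icc 0 T ⊆ Icc 0 T ∩ x ⁻¹' Ici (δ • 1) := fun u hu =>
        ⟨hu.2, hu.1 u ⟨hu.2.1, le_rfl⟩⟩
      exact (hxcl.closure_subset_iff.2 hsub ht).2
  have hmain : Icc 0 T ⊆ J := by
    refine hJcl.Icc_subset_of_forall_exists_gt ?_ ?_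
    · intro s hs
      have : s = 0 := le_antisymm hs.2 hs.1
      rw [this, ← h0]
      have := hyδ 0 0 (Nat.zero_le _)
      rwa [gridPt_zero] at this
    · rintro t ⟨htJ, ht0, htT⟩ u hu
      have hxt := htJ t ⟨ht0, le_rfl⟩
      -- A perturbation smaller than δ in norm cannot destroy positivity of a matrix that is at
      -- least δ.
      obtain ⟨η, hη, hclose⟩ := Metric.continuousWithinAt_iff.1 (hc t ⟨ht0, htT.le⟩) δ hδ
      set z := min (min u T) (t + η / 2) with hz
      have htz : t < z := lt_min (lt_min hu htT) (by linarith)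
      have hzu : z ≤ u := (min_le_left _ _).trans (min_le_left _ _)
      have hzT : z ≤ T := (min_le_left _ _).trans (min_le_right _ _)
      have hzη : z ≤ t + η / 2 := min_le_right _ _
      refine ⟨z, fun s hs => ?_, htz, hzu⟩
      have hpsd : ∀ r ∈ Icc 0 z, (x r).PosSemidef := by
        intro r hr
        rcases le_total r t with hrt | hrt
        · exact Matrix.nonneg_iff_posSemidef.1 (hδ1.trans (htJ r ⟨hr.1, hrt⟩))
        · have hrI : r ∈ Icc 0 T := ⟨hr.1, hr.2.trans hzT⟩
          have h1 := hclose hrI (by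
            rw [Real.dist_eq, abs_of_nonneg (sub_nonneg.2 hrt)]
            linarith [hr.2])
          rw [dist_eq_norm] at h1
          have h2 : (x r - x t)ᵀ = x r - x t := by
            rw [Matrix.transpose_sub, hx.isSymm r hrI, hx.isSymm t ⟨ht0, htT.le⟩]
          have h3 := add_le_add (neg_norm_smul_one_le h2 h1.le) hxt
          rw [neg_add_cancel, sub_add_cancel] at h3
          exact Matrix.nonneg_iff_posSemidef.1 h3
      refine le_of_le_gridPt (ht0.trans_lt htT) hzT hc (fun m k hk hkz => ?_) hs
      exact (hyδ m k hk).trans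
        (hy.le_covSolution_of_posSemidef hT hlam hQ hR hx h0 hzT hpsd hk hkz)
  refine hy.le_covSolution_of_posSemidef hT hlam hQ hR hx h0 le_rfl (fun s hs => ?_) hk
    (gridPt_mem hT hk).2
  exact Matrix.nonneg_iff_posSemidef.1 (hδ1.trans (hmain hs s ⟨hs.1, le_rfl⟩))

/-- Apart from the two comparisons, everything follows from the tangent inequality between the two
means: scalar Z gives positivity, Z = Ŷ⁻¹ the lower bound. -/
theorem bracket_of_subsolutions {Yhat Phat : ℝ → Matrix (Fin n) (Fin n) ℝ} (hT : 0 ≤ T)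
    (hlam : IsSchedule T lam) (hQ : Q.PosSemidef) (hR : ∀ j, (R j).PosDef)
    (hyP : IsDiscreteSubsolution T lam (covCoeffs A Q H R) yP)
    (hyY : IsDiscreteSubsolution T lam (infoCoeffs A Q H R) yY)
    (hYhat : IsSolution T (infoField A Q H R lam) Yhat)
    (hPhat : IsSolution T (covField A Q H R lam) Phat) (hP0 : yP 0 = Phat 0)
    (hY0 : yY 0 = Yhat 0)
    (htan : ∀ m k, k ≤ 2 ^ m → ∀ Z : Matrix (Fin n) (Fin n) ℝ,
      Z + Zᵀ - Z * yY (gridPt T m k) * Zᵀ ≤ yP (gridPt T m k)) :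
    (Yhat T).PosDef ∧ (Yhat T)⁻¹ ≤ yP T ∧ yP T ≤ Phat T := by
  obtain ⟨CY, hCY0, hCY⟩ := hyY.trace_le
  obtain ⟨CP, hCP0, hCP⟩ := hyP.trace_le
  have hT1 : gridPt T 0 1 = T := by simpa using gridPt_last T 0
  have htan1 : ∀ m k, k ≤ 2 ^ m → ∀ c : ℝ,
      (2 * c) • (1 : Matrix (Fin n) (Fin n) ℝ) ≤
        yP (gridPt T m k) + c ^ 2 • yY (gridPt T m k) := by
    intro m k hk c
    have h1 := htan m k hk (c • 1)
    rw [← sub_nonneg] at h1 ⊢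
    convert h1 using 1
    simp only [Matrix.transpose_smul, Matrix.transpose_one, Matrix.smul_mul, Matrix.mul_smul,
      one_mul, mul_one]
    module
  have hub : ∀ {y : ℝ → Matrix (Fin n) (Fin n) ℝ} {C : ℝ} {m k : ℕ},
      (y (gridPt T m k)).PosSemidef → (y (gridPt T m k)).trace ≤ C →
      y (gridPt T m k) ≤ C • 1 := fun hp ht =>
    (le_trace_smul_one hp).trans (smul_one_le_smul_one ht)
  -- With c = 1/(CY + 1), the mean of P is at least 2c - c² CY ≥ c.
  have hPδ : ∀ m k, k ≤ 2 ^ m → (1 / (CY + 1)) • 1 ≤ yP (gridPt T m k) := by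
    intro m k hk
    have h1 := htan1 m k hk (1 / (CY + 1))
    have h2 := smul_le_smul_of_nonneg (sq_nonneg (1 / (CY + 1)))
      (hub (hyY.posSemidef m k hk) (hCY m k hk))
    have h3 : (1 / (CY + 1) + (1 / (CY + 1)) ^ 2 * CY) • (1 : Matrix (Fin n) (Fin n) ℝ) ≤
        (2 * (1 / (CY + 1))) • 1 := by
      apply smul_one_le_smul_one
      have : (1 / (CY + 1)) ^ 2 * CY ≤ 1 / (CY + 1) := by
        rw [div_pow, one_pow, div_mul_eq_mul_div, one_mul, div_le_div_iff₀ (by positivity)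
          (by positivity)]
        nlinarith
      linarith
    have h4 := add_le_add (add_le_add h1 h2) h3
    rw [← sub_nonneg] at h4 ⊢
    convert h4 using 1
    module
  -- Conversely c = CP + 1 gives c² yY ≥ 2c - CP ≥ c.
  have hYδ : ∃ δ : ℝ, 0 < δ ∧ δ • 1 ≤ yY T := by
    refine ⟨1 / (CP + 1), by positivity, ?_⟩
    have h1 := htan1 0 1 (by norm_num) (CP + 1)
    have h2 := hub (hyP.posSemidef 0 1 (by norm_num)) (hCP 0 1 (by norm_num))
    rw [hT1] at h1 h2
    have h3 : (CP + 1) • (1 : Matrix (Fin n) (Fin n) ℝ) ≤ (2 * (CP + 1) - CP) • 1 :=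
      smul_one_le_smul_one (by linarith)
    have h4 : (CP + 1) • (1 : Matrix (Fin n) (Fin n) ℝ) ≤ (CP + 1) ^ 2 • yY T := by
      have h5 := add_le_add (add_le_add h1 h2) h3
      rw [← sub_nonneg] at h5 ⊢
      convert h5 using 1
      module
    have h5 := smul_le_smul_of_nonneg (by positivity : 0 ≤ 1 / (CP + 1) ^ 2) h4
    rw [smul_smul, smul_smul] at h5
    have e1 : 1 / (CP + 1) ^ 2 * (CP + 1) = 1 / (CP + 1) := by field_simp
    have e2 : 1 / (CP + 1) ^ 2 * (CP + 1) ^ 2 = 1 := by field_simp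
    rwa [e1, e2, one_smul] at h5
  have hYle : yY T ≤ Yhat T := by
    have := hyY.le_infoSolution hT hlam hQ hR hYhat hY0 (m := 0) (k := 1) (by norm_num)
    rwa [hT1] at this
  have hPle : yP T ≤ Phat T := by
    have := hyP.le_covSolution hT hlam hQ hR hPhat hP0 (by positivity : 0 < 1 / (CY + 1)) hPδ
      (m := 0) (k := 1) (by norm_num)
    rwa [hT1] at this
  obtain ⟨δ, hδ, hYδ⟩ := hYδ
  have hpd : (Yhat T).PosDef := by
    have h1 := Matrix.le_iff.1 (hYδ.trans hYle)
    have h2 := Matrix.PosDef.posSemidef_add h1 (Matrix.PosDef.one.smul hδ)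
    rwa [sub_add_cancel] at h2
  refine ⟨hpd, ?_, hPle⟩
  have hit := hpd.inv.posSemidef.transpose_eq
  have h1 := htan 0 1 (by norm_num) (Yhat T)⁻¹
  have h2 := conj_le_conj hYle (Yhat T)⁻¹
  rw [hT1] at h1
  rw [hpd.inv_mul_self, one_mul] at h2
  have h3 := add_le_add h1 h2
  rw [hit] at h3
  rw [← sub_nonneg] at h3 ⊢
  convert h3 using 1
  abel

end Bracket

end CDKF

namespace CDKF

/-! ### Conditional means of the covariance and of the information matrix -/

section ConditionalTangent

variable {n : ℕ}

theorem isClosed_tangent_le (X Y : Matrix (Fin n) (Fin n) ℝ) :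
    IsClosed {Z : Matrix (Fin n) (Fin n) ℝ | Z + Zᵀ - Z * Y * Zᵀ ≤ X} := by
  refine isClosed_le ?_ continuous_const
  fun_prop

theorem tangent_le_of_dense {D : Set (Matrix (Fin n) (Fin n) ℝ)} (hD : Dense D)
    {X Y : Matrix (Fin n) (Fin n) ℝ} (h : ∀ Z ∈ D, Z + Zᵀ - Z * Y * Zᵀ ≤ X)
    (Z : Matrix (Fin n) (Fin n) ℝ) : Z + Zᵀ - Z * Y * Zᵀ ≤ X := by
  have hsub := (isClosed_tangent_le X Y).closure_subset_iff.2 fun Z hZ => by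
    rw [mem_ofPred_eq]
    exact h Z hZ
  have := hsub (hD Z)
  rwa [mem_ofPred_eq] at this

theorem exists_countable_dense_matrix (n : ℕ) :
    ∃ D : Set (Matrix (Fin n) (Fin n) ℝ), D.Countable ∧ Dense D := by
  have := secondCountableTopology_matrix (n := n)
  exact TopologicalSpace.exists_countable_dense _

/-- The adjugate formula holds at singular matrices too, where both sides vanish. -/
theorem measurable_matrix_inv : Measurable fun X : Matrix (Fin n) (Fin n) ℝ => X⁻¹ := by
  have := borelSpace_matrix (n := n)
  refine measurable_pi_iff.2 fun i => measurable_pi_iff.2 fun j => ?_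
  have h1 : Measurable fun X : Matrix (Fin n) (Fin n) ℝ => X.det :=
    (by fun_prop : Continuous fun X : Matrix (Fin n) (Fin n) ℝ => X.det).measurable
  have h2 : Measurable fun X : Matrix (Fin n) (Fin n) ℝ => X.adjugate i j :=
    (by fun_prop : Continuous fun X : Matrix (Fin n) (Fin n) ℝ => X.adjugate i j).measurable
  have e : (fun X : Matrix (Fin n) (Fin n) ℝ => X⁻¹ i j) =
      fun X => (X.det)⁻¹ * X.adjugate i j := by
    funext X
    rw [Matrix.inv_def, Matrix.smul_apply, smul_eq_mul, Ring.inverse_eq_inv']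
  rw [e]
  exact h1.inv.mul h2

theorem measurable_trace : Measurable fun X : Matrix (Fin n) (Fin n) ℝ => X.trace := by
  have := borelSpace_matrix (n := n)
  exact (by fun_prop : Continuous fun X : Matrix (Fin n) (Fin n) ℝ => X.trace).measurable

attribute [local instance] instTopologicalSpaceFrobenius instBorelSpaceFrobenius
  instSecondCountableTopologyFrobenius instOrderClosedTopologyFrobenius

variable {Ω : Type*} {𝒢 mΩ : MeasurableSpace Ω} {μ : Measure Ω} {B : Set Ω}
  [IsProbabilityMeasure μ]

/-- Conditional Jensen for the matrix inverse: for fixed Z the inequality is affine in X and Y, so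
it can be averaged, and a countable dense set of Z gives a common null set. -/
theorem ae_tangent_le_condExp (h𝒢 : 𝒢 ≤ mΩ) (hB : MeasurableSet[𝒢] B)
    {X Y : Ω → Matrix (Fin n) (Fin n) ℝ} (hX : Integrable (B.indicator X) μ)
    (hY : Integrable (B.indicator Y) μ)
    (h : ∀ᵐ ω ∂μ, ∀ Z : Matrix (Fin n) (Fin n) ℝ, Z + Zᵀ - Z * Y ω * Zᵀ ≤ X ω) :
    ∀ᵐ ω ∂μ, ω ∈ B → ∀ Z : Matrix (Fin n) (Fin n) ℝ,
      Z + Zᵀ - Z * μ[B.indicator Y | 𝒢] ω * Zᵀ ≤ μ[B.indicator X | 𝒢] ω := by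
  obtain ⟨D, hDc, hDd⟩ := exists_countable_dense_matrix n
  have h1 : ∀ᵐ ω ∂μ, ∀ Z ∈ D, ω ∈ B →
      Z + Zᵀ - Z * μ[B.indicator Y | 𝒢] ω * Zᵀ ≤ μ[B.indicator X | 𝒢] ω := by
    refine (ae_ball_iff hDc).2 fun Z _ => ?_
    obtain ⟨hi, hc⟩ := condExp_indicator_affine h𝒢 hB hY (-conjCLM Z) (Z + Zᵀ)
    have hle : (B.indicator fun ω => (-conjCLM Z) (Y ω) + (Z + Zᵀ)) ≤ᵐ[μ] B.indicator X := by
      filter_upwards [h] with ω hω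
      by_cases hB : ω ∈ B
      · simp only [indicator_of_mem hB]
        refine le_trans (le_of_eq ?_) (hω Z)
        rw [_root_.neg_apply, conjCLM_apply]
        abel
      · simp [hB]
    filter_upwards [condExp_mono (m := 𝒢) hi hX hle, hc] with ω h2 h3 hω
    refine le_trans (le_of_eq ?_) h2
    rw [h3 hω, _root_.neg_apply, conjCLM_apply]
    abel
  filter_upwards [h1] with ω hω hωB
  exact tangent_le_of_dense hDd fun Z hZ => hω Z hZ hωB

/-- An entry of a matrix as a continuous linear map. -/
noncomputable def entryL (i k : Fin n) : Matrix (Fin n) (Fin n) ℝ →L[ℝ] ℝ :=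
  LinearMap.toContinuousLinearMap (Matrix.entryLinearMap ℝ ℝ i k)

theorem entryL_apply (i k : Fin n) (X : Matrix (Fin n) (Fin n) ℝ) : entryL i k X = X i k := rfl

theorem condExp_indicator_eq_self (h𝒢 : 𝒢 ≤ mΩ) (hB : MeasurableSet[𝒢] B)
    {X : Ω → Matrix (Fin n) (Fin n) ℝ} (hXm : Measurable[𝒢] X)
    (hX : Integrable (B.indicator X) μ) : μ[B.indicator X | 𝒢] = B.indicator X :=
  condExp_of_stronglyMeasurable h𝒢 (hXm.indicator hB).stronglyMeasurable hX

/-- On a set of values of `Z` where `X` is integrable, the conditional mean of `X` given `Z`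
is a conditional expectation. -/
theorem ae_condMean_eq {β : Type*} [mβ : MeasurableSpace β] {Z : Ω → β} (hZ : Measurable Z)
    {X : Ω → Matrix (Fin n) (Fin n) ℝ} (hX : Measurable X) {s : Set β} (hs : MeasurableSet s)
    (hi : Integrable ((Z ⁻¹' s).indicator X) μ) :
    ∀ᵐ ω ∂μ, Z ω ∈ s →
      condMean μ X Z ω = μ[(Z ⁻¹' s).indicator X | mβ.comap Z] ω := by
  have hent : ∀ᵐ ω ∂μ, ∀ i k : Fin n, Z ω ∈ s →
      condMean μ X Z ω i k = μ[(Z ⁻¹' s).indicator X | mβ.comap Z] ω i k := by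
    refine ae_all_iff.2 fun i => ae_all_iff.2 fun k => ?_
    have hXik : Measurable fun ω => X ω i k :=
      (measurable_pi_apply k).comp ((measurable_pi_apply i).comp hX)
    -- Truncating in the conditioning variable requires integrability only over Z ∈ s, yet f(z, ·)
    -- is the identity for z ∈ s.
    set f : β × ℝ → ℝ := (Prod.fst ⁻¹' s).indicator Prod.snd with hf
    have hfm : StronglyMeasurable f :=
      (measurable_snd.indicator (measurable_fst hs)).stronglyMeasurable
    have e : (fun ω => f (Z ω, X ω i k)) = entryL i k ∘ (Z ⁻¹' s).indicator X := by
      funext ω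
      rw [Function.comp_apply, entryL_apply]
      by_cases h : Z ω ∈ s
      · rw [indicator_of_mem (show ω ∈ Z ⁻¹' s from h), hf,
          indicator_of_mem (show (Z ω, X ω i k) ∈ Prod.fst ⁻¹' s from h)]
      · rw [indicator_of_notMem (show ω ∉ Z ⁻¹' s from h), hf,
          indicator_of_notMem (show (Z ω, X ω i k) ∉ Prod.fst ⁻¹' s from h)]
        rfl
    have hfi : Integrable (fun ω => f (Z ω, X ω i k)) μ := by
      rw [e]
      exact (entryL i k).integrable_comp hi
    have h1 := condExp_prod_ae_eq_integral_condDistrib (μ := μ) hZ hXik.aemeasurable hfm hfi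
    rw [e] at h1
    filter_upwards [h1, (entryL i k).comp_condExp_comm hi (m := mβ.comap Z)] with ω h2 h3 hω
    rw [← h3, Function.comp_apply, entryL_apply] at h2
    rw [h2, condMean, Matrix.of_apply]
    congr 1
    funext y
    rw [hf, indicator_of_mem (show (Z ω, y) ∈ Prod.fst ⁻¹' s from hω)]
  filter_upwards [hent] with ω h hω
  ext i k
  exact h i k hω

end ConditionalTangent

/-! ### Restriction to a shorter horizon -/

section Restriction

variable {n M : ℕ} {p : Fin M → ℕ} {T t : ℝ} {lam : Fin M → ℝ → ℝ}
  {A Q : Matrix (Fin n) (Fin n) ℝ} {H : (j : Fin M) → Matrix (Fin (p j)) (Fin n) ℝ}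
  {R : (j : Fin M) → Matrix (Fin (p j)) (Fin (p j)) ℝ}

theorem IsSchedule.mono (h : IsSchedule T lam) (ht : t ≤ T) : IsSchedule t lam := by
  have hle : (volume : Measure ℝ).restrict (Icc 0 t) ≤ volume.restrict (Icc 0 T) :=
    Measure.restrict_mono (Icc_subset_Icc_right ht) le_rfl
  refine ⟨fun j => (h.aemeasurable j).mono_measure hle,
    fun j => ae_mono hle (h.nonneg j), ?_⟩
  obtain ⟨C, hC⟩ := h.bounded
  exact ⟨C, fun j => MeasureTheory.ae_mono hle (hC j)⟩

theorem IsSolution.mono {F : ℝ → Matrix (Fin n) (Fin n) ℝ → Matrix (Fin n) (Fin n) ℝ}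
    {x : ℝ → Matrix (Fin n) (Fin n) ℝ} (h : IsSolution T F x) (ht0 : 0 ≤ t) (ht : t ≤ T) :
    IsSolution t F x where
  isSymm s hs := h.isSymm s (Icc_subset_Icc_right ht hs)
  continuousOn := h.continuousOn.mono (Icc_subset_Icc_right ht)
  integrable i k := (h.integrable i k).mono_set (by
    rw [uIcc_of_le ht0, uIcc_of_le (ht0.trans ht)]
    exact Icc_subset_Icc_right ht)
  eq s hs := h.eq s (Icc_subset_Icc_right ht hs)

theorem IsCovPath.mono {N : Fin M → ℝ → ℕ} {P : ℝ → Matrix (Fin n) (Fin n) ℝ}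
    (h : IsCovPath T A Q H R N P) (ht : t ≤ T) : IsCovPath t A Q H R N P where
  rightContinuous s hs := h.rightContinuous s (Ico_subset_Ico_right ht hs)
  leftLimits s hs := h.leftLimits s (Ioc_subset_Ioc_right ht hs)
  eq s hs := h.eq s (Icc_subset_Icc_right ht hs)

variable {Ω : Type*} {mΩ : MeasurableSpace Ω} {μ : Measure Ω} {ℱ : Filtration ℝ mΩ}
  {N : Fin M → ℝ → Ω → ℕ} {P : ℝ → Ω → Matrix (Fin n) (Fin n) ℝ}

theorem IsPoissonFamily.mono (h : IsPoissonFamily μ ℱ T lam N) (ht : t ≤ T) :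
    IsPoissonFamily μ ℱ t lam N where
  adapted j s hs := h.adapted j s (Icc_subset_Icc_right ht hs)
  zero := h.zero
  monotone j := by
    filter_upwards [h.monotone j] with ω hω
    exact hω.mono (Icc_subset_Icc_right ht)
  rightContinuous j := by
    filter_upwards [h.rightContinuous j] with ω hω s hs
    exact hω s (Ico_subset_Ico_right ht hs)
  indepIncrements s hs u hu := h.indepIncrements s (Icc_subset_Icc_right ht hs) u
    (Icc_subset_Icc_right ht hu)
  law j s hs u hu := h.law j s (Icc_subset_Icc_right ht hs) u (Icc_subset_Icc_right ht hu)
  indep := h.indep.comp (fun _ f s => f (inclusion (Icc_subset_Icc_right ht) s)) fun _ =>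
    measurable_pi_iff.2 fun _ => measurable_pi_apply _

theorem IsCovProcess.mono (h : IsCovProcess μ ℱ T A Q H R lam N P) (ht : t ≤ T) :
    IsCovProcess μ ℱ t A Q H R lam N P where
  poisson := h.poisson.mono ht
  adapted s hs := h.adapted s (Icc_subset_Icc_right ht hs)
  posDef_init := h.posDef_init
  path := by
    filter_upwards [h.path] with ω hω
    exact hω.mono ht

end Restriction

/-! ### The bracket at the final time -/

section FinalTime

variable {Ω : Type*} {mΩ : MeasurableSpace Ω} {μ : Measure Ω} [IsProbabilityMeasure μ]
  {ℱ : Filtration ℝ mΩ} {n M : ℕ} {p : Fin M → ℕ} {T : ℝ} {lam : Fin M → ℝ → ℝ}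
  {A Q : Matrix (Fin n) (Fin n) ℝ} {H : (j : Fin M) → Matrix (Fin (p j)) (Fin n) ℝ}
  {R : (j : Fin M) → Matrix (Fin (p j)) (Fin (p j)) ℝ}
  {N : Fin M → ℝ → Ω → ℕ} {P : ℝ → Ω → Matrix (Fin n) (Fin n) ℝ}

theorem IsCovProcess.ae_posDef_and_isJumpPath (hP : IsCovProcess μ ℱ T A Q H R lam N P)
    (hT : 0 ≤ T) (hlam : IsSchedule T lam) (hQ : Q.PosSemidef) (hR : ∀ j, (R j).PosDef) :
    ∀ᵐ ω ∂μ, (∀ s ∈ Icc 0 T, (P s ω).PosDef) ∧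
      IsJumpPath T (fun j t => N j t ω) (covCoeffs A Q H R) (fun t => P t ω) ∧
      IsJumpPath T (fun j t => N j t ω) (infoCoeffs A Q H R) (fun t => (P t ω)⁻¹) := by
  filter_upwards [hP.path, hP.posDef_init, hP.poisson.ae_mono,
    ae_all_iff.2 hP.poisson.rightContinuous, hP.poisson.ae_cells hT hlam] with ω h h0 hm hrc hcells
  exact ⟨h.posDef hT hQ hR hm hrc hcells h0, h.isJumpPath hT hQ hR hm hrc hcells h0,
    h.isJumpPath_inv hT hQ hR hm hrc hcells h0⟩

theorem IsCovProcess.ae_bracket (hP : IsCovProcess μ ℱ T A Q H R lam N P)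
    (hT : 0 ≤ T) (hlam : IsSchedule T lam) (hQ : Q.PosSemidef) (hR : ∀ j, (R j).PosDef)
    {Yhat Phat : ℝ → Ω → Matrix (Fin n) (Fin n) ℝ}
    (hY : ∀ᵐ ω ∂μ, IsSolution T (infoField A Q H R lam) (fun t => Yhat t ω))
    (hY0 : ∀ᵐ ω ∂μ, Yhat 0 ω = (P 0 ω)⁻¹)
    (hPh : ∀ᵐ ω ∂μ, IsSolution T (covField A Q H R lam) (fun t => Phat t ω))
    (hPh0 : ∀ᵐ ω ∂μ, Phat 0 ω = P 0 ω) :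
    ∀ᵐ ω ∂μ, (Yhat T ω).PosDef ∧ (Yhat T ω)⁻¹ ≤ condMean μ (P T) (P 0) ω ∧
      condMean μ (P T) (P 0) ω ≤ Phat T ω := by
  have h0T : (0 : ℝ) ∈ Icc 0 T := ⟨le_rfl, hT⟩
  have hTT : T ∈ Icc 0 T := ⟨hT, le_rfl⟩
  have hpaths := hP.ae_posDef_and_isJumpPath hT hlam hQ hR
  have hP0m : Measurable (P 0) := (hP.adapted 0 h0T).mono (ℱ.le 0) le_rfl
  have h𝒢 : MeasurableSpace.comap (P 0) instMeasurableSpaceMatrix ≤ ℱ 0 :=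
    (hP.adapted 0 h0T).comap_le
  have hYm : ∀ t ∈ Icc 0 T, Measurable[ℱ t] fun ω => (P t ω)⁻¹ := fun t ht =>
    measurable_matrix_inv.comp (hP.adapted t ht)
  -- Zero gain and zero linearization point give coefficients with all congruence factors equal to
  -- 1, as the trace bounds require.
  have hθP : (A, Q, (fun j => 1 - (0 : Matrix (Fin n) (Fin (p j)) ℝ) * H j), fun j =>
      (0 : Matrix (Fin n) (Fin (p j)) ℝ) * R j * (0 : Matrix (Fin n) (Fin (p j)) ℝ)ᵀ) ∈
      covCoeffs A Q H R := ⟨fun _ => 0, rfl⟩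
  have hθY : (-(A + Q * 0)ᵀ, (0 : Matrix (Fin n) (Fin n) ℝ)ᵀ * Q * 0, (fun _ => 1),
      fun j => infoGain (H j) (R j)) ∈ infoCoeffs A Q H R := ⟨0, rfl⟩
  -- Localization to a σ(P 0)-measurable event with bounded initial traces; as K ranges over ℕ these
  -- events cover Ω.
  have hK : ∀ K : ℕ, ∀ᵐ ω ∂μ, (P 0 ω).trace ≤ K ∧ ((P 0 ω)⁻¹).trace ≤ K →
      (Yhat T ω).PosDef ∧ (Yhat T ω)⁻¹ ≤ condMean μ (P T) (P 0) ω ∧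
        condMean μ (P T) (P 0) ω ≤ Phat T ω := by
    intro K
    set s : Set (Matrix (Fin n) (Fin n) ℝ) := {X | X.trace ≤ K ∧ (X⁻¹).trace ≤ K} with hs
    have hsm : MeasurableSet s :=
      (measurableSet_le measurable_trace measurable_const).inter
        (measurableSet_le (measurable_trace.comp measurable_matrix_inv) measurable_const)
    have hB : MeasurableSet[MeasurableSpace.comap (P 0) instMeasurableSpaceMatrix] (P 0 ⁻¹' s) :=
      ⟨s, hsm, rfl⟩
    have hKP : ∀ ω ∈ P 0 ⁻¹' s, (P 0 ω).trace ≤ K := fun ω hω => hω.1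
    have hKY : ∀ ω ∈ P 0 ⁻¹' s, ((P 0 ω)⁻¹).trace ≤ K := fun ω hω => hω.2
    have hJP := hpaths.mono fun ω h => h.2.1
    have hJY := hpaths.mono fun ω h => h.2.2
    obtain ⟨_, -, hiP⟩ := exists_trace_condExp_le hT hlam hP.poisson hθP (fun j => by simp) h𝒢 hB
      hP.adapted hJP hKP
    obtain ⟨_, -, hiY⟩ := exists_trace_condExp_le hT hlam hP.poisson hθY (fun j => rfl) h𝒢 hB
      hYm hJY hKY
    have hsubP := ae_isDiscreteSubsolution hT hlam hP.poisson
      (fun θ hθ => isSymm_of_mem_covCoeffs hQ hR hθ) hθP (fun j => by simp) h𝒢 hB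
      hP.adapted hJP hKP
    have hsubY := ae_isDiscreteSubsolution hT hlam hP.poisson
      (fun θ hθ => isSymm_of_mem_infoCoeffs hQ hR hθ) hθY (fun j => rfl) h𝒢 hB hYm hJY hKY
    have h𝒢' := h𝒢.trans (ℱ.le 0)
    have hP0 := condExp_indicator_eq_self h𝒢' hB (comap_measurable (P 0)) (hiP 0 h0T).1
    have hY0' := condExp_indicator_eq_self (X := fun ω => (P 0 ω)⁻¹) h𝒢' hB
      (measurable_matrix_inv.comp (comap_measurable (P 0))) (hiY 0 h0T).1
    have hmean := ae_condMean_eq hP0m ((hP.adapted T hTT).mono (ℱ.le T) le_rfl) hsm (hiP T hTT).1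
    have htan : ∀ᵐ ω ∂μ, ∀ m k : ℕ, k ≤ 2 ^ m → ω ∈ P 0 ⁻¹' s →
        ∀ Z : Matrix (Fin n) (Fin n) ℝ, Z + Zᵀ - Z *
          μ[(P 0 ⁻¹' s).indicator fun ω => (P (gridPt T m k) ω)⁻¹ |
            MeasurableSpace.comap (P 0) instMeasurableSpaceMatrix] ω * Zᵀ ≤
          μ[(P 0 ⁻¹' s).indicator (P (gridPt T m k)) |
            MeasurableSpace.comap (P 0) instMeasurableSpaceMatrix] ω := by
      refine ae_all_iff.2 fun m => ae_all_iff.2 fun k => ?_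
      by_cases hk : k ≤ 2 ^ m
      · have hg := gridPt_mem hT hk
        filter_upwards [ae_tangent_le_condExp h𝒢' hB (hiP _ hg).1 (hiY _ hg).1
          (hpaths.mono fun ω h Z => tangent_le_of_posDef (h.1 _ hg) Z)] with ω hω _ using hω
      · exact Eventually.of_forall fun ω h => absurd h hk
    filter_upwards [hsubP, hsubY, hmean, htan, hY, hY0, hPh, hPh0]
      with ω a1 a2 a3 a4 a5 a6 a7 a8 hω
    have hωB : ω ∈ P 0 ⁻¹' s := hω
    rw [a3 hω]
    refine bracket_of_subsolutions hT hlam hQ hR (a1 hωB) (a2 hωB) a5 a7 ?_ ?_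
      fun m k hk Z => a4 m k hk hωB Z
    · rw [hP0, indicator_of_mem hωB, a8]
    · rw [hY0', indicator_of_mem hωB, a6]
  filter_upwards [ae_all_iff.2 hK] with ω hω
  obtain ⟨K, hK⟩ := exists_nat_ge (max (P 0 ω).trace ((P 0 ω)⁻¹).trace)
  exact hω K ⟨(le_max_left _ _).trans hK, (le_max_right _ _).trans hK⟩

end FinalTime

end CDKF

theorem mainTheorem2 {Ω : Type*} [mΩ : MeasurableSpace Ω] (μ : Measure Ω) [IsProbabilityMeasure μ]
    (ℱ : Filtration ℝ mΩ)
    {n M : ℕ} {p : Fin M → ℕ} (T : ℝ) (hT : 0 ≤ T)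
    (A Q : Matrix (Fin n) (Fin n) ℝ) (hQ : Q.PosSemidef)
    (H : (j : Fin M) → Matrix (Fin (p j)) (Fin n) ℝ)
    (R : (j : Fin M) → Matrix (Fin (p j)) (Fin (p j)) ℝ) (hR : ∀ j, (R j).PosDef)
    (lam : Fin M → ℝ → ℝ) (hlam : CDKF.IsSchedule T lam)
    (N : Fin M → ℝ → Ω → ℕ) (P : ℝ → Ω → Matrix (Fin n) (Fin n) ℝ)
    (hP : CDKF.IsCovProcess μ ℱ T A Q H R lam N P)
    (hmom : CDKF.FiniteMoments μ T P)
    (Yhat Phat : ℝ → Ω → Matrix (Fin n) (Fin n) ℝ)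
    (hY : ∀ᵐ ω ∂μ, CDKF.IsSolution T (CDKF.infoField A Q H R lam) (fun t => Yhat t ω))
    (hY0 : ∀ᵐ ω ∂μ, Yhat 0 ω = (P 0 ω)⁻¹)
    (hPh : ∀ᵐ ω ∂μ, CDKF.IsSolution T (CDKF.covField A Q H R lam) (fun t => Phat t ω))
    (hPh0 : ∀ᵐ ω ∂μ, Phat 0 ω = P 0 ω) :
    ∀ t ∈ Icc 0 T, ∀ᵐ ω ∂μ,
      (Yhat t ω).PosDef ∧
      (Yhat t ω)⁻¹ ≤ CDKF.condMean μ (P t) (P 0) ω ∧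
      CDKF.condMean μ (P t) (P 0) ω ≤ Phat t ω := by
  intro t ht
  -- All the data restrict to [0, t], so the bracket at the final time suffices.
  exact (hP.mono ht.2).ae_bracket ht.1 (hlam.mono ht.2) hQ hR
    (hY.mono fun _ h => h.mono ht.1 ht.2) hY0 (hPh.mono fun _ h => h.mono ht.1 ht.2) hPh0
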